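/- Work in $\mathsf{ZF}+\mathsf{DC}$; that is, let $(V,\in)$ be an arbitrary model of the first-order theory $\mathsf{ZF}$ (without the axiom of choice) in which the axiom of dependent choice $\mathsf{DC}$ holds. Here $\mathsf{DC}$ is the statement: for every non-empty set $X$ and every relation $R$ such that each $x\in X$ has some $y\in X$ with $x\mathrel{R}y$, there is a function $f:\omega\to X$ with $f(n)\mathrel{R}f(n+1)$ for all $n<\omega$. For a set $A$, let $\mathrm{L}(A)=\bigcup_{\alpha\in\mathrm{Ord}}\mathrm{L}_\alpha(A)$, where $\mathrm{L}_0(A)$ is the transitive closure of $\{A\}$, $\mathrm{L}_{\alpha+1}(A)$ is the set of all subsets of $\mathrm{L}_\alpha(A)$ that are first-order definable over $(\mathrm{L}_\alpha(A),\in)$ with parameters, and $\mathrm{L}_\gamma(A)=\bigcup_{\alpha<\gamma}\mathrm{L}_\alpha(A)$ for limit $\gamma$. For an ordinal $\theta$, let $\theta^\omega$ be the set of all functions from $\omega$ to $\theta$, and let $\mathrm{L}(\mathrm{Ord}^\omega)=\bigcup_{\theta\in\mathrm{Ord}}\mathrm{L}(\theta^\omega)$ be the Chang model. Then: 1. for every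 ordinal $\theta$, $\mathrm{L}(\theta^\omega)\vDash\mathsf{DC}$; 2. $\mathrm{L}(\mathrm{Ord}^\omega)\vDash\mathsf{DC}$. -/

import Mathlib

namespace SetModel

/-! A model of set theory is a type `M` with an arbitrary binary relation `E` (`E x y` is read
"`x ∈ y`"); it need not be well-founded. Every notion below has its quantifiers ranging over `M`, so
it is the interpretation in `(M, E)` of the corresponding first-order formula of set theory. For a
class `P`, the relation `restrict E P` on the subtype of `P` gives the relativization to `P`. -/

universe u

variable {M : Type u} (E : M → M → Prop)

/-- The only symbol of the language of set theory: a binary relation. -/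
inductive MemSymbol : ℕ → Type
  | mem : MemSymbol 2

/-- The first-order language of set theory. -/
def lang : FirstOrder.Language := ⟨fun _ => Empty, MemSymbol⟩

/-- `(M, E)` as a first-order structure for the language of set theory. -/
@[reducible] def struc : lang.Structure M where
  funMap := fun f => Empty.elim f
  RelMap := fun r => match r with
    | MemSymbol.mem => fun v => E (v 0) (v 1)

/-- The restriction of `E` to the class `P`, making `P` a model. -/
def restrict (P : M → Prop) : {x : M // P x} → {x : M // P x} → Prop :=
  fun x y => E x.1 y.1

/-! ### Basic notions -/

/-- `x ⊆ y`. -/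
def IsSubset (x y : M) : Prop := ∀ z, E z x → E z y

/-- `x = ∅`. -/
def IsEmptySet (x : M) : Prop := ∀ z, ¬ E z x

/-- `p = {a, b}`. -/
def IsUPair (a b p : M) : Prop := ∀ z, E z p ↔ z = a ∨ z = b

/-- `p = (a, b) = {{a}, {a, b}}`. -/
def IsOPair (a b p : M) : Prop :=
  ∃ s t, IsUPair E a a s ∧ IsUPair E a b t ∧ IsUPair E s t p

/-- `(a, b) ∈ r`; for a function `r` this says `r(a) = b`. -/
def PairMem (a b r : M) : Prop := ∃ p, IsOPair E a b p ∧ E p r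

/-- `s = x ∪ {x}`. -/
def IsSucc (x s : M) : Prop := ∀ z, E z s ↔ E z x ∨ z = x

/-- `x` is transitive. -/
def IsTransSet (x : M) : Prop := ∀ y, E y x → IsSubset E y x

/-- `x` is an ordinal (in the presence of Foundation): a transitive set of transitive sets. -/
def IsOrd (x : M) : Prop := IsTransSet E x ∧ ∀ y, E y x → IsTransSet E y

/-- `x` contains `∅` and is closed under `n ↦ n ∪ {n}`. -/
def IsInductive (x : M) : Prop :=
  (∃ e, IsEmptySet E e ∧ E e x) ∧ ∀ n, E n x → ∃ s, IsSucc E n s ∧ E s x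

/-- `w = ω`, the least inductive set. -/
def IsOmega (w : M) : Prop := IsInductive E w ∧ ∀ v, IsInductive E v → IsSubset E w v

/-- `n ∈ ω`. -/
def IsNat (n : M) : Prop := ∃ w, IsOmega E w ∧ E n w

/-- `f` is a function from `a` to `b`. -/
def IsFun (f a b : M) : Prop :=
  (∀ p, E p f → ∃ x y, E x a ∧ E y b ∧ IsOPair E x y p) ∧
    ∀ x, E x a → ∃! y, PairMem E x y f

/-! ### The axioms -/

/-- `(M, E)` is a model of the first-order theory `ZF`. In the two schemas, the classes are those
defined by first-order formulas with parameters from `M`. -/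
structure ZF : Prop where
  extensionality : ∀ x y, (∀ z, E z x ↔ E z y) → x = y
  foundation : ∀ x, (∃ y, E y x) → ∃ y, E y x ∧ ∀ z, E z y → ¬ E z x
  pairing : ∀ a b, ∃ p, IsUPair E a b p
  union : ∀ x, ∃ u, ∀ z, E z u ↔ ∃ y, E y x ∧ E z y
  powerset : ∀ x, ∃ p, ∀ z, E z p ↔ IsSubset E z x
  infinity : ∃ x, IsInductive E x
  separation : ∀ D : Set M, @Set.Definable₁ M Set.univ lang (struc E) D →
    ∀ a, ∃ b, ∀ x, E x b ↔ E x a ∧ x ∈ D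
  replacement : ∀ F : Set (M × M), @Set.Definable₂ M Set.univ lang (struc E) F →
    ∀ a, (∀ x, E x a → ∃! y, (x, y) ∈ F) → ∃ b, ∀ y, E y b ↔ ∃ x, E x a ∧ (x, y) ∈ F

/-- `(M, E)` satisfies the axiom of dependent choice `DC`: if `X ≠ ∅` and every `x ∈ X` has some
`y ∈ X` with `(x, y) ∈ R`, then there is `f : ω → X` with `(f(n), f(n + 1)) ∈ R` for all `n ∈ ω`. -/
def DC : Prop :=
  ∀ X R, (∃ x, E x X) → (∀ x, E x X → ∃ y, E y X ∧ PairMem E x y R) →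
    ∃ w f, IsOmega E w ∧ IsFun E f w X ∧
      ∀ n m x y, E n w → IsSucc E n m → PairMem E n x f → PairMem E m y f → PairMem E x y R

/-! ### Definable subsets of a set

For `n ∈ ω`, an `n`-ary relation on `X` is a set of functions `n → X`. The relations that are
first-order definable without parameters over `(X, ∈)` form the least family of pairs `(n, R)`, `R`
an `n`-ary relation, that contains `{s : s(i) ∈ s(j)}` and `{s : s(i) = s(j)}` and is closed under
complements, intersections and projections. -/

/-- The set of pairs `D` contains the atomic relations on `X` and has the closure properties. -/
structure DefClosed (X D : M) : Prop where
  mem : ∀ n i j R, IsNat E n → E i n → E j n →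
    (∀ s, E s R ↔ IsFun E s n X ∧ ∃ a b, PairMem E i a s ∧ PairMem E j b s ∧ E a b) →
      PairMem E n R D
  eq : ∀ n i j R, IsNat E n → E i n → E j n →
    (∀ s, E s R ↔ IsFun E s n X ∧ ∃ a, PairMem E i a s ∧ PairMem E j a s) → PairMem E n R D
  compl : ∀ n R S, IsNat E n → PairMem E n R D →
    (∀ s, E s S ↔ IsFun E s n X ∧ ¬ E s R) → PairMem E n S D
  inter : ∀ n R S T, IsNat E n → PairMem E n R D → PairMem E n S D →
    (∀ s, E s T ↔ E s R ∧ E s S) → PairMem E n T D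
  proj : ∀ n m R S, IsNat E n → IsSucc E n m → PairMem E m R D →
    (∀ s, E s S ↔ IsFun E s n X ∧ ∃ t, E t R ∧ IsSubset E s t) → PairMem E n S D

/-- `R` is an `n`-ary relation on `X` definable over `(X, ∈)` without parameters. -/
def IsDefRel (X n R : M) : Prop := ∀ D, DefClosed E X D → PairMem E n R D

/-- `x ∈ Def(X)`: `x` is a subset of `X` definable over `(X, ∈)` with parameters, i.e.
`x = {a ∈ X : s⌢⟨a⟩ ∈ R}` for some `n ∈ ω`, some `s : n → X` and some definable `(n + 1)`-ary
relation `R` on `X`. -/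
def InDef (X x : M) : Prop :=
  ∃ n m s R, IsNat E n ∧ IsSucc E n m ∧ IsFun E s n X ∧ IsDefRel E X m R ∧
    ∀ a, E a x ↔ E a X ∧ ∃ t, E t R ∧ IsSubset E s t ∧ PairMem E n a t

/-! ### The models `L(A)` -/

/-- `T` is the transitive closure of `{A}`. -/
def IsTC (A T : M) : Prop :=
  (E A T ∧ IsTransSet E T) ∧ ∀ S, E A S → IsTransSet E S → IsSubset E T S

/-- `f` is the function `β ↦ L_β(A)` on `d`, for the hierarchy
`L_β(A) = tc({A}) ∪ ⋃_{γ < β} Def(L_γ(A))`. As `X ⊆ Def(X)` for transitive `X`, this is the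
usual one: `L_0(A) = tc({A})`, `L_{β+1}(A) = Def(L_β(A))`, unions at limits. -/
def IsHierarchy (A d f : M) : Prop :=
  ∃ T c, IsTC E A T ∧ IsFun E f d c ∧
    ∀ β Y, PairMem E β Y f →
      ∀ x, E x Y ↔ E x T ∨ ∃ γ Z, E γ β ∧ PairMem E γ Z f ∧ InDef E Z x

/-- `x ∈ L(A)`, i.e. `x ∈ L_β(A)` for some ordinal `β`. -/
def InL (A x : M) : Prop :=
  ∃ d f β Y, IsOrd E d ∧ IsHierarchy E A d f ∧ PairMem E β Y f ∧ E x Y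

/-- `A = θ^ω`, the set of all functions from `ω` to `θ`. -/
def IsOmegaPower (θ A : M) : Prop := ∀ f, E f A ↔ ∃ w, IsOmega E w ∧ IsFun E f w θ

/-- `x ∈ L(θ^ω)`. -/
def InLOmegaPower (θ x : M) : Prop := ∃ A, IsOmegaPower E θ A ∧ InL E A x

/-- `x ∈ L(Ord^ω) = ⋃_{θ ∈ Ord} L(θ^ω)`, the Chang model. -/
def InChang (x : M) : Prop := ∃ θ, IsOrd E θ ∧ InLOmegaPower E θ x

end SetModel

/-! Let `A = θ^ω` with `θ > 0`. Every element of `L(A)` is built from ordinals, `A` itself and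
finitely many members of `A`, and finitely many `ω`-sequences can be coded by a single one. For `a ∈
A` consider the hull of `a`: a class containing all ordinals and closed under a fixed finite list of
functions with parameter `a`, among them `β ↦ L_β(A)`, the operations generating definable
relations, and `k ↦` the `k`-th sequence coded by `a`. These hulls cover `L(A)` (`exists_good_Lv`),
and each is enumerated along the ordinals, definably and uniformly in `a` (`hull_of_new`,
`Hull.closed`). So a set that meets the hull of `a` has an `a`-first element, and choosing elements
of `L(A)` reduces to choosing members of `A`.

Let `R` be total on `X`, both in `L(A)`. In `V`, `DC` on `X × A` yields pairs `(x_n, a_n)` in which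
`x_{n+1}` is the `a_{n+1}`-first `R`-successor of `x_n`. All the `a_n` are coded by one `h : ω → θ`.
As `A` contains every such function of `V`, `h` belongs to `L(A)`, and recursion inside `L(A)`
recovers `(x_n)` from `x_0` and `h` (`dc_inL_funs`).

This needs `L(A)` to satisfy `ZF` (`InL.zfm`, by reflection) and to compute its levels correctly
(`val_Lv`), so that the covering by hulls can be carried out inside `L(A)`. For `θ = 0` one has
`L(0^ω) = L(1^ω)`. For the Chang model, `X` and `R` lie in a common `L(θ^ω)`, and the sequence found
there still works.

The model may be ill-founded and its `ω` nonstandard, so induction, recursion and finite sequences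
are internal, and separation, replacement and induction are available for definable predicates only.
Definability is therefore a type class (`Dfn`, `DFun`), discharged by instance search. Only single
formulas `Fml` are external. -/

namespace SetModel
universe u

/-! ### First-order formulas and definable predicates -/

/-- First-order formulas of set theory with `n` free variables; quantifiers bind the last one. -/
inductive Fml : ℕ → Type
  | mem {n : ℕ} (i j : Fin n) : Fml n
  | eq {n : ℕ} (i j : Fin n) : Fml n
  | neg {n : ℕ} (φ : Fml n) : Fml n
  | and {n : ℕ} (φ ψ : Fml n) : Fml n
  | ex {n : ℕ} (φ : Fml (n + 1)) : Fml n

/-- A type with a membership relation. -/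
class SetStr (M : Type u) where
  /-- The membership relation. -/
  mem : M → M → Prop

infix:50 "ε" => SetStr.mem

/-- A subclass carries the restricted membership relation. -/
instance SetStr.subtype {M : Type u} [SetStr M] (P : M → Prop) : SetStr {x : M // P x} :=
  ⟨restrict SetStr.mem P⟩

/-- Extend a tuple by a last entry. -/
abbrev snoc {M : Type u} {n : ℕ} (v : Fin n → M) (y : M) : Fin (n + 1) → M :=
  Fin.snoc (α := fun _ => M) v y

section
variable {M : Type u} [SetStr M]

/-- Satisfaction of a formula. -/
def Fml.Sat : {n : ℕ} → Fml n → (Fin n → M) → Prop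
  | _, .mem i j, v => v i ε v j
  | _, .eq i j, v => v i = v j
  | _, .neg φ, v => ¬ φ.Sat v
  | _, .and φ ψ, v => φ.Sat v ∧ ψ.Sat v
  | _, .ex φ, v => ∃ y, φ.Sat (snoc v y)

/-- Renaming of free variables. -/
def Fml.rename : {n m : ℕ} → (Fin n → Fin m) → Fml n → Fml m
  | _, _, f, .mem i j => .mem (f i) (f j)
  | _, _, f, .eq i j => .eq (f i) (f j)
  | _, _, f, .neg φ => .neg (φ.rename f)
  | _, _, f, .and φ ψ => .and (φ.rename f) (ψ.rename f)
  | _, m, f, .ex φ => .ex (φ.rename (snoc (fun i => (f i).castSucc) (Fin.last m)))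

theorem Fml.sat_rename {n m : ℕ} (f : Fin n → Fin m) (φ : Fml n) (v : Fin m → M) :
    (φ.rename f).Sat v ↔ φ.Sat (fun i => v (f i)) := by
  induction φ generalizing m with
  | mem i j => rfl
  | eq i j => rfl
  | neg φ ih => exact not_congr (ih f v)
  | and φ ψ ih1 ih2 => exact and_congr (ih1 f v) (ih2 f v)
  | ex φ ih =>
    refine exists_congr fun y => (ih _ _).trans (iff_of_eq (congrArg _ ?_))
    funext i
    refine Fin.lastCases ?_ (fun i => ?_) i <;> simp [snoc]

/-- The value of a variable or constant. -/
def ev {n : ℕ} (v : Fin n → M) : M ⊕ Fin n → M := Sum.elim id v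

/-- `P` is first-order definable with parameters. -/
class Dfn {n : ℕ} (P : (Fin n → M) → Prop) : Prop where
  -- The map `t` sends each free variable of `φ` to a parameter or to a coordinate, so a
  -- substitution changes `t` and leaves `φ` alone.
  out : ∃ (k : ℕ) (φ : Fml k) (t : Fin k → M ⊕ Fin n), ∀ v, P v ↔ φ.Sat fun i => ev v (t i)

/-- `F` is a definable function. -/
class DFun {n : ℕ} (F : (Fin n → M) → M) : Prop where
  out : Dfn fun w : Fin (n + 1) → M => w (Fin.last n) = F fun i => w i.castSucc

/-! ### Closure of definability under connectives, quantifiers and composition -/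

theorem Dfn.congr {n : ℕ} {P Q : (Fin n → M) → Prop} (hP : Dfn P) (h : ∀ v, Q v ↔ P v) : Dfn Q :=
  (funext fun v => propext (h v) : Q = P) ▸ hP

/-- Substitution of variables and constants. -/
theorem Dfn.subst {n m : ℕ} {P : (Fin m → M) → Prop} (hP : Dfn P) (t : Fin m → M ⊕ Fin n) :
    Dfn fun v => P fun i => ev v (t i) := by
  obtain ⟨k, φ, s, h⟩ := hP.out
  refine ⟨k, φ, fun i => Sum.elim Sum.inl t (s i), fun v => (h _).trans (iff_of_eq (congrArg _ ?_))⟩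
  funext i
  dsimp only
  rcases s i with c | j <;> rfl

/-- A definable predicate in normal form, with the last variable separated. -/
theorem Dfn.last {n : ℕ} {P : (Fin (n + 1) → M) → Prop} (hP : Dfn P) :
    ∃ (k : ℕ) (φ : Fml (k + 1)) (t : Fin k → M ⊕ Fin n),
      ∀ v y, P (snoc v y) ↔ φ.Sat (snoc (fun i => ev v (t i)) y) := by
  obtain ⟨k, φ, t, h⟩ := hP.out
  by_cases hM : Nonempty M
  · obtain ⟨c⟩ := hM
    -- A variable that `t` sends to the last coordinate is renamed to the new variable. Its old slot
    -- becomes vacuous and receives the dummy parameter `c`, hence the split on whether `M` is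
    -- non-empty.
    refine ⟨k, φ.rename fun i => Sum.elim (fun _ => i.castSucc)
      (Fin.lastCases (motive := fun _ => Fin (k + 1)) (Fin.last k) fun _ => i.castSucc) (t i),
      fun i => Sum.elim Sum.inl
        (Fin.lastCases (motive := fun _ => M ⊕ Fin n) (Sum.inl c) Sum.inr) (t i), fun v y => ?_⟩
    rw [h, Fml.sat_rename]
    refine iff_of_eq (congrArg _ (funext fun i => ?_))
    rcases hti : t i with d | j
    · simp [ev, snoc, hti]
    · refine Fin.lastCases (fun hti => ?_) (fun j hti => ?_) j hti <;> simp [ev, snoc, hti]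
  · exact ⟨0, .eq 0 0, Fin.elim0, fun v y => (hM ⟨y⟩).elim⟩

instance (priority := low) Dfn.const {n : ℕ} (p : Prop) : Dfn fun _ : Fin n → M => p := by
  by_cases hp : p
  · exact ⟨0, .neg (.ex (.neg (.eq 0 0))), Fin.elim0, fun v => by simp [hp, Fml.Sat]⟩
  · by_cases hM : Nonempty M
    · exact ⟨0, .ex (.neg (.eq 0 0)), Fin.elim0, fun v => by simp [hp, Fml.Sat]⟩
    · exact ⟨0, .ex (.eq 0 0), Fin.elim0, fun v => by simpa [hp, Fml.Sat] using hM⟩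

instance Dfn.not {n : ℕ} {P : (Fin n → M) → Prop} [hP : Dfn P] : Dfn fun v => ¬ P v := by
  obtain ⟨k, φ, t, h⟩ := hP.out
  exact ⟨k, .neg φ, t, fun v => not_congr (h v)⟩

instance Dfn.and {n : ℕ} {P Q : (Fin n → M) → Prop} [hP : Dfn P] [hQ : Dfn Q] :
    Dfn fun v => P v ∧ Q v := by
  obtain ⟨k, φ, t, h⟩ := hP.out
  obtain ⟨l, ψ, s, h'⟩ := hQ.out
  refine ⟨k + l, .and (φ.rename (Fin.castAdd l)) (ψ.rename (Fin.natAdd k)), Fin.append t s,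
    fun v => and_congr ?_ ?_⟩
  · rw [h, Fml.sat_rename]; simp
  · rw [h', Fml.sat_rename]; simp

instance Dfn.or {n : ℕ} {P Q : (Fin n → M) → Prop} [hP : Dfn P] [hQ : Dfn Q] :
    Dfn fun v => P v ∨ Q v :=
  Dfn.congr (P := fun v => ¬ (¬ P v ∧ ¬ Q v)) inferInstance fun v => by tauto

instance Dfn.imp {n : ℕ} {P Q : (Fin n → M) → Prop} [hP : Dfn P] [hQ : Dfn Q] :
    Dfn fun v => P v → Q v :=
  Dfn.congr (P := fun v => ¬ (P v ∧ ¬ Q v)) inferInstance fun v => by tauto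

instance Dfn.iff {n : ℕ} {P Q : (Fin n → M) → Prop} [hP : Dfn P] [hQ : Dfn Q] :
    Dfn fun v => P v ↔ Q v :=
  Dfn.congr (P := fun v => (P v → Q v) ∧ (Q v → P v)) inferInstance fun v => by tauto

theorem Dfn.ex_snoc {n : ℕ} {P : (Fin (n + 1) → M) → Prop} (hP : Dfn P) :
    Dfn fun v => ∃ y, P (snoc v y) := by
  obtain ⟨k, φ, t, h⟩ := hP.last
  exact ⟨k, .ex φ, t, fun v => exists_congr fun y => h v y⟩

instance Dfn.ex {n : ℕ} {P : (Fin n → M) → M → Prop}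
    [hP : Dfn fun w : Fin (n + 1) → M => P (fun i => w i.castSucc) (w (Fin.last n))] :
    Dfn fun v => ∃ y, P v y :=
  hP.ex_snoc.congr fun v => by simp [snoc]

instance Dfn.all {n : ℕ} {P : (Fin n → M) → M → Prop}
    [hP : Dfn fun w : Fin (n + 1) → M => P (fun i => w i.castSucc) (w (Fin.last n))] :
    Dfn fun v => ∀ y, P v y :=
  Dfn.congr (P := fun v => ¬ ∃ y, ¬ P v y) inferInstance fun v => by push Not; rfl

theorem Dfn.mem_term {n : ℕ} (s t : M ⊕ Fin n) : Dfn fun v : Fin n → M => ev v s ε ev v t :=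
  ⟨2, .mem 0 1, ![s, t], fun _ => Iff.rfl⟩

theorem Dfn.eq_term {n : ℕ} (s t : M ⊕ Fin n) : Dfn fun v : Fin n → M => ev v s = ev v t :=
  ⟨2, .eq 0 1, ![s, t], fun _ => Iff.rfl⟩

instance (priority := high) DFun.proj {n : ℕ} (i : Fin n) : DFun fun v : Fin n → M => v i :=
  ⟨Dfn.eq_term (Sum.inr (Fin.last n)) (Sum.inr i.castSucc)⟩

instance (priority := high) DFun.const {n : ℕ} (c : M) : DFun fun _ : Fin n → M => c :=
  ⟨Dfn.eq_term (Sum.inr (Fin.last n)) (Sum.inl c)⟩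

theorem DFun.weaken {n : ℕ} {F : (Fin n → M) → M} (hF : DFun F) :
    DFun fun w : Fin (n + 1) → M => F fun i => w i.castSucc :=
  ⟨(hF.out.subst (snoc (fun i => Sum.inr i.castSucc.castSucc) (Sum.inr (Fin.last _)))).congr
    fun w => by simp [snoc, ev]⟩

/-- Substitution of a definable function for the last variable. -/
theorem Dfn.subst_last {n : ℕ} {P : (Fin n → M) → M → Prop} {F : (Fin n → M) → M}
    (hP : Dfn fun w : Fin (n + 1) → M => P (fun i => w i.castSucc) (w (Fin.last n)))
    (hF : DFun F) : Dfn fun v => P v (F v) :=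
  Dfn.congr (P := fun v => ∃ y, y = F v ∧ P v y) (@Dfn.ex _ _ _ _ (@Dfn.and _ _ _ _ _ hF.out hP))
    fun v => by simp

/-- With this and its analogues of higher arity, a notion has to be shown definable only for
variables; arbitrary definable terms are then substituted one argument at a time. -/
theorem Dfn.app1 {R : M → Prop} (hR : Dfn fun v : Fin 1 → M => R (v 0)) {n : ℕ}
    {F : (Fin n → M) → M} (hF : DFun F) : Dfn fun v => R (F v) :=
  Dfn.subst_last (P := fun _ x => R x) (hR.subst ![Sum.inr (Fin.last n)]) hF

theorem Dfn.app2 {R : M → M → Prop} (hR : Dfn fun v : Fin 2 → M => R (v 0) (v 1)) {n : ℕ}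
    {F G : (Fin n → M) → M} (hF : DFun F) (hG : DFun G) : Dfn fun v => R (F v) (G v) :=
  Dfn.subst_last (P := fun v x => R x (G v)) (Dfn.subst_last
    (P := fun w y => R (w (Fin.last n)) y)
    (hR.subst ![Sum.inr (Fin.last n).castSucc, Sum.inr (Fin.last _)]) hG.weaken) hF

theorem Dfn.app3 {R : M → M → M → Prop} (hR : Dfn fun v : Fin 3 → M => R (v 0) (v 1) (v 2)) {n : ℕ}
    {F G H : (Fin n → M) → M} (hF : DFun F) (hG : DFun G) (hH : DFun H) :
    Dfn fun v => R (F v) (G v) (H v) :=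
  Dfn.subst_last (P := fun v x => R x (G v) (H v)) (Dfn.subst_last
    (P := fun w y => R (w (Fin.last n)) y (H fun i => w i.castSucc)) (Dfn.subst_last
    (P := fun w z => R (w (Fin.last n).castSucc) (w (Fin.last _)) z)
    (hR.subst ![Sum.inr (Fin.last n).castSucc.castSucc, Sum.inr (Fin.last _).castSucc,
      Sum.inr (Fin.last _)]) hH.weaken.weaken) hG.weaken) hF

theorem Dfn.app4 {R : M → M → M → M → Prop}
    (hR : Dfn fun v : Fin 4 → M => R (v 0) (v 1) (v 2) (v 3)) {n : ℕ}
    {F G H K : (Fin n → M) → M} (hF : DFun F) (hG : DFun G) (hH : DFun H) (hK : DFun K) :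
    Dfn fun v => R (F v) (G v) (H v) (K v) :=
  Dfn.subst_last (P := fun v x => R x (G v) (H v) (K v)) (Dfn.subst_last
    (P := fun w y => R (w (Fin.last n)) y (H fun i => w i.castSucc) (K fun i => w i.castSucc))
    (Dfn.subst_last (P := fun w z => R (w (Fin.last n).castSucc) (w (Fin.last _)) z
      (K fun i => w i.castSucc.castSucc)) (Dfn.subst_last
    (P := fun w z => R (w (Fin.last n).castSucc.castSucc) (w (Fin.last _).castSucc)
      (w (Fin.last _)) z)
    (hR.subst ![Sum.inr (Fin.last n).castSucc.castSucc.castSucc,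
      Sum.inr (Fin.last _).castSucc.castSucc, Sum.inr (Fin.last _).castSucc,
      Sum.inr (Fin.last _)]) hK.weaken.weaken.weaken) hH.weaken.weaken) hG.weaken) hF

theorem DFun.app1 {H : M → M} (hH : DFun fun v : Fin 1 → M => H (v 0)) {n : ℕ}
    {F : (Fin n → M) → M} (hF : DFun F) : DFun fun v => H (F v) :=
  ⟨Dfn.app2 (R := fun x y => y = H x) hH.out hF.weaken (DFun.proj _)⟩

theorem DFun.app2 {H : M → M → M} (hH : DFun fun v : Fin 2 → M => H (v 0) (v 1)) {n : ℕ}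
    {F G : (Fin n → M) → M} (hF : DFun F) (hG : DFun G) : DFun fun v => H (F v) (G v) :=
  ⟨Dfn.app3 (R := fun x y z => z = H x y) hH.out hF.weaken hG.weaken (DFun.proj _)⟩

theorem DFun.app3 {H : M → M → M → M} (hH : DFun fun v : Fin 3 → M => H (v 0) (v 1) (v 2)) {n : ℕ}
    {F G K : (Fin n → M) → M} (hF : DFun F) (hG : DFun G) (hK : DFun K) :
    DFun fun v => H (F v) (G v) (K v) :=
  ⟨Dfn.app4 (R := fun x y z w => w = H x y z) hH.out hF.weaken hG.weaken hK.weaken (DFun.proj _)⟩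

theorem DFun.of_graph {n : ℕ} {F : (Fin n → M) → M} {G : (Fin n → M) → M → Prop}
    (hG : Dfn fun w : Fin (n + 1) → M => G (fun i => w i.castSucc) (w (Fin.last n)))
    (h : ∀ v y, y = F v ↔ G v y) : DFun F :=
  ⟨hG.congr fun _ => h _ _⟩

/-- Fixing all variables but the last one. -/
theorem Dfn.section_last {n : ℕ} {P : (Fin n → M) → M → Prop}
    (hP : Dfn fun w : Fin (n + 1) → M => P (fun i => w i.castSucc) (w (Fin.last n)))
    (v : Fin n → M) : Dfn fun w : Fin 1 → M => P v (w 0) :=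
  (hP.subst (snoc (fun i => Sum.inl (v i)) (Sum.inr 0))).congr fun w => by simp [snoc, ev]

theorem DFun.section_last {n : ℕ} {F : (Fin n → M) → M → M}
    (hF : DFun fun w : Fin (n + 1) → M => F (fun i => w i.castSucc) (w (Fin.last n)))
    (v : Fin n → M) : DFun fun w : Fin 1 → M => F v (w 0) :=
  ⟨(hF.out.subst (snoc (snoc (fun i => Sum.inl (v i)) (Sum.inr 0)) (Sum.inr 1))).congr
    fun w => by simp [snoc, ev]⟩

instance (priority := high) Dfn.mem {n : ℕ} {F G : (Fin n → M) → M} [hF : DFun F] [hG : DFun G] :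
    Dfn fun v => F v ε G v :=
  Dfn.app2 (R := fun x y => x ε y) (Dfn.mem_term (Sum.inr 0) (Sum.inr 1)) hF hG

instance (priority := high) Dfn.eq {n : ℕ} {F G : (Fin n → M) → M} [hF : DFun F] [hG : DFun G] :
    Dfn fun v => F v = G v :=
  Dfn.app2 (R := fun x y => x = y) (Dfn.eq_term (Sum.inr 0) (Sum.inr 1)) hF hG

instance Dfn.existsUnique {n : ℕ} {P : (Fin n → M) → M → Prop}
    [hP : Dfn fun w : Fin (n + 1) → M => P (fun i => w i.castSucc) (w (Fin.last n))] :
    Dfn fun v => ∃! y, P v y := by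
  have : Dfn fun w : Fin (n + 1 + 1) → M => P (fun i => w i.castSucc.castSucc) (w (Fin.last _)) :=
    (hP.subst (snoc (fun i => Sum.inr i.castSucc.castSucc) (Sum.inr (Fin.last _)))).congr
      fun w => by simp [snoc, ev]
  unfold ExistsUnique
  infer_instance

open Classical in
instance DFun.ite {n : ℕ} {P : (Fin n → M) → Prop} {F G : (Fin n → M) → M} [hP : Dfn P]
    [hF : DFun F] [hG : DFun G] : DFun fun v => if P v then F v else G v := by
  have h1 := hF.out
  have h2 := hG.out
  have h3 : Dfn fun w : Fin (n + 1) → M => P fun i => w i.castSucc :=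
    hP.subst fun i => Sum.inr i.castSucc
  refine DFun.of_graph (G := fun v y => (P v ∧ y = F v) ∨ (¬ P v ∧ y = G v)) inferInstance
    fun v y => ?_
  by_cases h : P v <;> simp [h]

/-- A predicate definable over a subclass `Q` is, relativized, definable over the whole model. -/
theorem Dfn.relativize {Q : M → Prop} [hQ : Dfn fun v : Fin 1 → M => Q (v 0)] {n : ℕ}
    {P : (Fin n → {x // Q x}) → Prop} (hP : Dfn P) :
    Dfn fun v : Fin n → M => ∃ h : ∀ i, Q (v i), P fun i => ⟨v i, h i⟩ := by
  -- The usual relativization by induction on `φ`. Membership of all arguments in `Q` is carried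
  -- along because satisfaction in the subclass makes sense only then.
  have key : ∀ {k : ℕ} (φ : Fml k), Dfn fun v : Fin k → M =>
      ∃ h : ∀ i, Q (v i), φ.Sat (M := {x // Q x}) fun i => ⟨v i, h i⟩ := by
    have all : ∀ k : ℕ, Dfn fun v : Fin k → M => ∀ i, Q (v i) := by
      intro k
      induction k with
      | zero => exact (Dfn.const True).congr fun v => by simp
      | succ k ih =>
        have h1 : Dfn fun v : Fin (k + 1) → M => ∀ i : Fin k, Q (v i.castSucc) :=
          ih.subst fun i => Sum.inr i.castSucc
        have h2 : Dfn fun v : Fin (k + 1) → M => Q (v (Fin.last k)) := hQ.app1 (DFun.proj _)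
        exact (Dfn.and (hP := h1) (hQ := h2)).congr fun v => Fin.forall_fin_succ'
    intro k φ
    induction φ with
    | mem i j =>
      exact Dfn.congr (P := fun v => (∀ i, Q (v i)) ∧ v i ε v j)
        (Dfn.and (hP := all _)) fun v => ⟨fun ⟨h, h'⟩ => ⟨h, h'⟩, fun ⟨h, h'⟩ => ⟨h, h'⟩⟩
    | eq i j =>
      exact Dfn.congr (P := fun v => (∀ i, Q (v i)) ∧ v i = v j)
        (Dfn.and (hP := all _)) fun v => by simp [Fml.Sat]
    | neg φ ih =>
      exact (Dfn.and (hP := all _) (hQ := Dfn.not (hP := ih))).congr fun v => by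
        simp only [Fml.Sat]
        exact ⟨fun ⟨h, h'⟩ => ⟨h, fun ⟨_, h2⟩ => h' h2⟩, fun ⟨h, h'⟩ => ⟨h, fun h2 => h' ⟨h, h2⟩⟩⟩
    | and φ ψ ih1 ih2 =>
      exact (Dfn.and (hP := ih1) (hQ := ih2)).congr fun v => by
        simp only [Fml.Sat]
        exact ⟨fun ⟨h, h', h''⟩ => ⟨⟨h, h'⟩, ⟨h, h''⟩⟩, fun ⟨⟨h, h'⟩, ⟨_, h''⟩⟩ => ⟨h, h', h''⟩⟩
    | @ex k φ ih =>
      refine ih.ex_snoc.congr fun v => ?_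
      simp only [Fml.Sat]
      constructor
      · rintro ⟨h, y, hy⟩
        have h' : ∀ i, Q (snoc v y.1 i) := fun i => by
          refine Fin.lastCases ?_ (fun i => ?_) i
          · simpa [snoc] using y.2
          · simpa [snoc] using h i
        refine ⟨y.1, h', ?_⟩
        convert hy using 1
        funext i
        refine Fin.lastCases ?_ (fun i => ?_) i <;> simp [snoc]
      · rintro ⟨y, h, hy⟩
        have hQy : Q y := by simpa [snoc] using h (Fin.last k)
        refine ⟨fun i => by simpa [snoc] using h i.castSucc, ⟨y, hQy⟩, ?_⟩
        convert hy using 1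
        funext i
        refine Fin.lastCases ?_ (fun i => ?_) i <;> simp [snoc]
  obtain ⟨k, φ, t, h⟩ := hP.out
  -- Applied to a valid formula, `key` leaves just the condition that all entries lie in `Q`.
  have hall : Dfn fun v : Fin n → M => ∀ i, Q (v i) :=
    ((key (.neg (.ex (.neg (.eq 0 0)))) : Dfn fun v : Fin n → M => _)).congr fun v => by
      simp [Fml.Sat]
  refine (Dfn.and (hP := hall)
    (hQ := (key φ).subst fun i => Sum.map Subtype.val id (t i))).congr fun v => ?_
  constructor
  · rintro ⟨hv, hp⟩
    rw [h] at hp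
    have hev : ∀ i, ev v (Sum.map Subtype.val id (t i)) =
        (ev (fun i => (⟨v i, hv i⟩ : {x // Q x})) (t i)).1 := fun i => by
      rcases t i with c | j <;> rfl
    refine ⟨hv, fun i => (congrArg Q (hev i)).mpr (ev _ (t i)).2, ?_⟩
    convert hp using 2
    exact Subtype.ext (hev _)
  · rintro ⟨hv, hp, hp'⟩
    refine ⟨hv, (h _).2 ?_⟩
    convert hp' using 2 with i
    refine Subtype.ext ?_
    show _ = ev v _
    rcases t i with c | j <;> rfl

end

/-! ### Instances for the basic notions -/

section
variable {M : Type u} [SetStr M] {n : ℕ} {F G H K : (Fin n → M) → M}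
  [hF : DFun F] [hG : DFun G] [hH : DFun H] [hK : DFun K]

instance Dfn.isSubset : Dfn fun v => IsSubset SetStr.mem (F v) (G v) :=
  Dfn.app2 (by unfold IsSubset; infer_instance) hF hG

instance Dfn.isEmptySet : Dfn fun v => IsEmptySet SetStr.mem (F v) :=
  Dfn.app1 (by unfold IsEmptySet; infer_instance) hF

instance Dfn.isUPair : Dfn fun v => IsUPair SetStr.mem (F v) (G v) (H v) :=
  Dfn.app3 (by unfold IsUPair; infer_instance) hF hG hH

instance Dfn.isOPair : Dfn fun v => IsOPair SetStr.mem (F v) (G v) (H v) :=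
  Dfn.app3 (by unfold IsOPair; infer_instance) hF hG hH

instance Dfn.pairMem : Dfn fun v => PairMem SetStr.mem (F v) (G v) (H v) :=
  Dfn.app3 (by unfold PairMem; infer_instance) hF hG hH

instance Dfn.isSucc : Dfn fun v => IsSucc SetStr.mem (F v) (G v) :=
  Dfn.app2 (by unfold IsSucc; infer_instance) hF hG

instance Dfn.isTransSet : Dfn fun v => IsTransSet SetStr.mem (F v) :=
  Dfn.app1 (by unfold IsTransSet; infer_instance) hF

instance Dfn.isOrd : Dfn fun v => IsOrd SetStr.mem (F v) :=
  Dfn.app1 (by unfold IsOrd; infer_instance) hF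

instance Dfn.isInductive : Dfn fun v => IsInductive SetStr.mem (F v) :=
  Dfn.app1 (by unfold IsInductive; infer_instance) hF

instance Dfn.isOmega : Dfn fun v => IsOmega SetStr.mem (F v) :=
  Dfn.app1 (by unfold IsOmega; infer_instance) hF

instance Dfn.isNat : Dfn fun v => IsNat SetStr.mem (F v) :=
  Dfn.app1 (by unfold IsNat; infer_instance) hF

instance Dfn.isFun : Dfn fun v => IsFun SetStr.mem (F v) (G v) (H v) :=
  Dfn.app3 (by unfold IsFun; infer_instance) hF hG hH

set_option synthInstance.maxSize 2000 in
set_option synthInstance.maxHeartbeats 400000 in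
instance Dfn.defClosed : Dfn fun v => DefClosed SetStr.mem (F v) (G v) :=
  Dfn.app2 (Dfn.congr (P := fun v : Fin 2 → M =>
  (∀ n i j R, IsNat SetStr.mem n → i ε n → j ε n →
    (∀ s, s ε R ↔ IsFun SetStr.mem s n (v 0) ∧ ∃ a b, PairMem SetStr.mem i a s ∧ PairMem SetStr.mem j b s ∧ a ε b) →
      PairMem SetStr.mem n R (v 1)) ∧
  (∀ n i j R, IsNat SetStr.mem n → i ε n → j ε n →
    (∀ s, s ε R ↔ IsFun SetStr.mem s n (v 0) ∧ ∃ a, PairMem SetStr.mem i a s ∧ PairMem SetStr.mem j a s) → PairMem SetStr.mem n R (v 1)) ∧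
  (∀ n R S, IsNat SetStr.mem n → PairMem SetStr.mem n R (v 1) →
    (∀ s, s ε S ↔ IsFun SetStr.mem s n (v 0) ∧ ¬ s ε R) → PairMem SetStr.mem n S (v 1)) ∧
  (∀ n R S T, IsNat SetStr.mem n → PairMem SetStr.mem n R (v 1) → PairMem SetStr.mem n S (v 1) →
    (∀ s, s ε T ↔ s ε R ∧ s ε S) → PairMem SetStr.mem n T (v 1)) ∧
  (∀ n m R S, IsNat SetStr.mem n → IsSucc SetStr.mem n m → PairMem SetStr.mem m R (v 1) →
    (∀ s, s ε S ↔ IsFun SetStr.mem s n (v 0) ∧ ∃ t, t ε R ∧ IsSubset SetStr.mem s t) → PairMem SetStr.mem n S (v 1)))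
   (by infer_instance) fun v => ⟨fun ⟨a, b, c, d, e⟩ => ⟨a, b, c, d, e⟩, fun ⟨a, b, c, d, e⟩ => ⟨a, b, c, d, e⟩⟩) hF hG

instance Dfn.isDefRel : Dfn fun v => IsDefRel SetStr.mem (F v) (G v) (H v) :=
  Dfn.app3 (by unfold IsDefRel; infer_instance) hF hG hH

instance Dfn.inDef : Dfn fun v => InDef SetStr.mem (F v) (G v) :=
  Dfn.app2 (by unfold InDef; infer_instance) hF hG

instance Dfn.isTC : Dfn fun v => IsTC SetStr.mem (F v) (G v) :=
  Dfn.app2 (by unfold IsTC; infer_instance) hF hG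

instance Dfn.isHierarchy : Dfn fun v => IsHierarchy SetStr.mem (F v) (G v) (H v) :=
  Dfn.app3 (by unfold IsHierarchy; infer_instance) hF hG hH

instance Dfn.inL : Dfn fun v => InL SetStr.mem (F v) (G v) :=
  Dfn.app2 (by unfold InL; infer_instance) hF hG

end
end SetModel

namespace SetModel
universe u
open SetStr

/-! ### Models of `ZF` -/

/-- The axioms of `ZF`, with the schemas stated for definable predicates and functions. -/
class ZFM (M : Type u) [SetStr M] : Prop where
  ext' : ∀ x y : M, (∀ z, z ε x ↔ z ε y) → x = y
  foundation : ∀ x : M, (∃ y, y ε x) → ∃ y, y ε x ∧ ∀ z, z ε y → ¬ z ε x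
  pairing : ∀ a b : M, ∃ p, ∀ z, z ε p ↔ z = a ∨ z = b
  union : ∀ x : M, ∃ u, ∀ z, z ε u ↔ ∃ y, y ε x ∧ z ε y
  powerset : ∀ x : M, ∃ p, ∀ z, z ε p ↔ IsSubset mem z x
  infinity : ∃ x : M, IsInductive mem x
  separation : ∀ P : M → Prop, (Dfn fun v : Fin 1 → M => P (v 0)) →
    ∀ a, ∃ b, ∀ x, x ε b ↔ x ε a ∧ P x
  replacement : ∀ F : M → M, (DFun fun v : Fin 1 → M => F (v 0)) →
    ∀ a, ∃ b, ∀ y, y ε b ↔ ∃ x, x ε a ∧ y = F x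

section
variable {M : Type u} [SetStr M]

/-- The bridge to Mathlib's `Set.Definable`, in which the schemas of `ZF` are stated. An existential
quantifier corresponds to the image of a definable set under dropping the last coordinate. -/
theorem Fml.definable_sat {k : ℕ} (φ : Fml k) : ∀ {n : ℕ} (t : Fin k → M ⊕ Fin n),
    @Set.Definable M Set.univ lang (struc SetStr.mem) (Fin n) {v | φ.Sat fun i => ev v (t i)} := by
  let := struc (M := M) SetStr.mem
  let tm : ∀ {n : ℕ}, M ⊕ Fin n → (lang.withConstants (Set.univ : Set M)).Term (Fin n) := fun t =>
    Sum.elim (fun c => (lang.con (⟨c, trivial⟩ : (Set.univ : Set M))).term) (fun i => .var i) t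
  have htm : ∀ {n : ℕ} (t : M ⊕ Fin n) (v : Fin n → M), (tm t).realize v = ev v t := by
    rintro n (c | i) v
    · simp only [tm, ev, Sum.elim_inl, id]
      exact FirstOrder.Language.Term.realize_con
    · rfl
  induction φ with
  | mem i j =>
    intro n t
    refine ⟨FirstOrder.Language.Relations.formula₂ (L := lang.withConstants (Set.univ : Set M))
      (Sum.inl MemSymbol.mem) (tm (t i)) (tm (t j)), ?_⟩
    ext v
    simp only [Set.mem_ofPred_eq, Fml.Sat]
    rw [← htm (t i), ← htm (t j)]
    exact (FirstOrder.Language.Formula.realize_rel₂ (M := M)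
      (L := lang.withConstants (Set.univ : Set M)) (R := Sum.inl MemSymbol.mem)).symm
  | eq i j =>
    intro n t
    refine ⟨(tm (t i)).equal (tm (t j)), ?_⟩
    ext v
    simp only [Set.mem_ofPred_eq, Fml.Sat]
    rw [FirstOrder.Language.Formula.realize_equal, htm, htm]
  | neg φ ih => intro n t; exact (ih t).compl
  | and φ ψ ih1 ih2 => intro n t; exact (ih1 t).inter (ih2 t)
  | @ex k φ ih =>
    intro n t
    have h := (ih (snoc (fun i => Sum.map id Fin.castSucc (t i)) (Sum.inr (Fin.last n)))).image_comp
      (Fin.castSucc : Fin n → Fin (n + 1))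
    refine (congrArg _ ?_).mp h
    have key : ∀ w : Fin (n + 1) → M, (fun i => ev w
        (snoc (fun i => Sum.map id Fin.castSucc (t i)) (Sum.inr (Fin.last n)) i)) =
        snoc (fun i => ev (fun j => w j.castSucc) (t i)) (w (Fin.last n)) := by
      intro w
      funext i
      refine Fin.lastCases ?_ (fun i => ?_) i
      · simp [snoc, ev]
      · rcases h : t i with c | j <;> simp [snoc, ev, h]
    ext v
    simp only [Set.mem_image, Set.mem_ofPred_eq, key, Fml.Sat]
    constructor
    · rintro ⟨w, hw, rfl⟩
      exact ⟨_, hw⟩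
    · rintro ⟨y, hy⟩
      exact ⟨snoc v y, by simpa [snoc] using hy, by funext i; simp [snoc]⟩

theorem Dfn.definable {n : ℕ} {P : (Fin n → M) → Prop} (hP : Dfn P) :
    @Set.Definable M Set.univ lang (struc SetStr.mem) (Fin n) {v | P v} := by
  obtain ⟨k, φ, t, h⟩ := hP.out
  simp only [h]
  exact φ.definable_sat t

theorem ZF.zfm (h : ZF (mem : M → M → Prop)) : ZFM M where
  ext' := h.extensionality
  foundation := h.foundation
  pairing := h.pairing
  union := h.union
  powerset := h.powerset
  infinity := h.infinity
  separation P hP a := h.separation {x | P x} hP.definable a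
  replacement F hF a := by
    obtain ⟨b, hb⟩ := h.replacement {p | p.2 = F p.1} hF.out.definable a
      fun x _ => ⟨F x, rfl, fun y hy => hy⟩
    exact ⟨b, hb⟩

end

section
variable {M : Type u} [SetStr M] [ZFM M]

theorem ext {x y : M} (h : ∀ z, z ε x ↔ z ε y) : x = y := ZFM.ext' x y h

instance : Nonempty M := ⟨(ZFM.infinity (M := M)).choose⟩

/-! ### Separation, replacement and basic sets as total operations -/

open Classical in
/-- The set `{x ∈ a : P x}`. -/
noncomputable def sep (a : M) (P : M → Prop) : M :=
  -- The junk value keeps `sep` a plain term without a definability proof inside; definability is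
  -- required only in order to compute its members. The same device is used for `img`.
  if h : ∃ b, ∀ x, x ε b ↔ x ε a ∧ P x then h.choose else Classical.arbitrary M

@[simp] theorem mem_sep {a : M} {P : M → Prop} [hP : Dfn fun v : Fin 1 → M => P (v 0)] {x : M} :
    x ε sep a P ↔ x ε a ∧ P x := by
  have h := ZFM.separation P hP a
  rw [sep, dif_pos h]
  exact h.choose_spec x

instance DFun.sep {n : ℕ} {F : (Fin n → M) → M} {P : (Fin n → M) → M → Prop} [hF : DFun F]
    [hP : Dfn fun w : Fin (n + 1) → M => P (fun i => w i.castSucc) (w (Fin.last n))] :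
    DFun fun v => SetModel.sep (F v) (P v) := by
  have h1 := hF.weaken.weaken
  have h2 : Dfn fun w : Fin (n + 1 + 1) → M => P (fun i => w i.castSucc.castSucc) (w (Fin.last _)) :=
    (hP.subst (snoc (fun i => Sum.inr i.castSucc.castSucc) (Sum.inr (Fin.last _)))).congr
      fun w => by simp [snoc, ev]
  refine DFun.of_graph (G := fun v y => ∀ x, x ε y ↔ x ε F v ∧ P v x) inferInstance fun v y => ?_
  have := hP.section_last v
  constructor
  · rintro rfl x
    exact mem_sep
  · exact fun h => ext fun x => (h x).trans mem_sep.symm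

open Classical in
/-- The set `{F x : x ∈ a}`. -/
noncomputable def img (a : M) (F : M → M) : M :=
  if h : ∃ b, ∀ y, y ε b ↔ ∃ x, x ε a ∧ y = F x then h.choose else Classical.arbitrary M

@[simp] theorem mem_img {a : M} {F : M → M} [hF : DFun fun v : Fin 1 → M => F (v 0)] {y : M} :
    y ε img a F ↔ ∃ x, x ε a ∧ y = F x := by
  have h := ZFM.replacement F hF a
  rw [img, dif_pos h]
  exact h.choose_spec y

instance DFun.img {n : ℕ} {F : (Fin n → M) → M} {G : (Fin n → M) → M → M} [hF : DFun F]
    [hG : DFun fun w : Fin (n + 1) → M => G (fun i => w i.castSucc) (w (Fin.last n))] :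
    DFun fun v => SetModel.img (F v) (G v) := by
  have h1 := hF.weaken.weaken.weaken
  have h2 : Dfn fun w : Fin (n + 1 + 1 + 1) → M =>
      w (Fin.last _).castSucc = G (fun i => w i.castSucc.castSucc.castSucc) (w (Fin.last _)) :=
    (hG.out.subst (snoc (snoc (fun i => Sum.inr i.castSucc.castSucc.castSucc)
      (Sum.inr (Fin.last _))) (Sum.inr (Fin.last _).castSucc))).congr fun w => by simp [snoc, ev]
  refine DFun.of_graph (G := fun v y => ∀ z, z ε y ↔ ∃ x, x ε F v ∧ z = G v x) inferInstance
    fun v y => ?_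
  have := hG.section_last v
  constructor
  · rintro rfl x
    exact mem_img
  · exact fun h => ext fun x => (h x).trans mem_img.symm

/-- The unordered pair. -/
noncomputable def upair (a b : M) : M := (ZFM.pairing a b).choose
/-- The union of a set. -/
noncomputable def sUnion (a : M) : M := (ZFM.union a).choose
/-- The power set. -/
noncomputable def power (a : M) : M := (ZFM.powerset a).choose

@[simp] theorem mem_upair {a b z : M} : z ε upair a b ↔ z = a ∨ z = b :=
  (ZFM.pairing a b).choose_spec z
@[simp] theorem mem_sUnion {a z : M} : z ε sUnion a ↔ ∃ y, y ε a ∧ z ε y :=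
  (ZFM.union a).choose_spec z
@[simp] theorem mem_power {a z : M} : z ε power a ↔ IsSubset mem z a :=
  (ZFM.powerset a).choose_spec z

/-- A function is definable if membership in its values is. -/
theorem DFun.of_mem {n : ℕ} {F : (Fin n → M) → M} {P : (Fin n → M) → M → Prop}
    (hP : Dfn fun w : Fin (n + 1) → M => P (fun i => w i.castSucc) (w (Fin.last n)))
    (h : ∀ v z, z ε F v ↔ P v z) : DFun F := by
  have h2 : Dfn fun w : Fin (n + 1 + 1) → M => P (fun i => w i.castSucc.castSucc) (w (Fin.last _)) :=
    (hP.subst (snoc (fun i => Sum.inr i.castSucc.castSucc) (Sum.inr (Fin.last _)))).congr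
      fun w => by simp [snoc, ev]
  refine DFun.of_graph (G := fun v y => ∀ z, z ε y ↔ P v z) inferInstance fun v y => ?_
  constructor
  · rintro rfl z
    exact h v z
  · exact fun h' => ext fun z => (h' z).trans (h v z).symm

/-- The empty set. -/
noncomputable def empty : M := sep (Classical.arbitrary M) fun _ => False
@[simp] theorem not_mem_empty {z : M} : ¬ z ε (empty : M) := by simp [empty]

/-- The union of two sets. -/
noncomputable def union (a b : M) : M := sUnion (upair a b)
/-- `a ∪ {b}`. -/
noncomputable def adj (a b : M) : M := union a (upair b b)
/-- `a ∪ {a}`. -/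
noncomputable def succ (a : M) : M := adj a a
/-- The ordered pair. -/
noncomputable def opair (a b : M) : M := upair (upair a a) (upair a b)

@[simp] theorem mem_union {a b z : M} : z ε union a b ↔ z ε a ∨ z ε b := by simp [union]
@[simp] theorem mem_adj {a b z : M} : z ε adj a b ↔ z ε a ∨ z = b := by simp [adj]
@[simp] theorem mem_succ {a z : M} : z ε succ a ↔ z ε a ∨ z = a := by simp [succ]

section
variable {n : ℕ} {F G H : (Fin n → M) → M} [hF : DFun F] [hG : DFun G] [hH : DFun H]
instance DFun.upair : DFun fun v => SetModel.upair (F v) (G v) :=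
  DFun.app2 (DFun.of_mem inferInstance fun _ _ => mem_upair) hF hG
instance DFun.sUnion : DFun fun v => SetModel.sUnion (F v) :=
  DFun.app1 (DFun.of_mem inferInstance fun _ _ => mem_sUnion) hF
instance DFun.power : DFun fun v => SetModel.power (F v) :=
  DFun.app1 (DFun.of_mem inferInstance fun _ _ => mem_power) hF
instance DFun.union : DFun fun v => SetModel.union (F v) (G v) :=
  DFun.app2 (by unfold SetModel.union; infer_instance) hF hG
instance DFun.adj : DFun fun v => SetModel.adj (F v) (G v) :=
  DFun.app2 (by unfold SetModel.adj; infer_instance) hF hG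
instance DFun.succ : DFun fun v => SetModel.succ (F v) :=
  DFun.app1 (by unfold SetModel.succ; infer_instance) hF
instance DFun.opair : DFun fun v => SetModel.opair (F v) (G v) :=
  DFun.app2 (by unfold SetModel.opair; infer_instance) hF hG
end

/-! ### Pairs and functions -/

theorem isUPair_iff {a b p : M} : IsUPair mem a b p ↔ p = upair a b :=
  ⟨fun h => ext fun z => (h z).trans mem_upair.symm, fun h => h ▸ fun _ => mem_upair⟩

@[simp] theorem isOPair_iff {a b p : M} : IsOPair mem a b p ↔ p = opair a b := by
  simp [IsOPair, isUPair_iff, opair]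

@[simp] theorem pairMem_iff {a b r : M} : PairMem mem a b r ↔ opair a b ε r := by
  simp [PairMem]

@[simp] theorem isSucc_iff {a s : M} : IsSucc mem a s ↔ s = succ a :=
  ⟨fun h => ext fun z => (h z).trans mem_succ.symm, fun h => h ▸ fun _ => mem_succ⟩

@[simp] theorem isEmptySet_iff {a : M} : IsEmptySet mem a ↔ a = empty :=
  ⟨fun h => ext fun z => by simp [h z], fun h => h ▸ fun _ => not_mem_empty⟩

theorem upair_inj_right {a b c : M} (h : upair a b = upair a c) : b = c := by
  have h1 : b ε upair a c := h ▸ mem_upair.2 (Or.inr rfl)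
  have h2 : c ε upair a b := h ▸ mem_upair.2 (Or.inr rfl)
  rw [mem_upair] at h1 h2
  rcases h1 with h1 | h1
  · rcases h2 with h2 | h2
    · exact h1.trans h2.symm
    · exact h2.symm
  · exact h1

@[simp] theorem opair_inj {a b c d : M} : opair a b = opair c d ↔ a = c ∧ b = d := by
  refine ⟨fun h => ?_, fun ⟨h, h'⟩ => h ▸ h' ▸ rfl⟩
  have ha : a = c := by
    have h1 : upair c c ε opair a b := h ▸ mem_upair.2 (Or.inl rfl)
    rcases mem_upair.1 h1 with h1 | h1
    · have : c ε upair a a := h1 ▸ mem_upair.2 (Or.inl rfl)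
      simpa [eq_comm] using this
    · have : a ε upair c c := h1.symm ▸ mem_upair.2 (Or.inl rfl)
      simpa using this
  subst ha
  exact ⟨rfl, upair_inj_right (upair_inj_right h)⟩

theorem not_mem_self (x : M) : ¬ x ε x := by
  obtain ⟨y, hy, hy'⟩ := ZFM.foundation (upair x x) ⟨x, by simp⟩
  obtain rfl : y = x := by simpa using hy
  exact fun h => hy' _ h (by simp)

theorem succ_ne_empty (x : M) : succ x ≠ empty := fun h =>
  not_mem_empty (h ▸ mem_succ.2 (Or.inr rfl) : x ε (empty : M))

/-! ### Products, function values and functions given by terms -/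

/-- The cartesian product. -/
noncomputable def prod (a b : M) : M :=
  sep (power (power (union a b))) fun p => ∃ x, x ε a ∧ ∃ y, y ε b ∧ p = opair x y

@[simp] theorem mem_prod {a b p : M} :
    p ε prod a b ↔ ∃ x, x ε a ∧ ∃ y, y ε b ∧ p = opair x y := by
  refine mem_sep.trans ⟨fun h => h.2, fun h => ⟨?_, h⟩⟩
  obtain ⟨x, hx, y, hy, rfl⟩ := h
  refine mem_power.2 fun z hz => mem_power.2 fun w hw => ?_
  rcases mem_upair.1 hz with rfl | rfl <;> rcases mem_upair.1 hw with rfl | rfl <;> simp [*]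

theorem opair_mem_prod {a b x y : M} : opair x y ε prod a b ↔ x ε a ∧ y ε b := by
  simp only [mem_prod, opair_inj]
  constructor
  · rintro ⟨x, hx, y, hy, rfl, rfl⟩; exact ⟨hx, hy⟩
  · rintro ⟨hx, hy⟩; exact ⟨x, hx, y, hy, rfl, rfl⟩

/-- The value of the function `f` at `x`. -/
noncomputable def app (f x : M) : M :=
  -- The union of the set of all values at `x`; if `y` is the only one, this is `⋃ {y} = y`.
  sUnion (sep (sUnion (sUnion f)) fun y => opair x y ε f)

theorem mem_sUnion_sUnion {f x y : M} (h : opair x y ε f) :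
    x ε sUnion (sUnion f) ∧ y ε sUnion (sUnion f) := by
  constructor <;> refine mem_sUnion.2 ⟨upair x y, mem_sUnion.2 ⟨_, h, ?_⟩, ?_⟩ <;> simp [opair]

theorem app_eq {f x y : M} (h : opair x y ε f) (hu : ∀ z, opair x z ε f → z = y) : app f x = y := by
  refine ext fun z => ?_
  rw [app, mem_sUnion]
  constructor
  · rintro ⟨w, hw, hz⟩; exact hu w (mem_sep.1 hw).2 ▸ hz
  · exact fun hz => ⟨y, mem_sep.2 ⟨(mem_sUnion_sUnion h).2, h⟩, hz⟩

/-- The first component of a pair. -/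
noncomputable def fst (p : M) : M := sUnion (sep (sUnion p) fun x => ∃ y, p = opair x y)
/-- The second component of a pair. -/
noncomputable def snd (p : M) : M := sUnion (sep (sUnion p) fun y => ∃ x, p = opair x y)

@[simp] theorem fst_opair (x y : M) : fst (opair x y) = x := by
  refine ext fun z => ?_
  simp only [fst, mem_sUnion, mem_sep, opair_inj]
  constructor
  · rintro ⟨w, ⟨_, _, rfl, rfl⟩, h⟩; exact h
  · exact fun h => ⟨x, ⟨⟨upair x x, by simp [opair], by simp⟩, y, rfl, rfl⟩, h⟩

@[simp] theorem snd_opair (x y : M) : snd (opair x y) = y := by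
  refine ext fun z => ?_
  simp only [snd, mem_sUnion, mem_sep, opair_inj]
  constructor
  · rintro ⟨w, ⟨_, _, rfl, rfl⟩, h⟩; exact h
  · exact fun h => ⟨y, ⟨⟨upair x y, by simp [opair], by simp⟩, x, rfl, rfl⟩, h⟩

/-- The set of functions from `a` to `b`. -/
noncomputable def funs (a b : M) : M := sep (power (prod a b)) fun f => IsFun mem f a b

section
variable {n : ℕ} {F G : (Fin n → M) → M} [hF : DFun F] [hG : DFun G]
instance DFun.prod : DFun fun v => SetModel.prod (F v) (G v) :=
  DFun.app2 (by unfold SetModel.prod; infer_instance) hF hG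
instance DFun.app : DFun fun v => SetModel.app (F v) (G v) :=
  DFun.app2 (by unfold SetModel.app; infer_instance) hF hG
instance DFun.fst : DFun fun v => SetModel.fst (F v) :=
  DFun.app1 (by unfold SetModel.fst; infer_instance) hF
instance DFun.snd : DFun fun v => SetModel.snd (F v) :=
  DFun.app1 (by unfold SetModel.snd; infer_instance) hF
instance DFun.funs : DFun fun v => SetModel.funs (F v) (G v) :=
  DFun.app2 (by unfold SetModel.funs; infer_instance) hF hG
end

theorem isFun_iff {f a b : M} : IsFun mem f a b ↔ (∀ p, p ε f → p ε prod a b) ∧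
    (∀ x, x ε a → ∃ y, opair x y ε f) ∧
    ∀ x y z, opair x y ε f → opair x z ε f → y = z := by
  simp only [IsFun, isOPair_iff, pairMem_iff, mem_prod]
  constructor
  · rintro ⟨h1, h2⟩
    refine ⟨fun p hp => ?_, fun x hx => (h2 x hx).exists, fun x y z hy hz => ?_⟩
    · obtain ⟨x, y, hx, hy, h⟩ := h1 p hp
      exact ⟨x, hx, y, hy, h⟩
    · obtain ⟨x', _, hx, _, h⟩ := h1 _ hy
      exact (h2 x ((opair_inj.1 h).1 ▸ hx)).unique hy hz
  · rintro ⟨h1, h2, h3⟩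
    refine ⟨fun p hp => ?_, fun x hx => ?_⟩
    · obtain ⟨x, hx, y, hy, h⟩ := h1 p hp
      exact ⟨x, y, hx, hy, h⟩
    · obtain ⟨y, hy⟩ := h2 x hx
      exact ⟨y, hy, fun z hz => h3 x z y hz hy⟩

@[simp] theorem mem_funs {f a b : M} : f ε funs a b ↔ IsFun mem f a b :=
  mem_sep.trans ⟨fun h => h.2, fun h => ⟨mem_power.2 (isFun_iff.1 h).1, h⟩⟩

theorem IsFun.app_eq {f a b x y : M} (hf : IsFun mem f a b) (h : opair x y ε f) : app f x = y :=
  SetModel.app_eq h fun z hz => (isFun_iff.1 hf).2.2 x z y hz h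

theorem IsFun.dom {f a b x y : M} (hf : IsFun mem f a b) (h : opair x y ε f) : x ε a :=
  (opair_mem_prod.1 ((isFun_iff.1 hf).1 _ h)).1

theorem IsFun.cod {f a b x y : M} (hf : IsFun mem f a b) (h : opair x y ε f) : y ε b :=
  (opair_mem_prod.1 ((isFun_iff.1 hf).1 _ h)).2

theorem IsFun.opair_app {f a b x : M} (hf : IsFun mem f a b) (hx : x ε a) : opair x (app f x) ε f := by
  obtain ⟨y, hy⟩ := (isFun_iff.1 hf).2.1 x hx
  rwa [hf.app_eq hy]

theorem IsFun.app_mem {f a b x : M} (hf : IsFun mem f a b) (hx : x ε a) : app f x ε b :=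
  hf.cod (hf.opair_app hx)

theorem IsFun.opair_mem {f a b x y : M} (hf : IsFun mem f a b) :
    opair x y ε f ↔ x ε a ∧ y = app f x :=
  ⟨fun h => ⟨hf.dom h, (hf.app_eq h).symm⟩, fun ⟨h, h'⟩ => h' ▸ hf.opair_app h⟩

theorem IsFun.mem_iff {f a b p : M} (hf : IsFun mem f a b) :
    p ε f ↔ ∃ x, x ε a ∧ p = opair x (app f x) := by
  constructor
  · intro hp
    obtain ⟨x, hx, y, _, rfl⟩ := mem_prod.1 ((isFun_iff.1 hf).1 p hp)
    exact ⟨x, hx, by rw [hf.app_eq hp]⟩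
  · rintro ⟨x, hx, rfl⟩; exact hf.opair_app hx

theorem IsFun.funext {f g a b c : M} (hf : IsFun mem f a b) (hg : IsFun mem g a c)
    (h : ∀ x, x ε a → app f x = app g x) : f = g := by
  refine ext fun p => hf.mem_iff.trans (Iff.trans ?_ hg.mem_iff.symm)
  exact exists_congr fun x => and_congr_right fun hx => by rw [h x hx]

theorem IsFun.mono {f a b c : M} (hf : IsFun mem f a b) (h : IsSubset mem b c) : IsFun mem f a c := by
  rw [isFun_iff] at hf ⊢
  refine ⟨fun p hp => ?_, hf.2⟩
  obtain ⟨x, hx, y, hy, rfl⟩ := mem_prod.1 (hf.1 p hp)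
  exact opair_mem_prod.2 ⟨hx, h y hy⟩

/-- The function `x ↦ F x` on `a`. -/
noncomputable def lam (a : M) (F : M → M) : M := img a fun x => opair x (F x)

section
variable {a : M} {F : M → M} [hF : DFun fun v : Fin 1 → M => F (v 0)]

theorem opair_mem_lam {x y : M} : opair x y ε lam a F ↔ x ε a ∧ y = F x := by
  simp only [lam, mem_img, opair_inj]
  constructor
  · rintro ⟨x, hx, rfl, rfl⟩; exact ⟨hx, rfl⟩
  · rintro ⟨hx, rfl⟩; exact ⟨x, hx, rfl, rfl⟩

theorem isFun_lam {b : M} (h : ∀ x, x ε a → F x ε b) : IsFun mem (lam a F) a b := by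
  refine isFun_iff.2 ⟨fun p hp => ?_, fun x hx => ⟨F x, opair_mem_lam.2 ⟨hx, rfl⟩⟩,
    fun x y z hy hz => ?_⟩
  · obtain ⟨x, hx, rfl⟩ := mem_img.1 hp
    exact opair_mem_prod.2 ⟨hx, h x hx⟩
  · rw [(opair_mem_lam.1 hy).2, (opair_mem_lam.1 hz).2]

theorem app_lam {x : M} (hx : x ε a) : app (lam a F) x = F x :=
  app_eq (opair_mem_lam.2 ⟨hx, rfl⟩) fun _ h => (opair_mem_lam.1 h).2

end

instance DFun.lam {n : ℕ} {F : (Fin n → M) → M} {G : (Fin n → M) → M → M} [hF : DFun F]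
    [hG : DFun fun w : Fin (n + 1) → M => G (fun i => w i.castSucc) (w (Fin.last n))] :
    DFun fun v => SetModel.lam (F v) (G v) := by
  unfold SetModel.lam
  infer_instance

end
end SetModel

namespace SetModel
universe u
open SetStr

section
variable {M : Type u} [SetStr M]

/-! ### Ordinals -/

theorem IsOrd.mem {α β : M} (h : IsOrd SetStr.mem α) (hβ : β ε α) : IsOrd SetStr.mem β :=
  ⟨h.2 β hβ, fun γ hγ => h.2 γ (h.1 β hβ γ hγ)⟩

theorem IsOrd.trans {α β γ : M} (h : IsOrd SetStr.mem α) (hβ : β ε α) (hγ : γ ε β) : γ ε α :=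
  h.1 β hβ γ hγ

variable [ZFM M]

/-- Foundation is applied to the set of `γ ∈ α` with `P γ`; if that set is empty, `α` itself is
least. -/
theorem exists_least {P : M → Prop} [hP : Dfn fun v : Fin 1 → M => P (v 0)] {α : M}
    (hα : IsOrd mem α) (h : P α) : ∃ β, IsOrd mem β ∧ P β ∧ ∀ γ, γ ε β → ¬ P γ := by
  by_cases h' : ∃ γ, γ ε α ∧ P γ
  · obtain ⟨γ, hγ, hPγ⟩ := h'
    obtain ⟨β, hβ, hβ'⟩ := ZFM.foundation (sep α P) ⟨γ, mem_sep.2 ⟨hγ, hPγ⟩⟩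
    rw [mem_sep] at hβ
    exact ⟨β, hα.mem hβ.1, hβ.2, fun δ hδ hP => hβ' δ hδ (mem_sep.2 ⟨hα.trans hβ.1 hδ, hP⟩)⟩
  · exact ⟨α, hα, h, fun γ hγ hP => h' ⟨γ, hγ, hP⟩⟩

theorem ord_induction {P : M → Prop} [hP : Dfn fun v : Fin 1 → M => P (v 0)]
    (h : ∀ α, IsOrd mem α → (∀ β, β ε α → P β) → P α) {α : M} (hα : IsOrd mem α) : P α := by
  by_contra hn
  obtain ⟨β, hβ, hβ', hmin⟩ := exists_least (P := fun x => ¬ P x) hα hn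
  exact hβ' (h β hβ fun γ hγ => not_not.1 (hmin γ hγ))

theorem ord_trichotomy {α β : M} (hα : IsOrd mem α) (hβ : IsOrd mem β) :
    α ε β ∨ α = β ∨ β ε α := by
  refine ord_induction (P := fun α => ∀ β, IsOrd mem β → α ε β ∨ α = β ∨ β ε α) ?_ hα β hβ
  clear hα hβ α β
  intro α hα ih β hβ
  refine ord_induction (P := fun β => α ε β ∨ α = β ∨ β ε α) ?_ hβ
  intro β hβ ih'
  by_contra hn
  push Not at hn
  -- For an incomparable pair, the two induction hypotheses and transitivity show that `α` and `β`
  -- have the same elements.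
  refine hn.2.1 (ext fun γ => ⟨fun hγ => ?_, fun hγ => ?_⟩)
  · rcases ih γ hγ β hβ with h | rfl | h
    · exact h
    · exact (hn.2.2 hγ).elim
    · exact (hn.2.2 (hα.trans hγ h)).elim
  · rcases ih' γ hγ with h | rfl | h
    · exact (hn.1 (hβ.trans hγ h)).elim
    · exact (hn.1 hγ).elim
    · exact h

theorem IsOrd.succ {α : M} (h : IsOrd SetStr.mem α) : IsOrd SetStr.mem (succ α) := by
  constructor
  · intro β hβ γ hγ
    rcases mem_succ.1 hβ with hβ | rfl
    · exact mem_succ.2 (Or.inl (h.trans hβ hγ))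
    · exact mem_succ.2 (Or.inl hγ)
  · intro β hβ
    rcases mem_succ.1 hβ with hβ | rfl
    · exact h.2 β hβ
    · exact h.1

theorem isOrd_empty : IsOrd mem (empty : M) :=
  ⟨fun _ h => (not_mem_empty h).elim, fun _ h => (not_mem_empty h).elim⟩

theorem isOrd_sUnion {a : M} (h : ∀ α, α ε a → IsOrd mem α) : IsOrd mem (sUnion a) := by
  constructor
  · intro β hβ γ hγ
    obtain ⟨α, hα, hβ⟩ := mem_sUnion.1 hβ
    exact mem_sUnion.2 ⟨α, hα, (h α hα).trans hβ hγ⟩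
  · intro β hβ
    obtain ⟨α, hα, hβ⟩ := mem_sUnion.1 hβ
    exact (h α hα).2 β hβ

theorem subset_of_mem_succ {α β : M} (hα : IsOrd mem α) (h : β ε succ α) : IsSubset mem β α := by
  rcases mem_succ.1 h with h | rfl
  · exact hα.1 β h
  · exact fun _ h => h

theorem mem_succ_of_subset {α β : M} (hα : IsOrd mem α) (hβ : IsOrd mem β) (h : IsSubset mem β α) :
    β ε succ α := by
  rcases ord_trichotomy hα hβ with hlt | rfl | hlt
  · exact (not_mem_self α (h α hlt)).elim
  · simp
  · exact mem_succ.2 (Or.inl hlt)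

/-- Every set of ordinals has a strict upper bound. -/
theorem exists_ord_bound (a : M) : ∃ δ, IsOrd mem δ ∧ ∀ α, α ε a → IsOrd mem α → α ε δ := by
  refine ⟨succ (sUnion (sep a fun α => IsOrd mem α)),
    (isOrd_sUnion fun α hα => (mem_sep.1 hα).2).succ, fun α hα ho => ?_⟩
  refine mem_succ_of_subset (isOrd_sUnion fun α hα => (mem_sep.1 hα).2) ho fun β hβ => ?_
  exact mem_sUnion.2 ⟨α, mem_sep.2 ⟨hα, ho⟩, hβ⟩

/-! ### Least ordinal witnesses and collection -/

open Classical in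
/-- The least ordinal satisfying `P`, or `∅` if there is none. -/
noncomputable def least (P : M → Prop) : M :=
  if h : ∃ α, IsOrd mem α ∧ P α ∧ ∀ β, β ε α → ¬ P β then h.choose else empty

section
variable {P : M → Prop} [hP : Dfn fun v : Fin 1 → M => P (v 0)]

theorem least_spec {α : M} (hα : IsOrd mem α) (h : P α) :
    IsOrd mem (least P) ∧ P (least P) ∧ ∀ β, β ε least P → ¬ P β := by
  have h := exists_least hα h
  rw [least, dif_pos h]
  exact h.choose_spec

theorem least_mem_succ {α : M} (hα : IsOrd mem α) (h : P α) : least P ε succ α := by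
  obtain ⟨h1, _, h3⟩ := least_spec hα h
  rcases ord_trichotomy h1 hα with h' | h' | h'
  · exact mem_succ.2 (Or.inl h')
  · exact mem_succ.2 (Or.inr h')
  · exact (h3 α h' h).elim

end

instance DFun.least {n : ℕ} {P : (Fin n → M) → M → Prop}
    [hP : Dfn fun w : Fin (n + 1) → M => P (fun i => w i.castSucc) (w (Fin.last n))] :
    DFun fun v => SetModel.least (P v) := by
  have h2 : Dfn fun w : Fin (n + 1 + 1) → M => P (fun i => w i.castSucc.castSucc) (w (Fin.last _)) :=
    (hP.subst (snoc (fun i => Sum.inr i.castSucc.castSucc) (Sum.inr (Fin.last _)))).congr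
      fun w => by simp [snoc, ev]
  refine DFun.of_graph (G := fun v y => (IsOrd SetStr.mem y ∧ P v y ∧ ∀ z, z ε y → ¬ P v z) ∨
    ((∀ z, IsOrd SetStr.mem z → ¬ P v z) ∧ y = SetModel.empty)) inferInstance fun v y => ?_
  have := hP.section_last v
  by_cases h : ∃ α, IsOrd SetStr.mem α ∧ P v α
  · obtain ⟨α, hα, h⟩ := h
    obtain ⟨h1, h2, h3⟩ := least_spec hα h
    constructor
    · rintro rfl; exact Or.inl ⟨h1, h2, h3⟩
    · rintro (⟨h4, h5, h6⟩ | ⟨h4, _⟩)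
      · rcases ord_trichotomy h1 h4 with h' | h' | h'
        · exact (h6 _ h' h2).elim
        · exact h'.symm
        · exact (h3 _ h' h5).elim
      · exact (h4 α hα h).elim
  · push Not at h
    have h0 : SetModel.least (P v) = SetModel.empty := by
      rw [SetModel.least, dif_neg]
      rintro ⟨α, hα, h', _⟩
      exact h α hα h'
    rw [h0]
    constructor
    · exact fun hy => Or.inr ⟨h, hy⟩
    · rintro (⟨h4, h5, _⟩ | ⟨_, h4⟩)
      · exact (h y h4 h5).elim
      · exact h4

/-- Collection for ordinal witnesses. -/
theorem ord_collection {Q : M → M → Prop} [hQ : Dfn fun v : Fin 2 → M => Q (v 0) (v 1)] (a : M) :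
    ∃ δ, IsOrd mem δ ∧ ∀ x, x ε a → (∃ α, IsOrd mem α ∧ Q x α) → ∃ α, α ε δ ∧ Q x α := by
  have h1 : DFun fun v : Fin 1 → M => least (Q (v 0)) := DFun.least (hP := hQ)
  -- The least witness is a definable function of `x`, so replacement yields a bound and no choice
  -- is involved.
  obtain ⟨δ, hδ, h⟩ := exists_ord_bound (img a fun x => least (Q x))
  refine ⟨δ, hδ, fun x hx ⟨α, hα, hα'⟩ => ?_⟩
  have hQx : Dfn fun v : Fin 1 → M => Q x (v 0) := hQ.app2 (DFun.const x) (DFun.proj 0)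
  obtain ⟨h2, h3, _⟩ := least_spec (P := Q x) hα hα'
  exact ⟨_, h _ (mem_img.2 ⟨x, hx, rfl⟩) h2, h3⟩

/-- There is no definable injection of a final segment of the ordinals into a set. -/
theorem no_ord_injection {F : M → M} [hF : DFun fun v : Fin 1 → M => F (v 0)] {μ b : M}
    (hμ : IsOrd mem μ) (hb : ∀ α, IsOrd mem α → μ ε α → F α ε b)
    (hi : ∀ α β, IsOrd mem α → IsOrd mem β → μ ε α → α ε β → F α ≠ F β) : False := by
  have h2 : Dfn fun v : Fin 2 → M => v 0 = F (v 1) :=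
    hF.out.subst ![Sum.inr 1, Sum.inr 0]
  have h2' : Dfn fun v : Fin 2 → M => μ ε v 1 ∧ v 0 = F (v 1) := inferInstance
  -- Every value in `b` attained above `μ` is attained above `μ` at some ordinal below `δ`. The
  -- value at `max(δ, μ + 1)` is therefore a repetition.
  obtain ⟨δ, hδ, h⟩ := ord_collection (Q := fun x α => μ ε α ∧ x = F α) b
  have hm : IsOrd mem (union δ (succ μ)) := by
    have : union δ (succ μ) = sUnion (upair δ (succ μ)) := rfl
    rw [this]
    refine isOrd_sUnion fun α hα => ?_
    rcases mem_upair.1 hα with rfl | rfl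
    · exact hδ
    · exact hμ.succ
  have hm' : μ ε union δ (succ μ) := by simp
  obtain ⟨α, hα, hμα, he⟩ := h _ (hb _ hm hm') ⟨_, hm, hm', rfl⟩
  exact hi α _ (hδ.mem hα) hm hμα (by simp [hα]) he.symm

/-! ### Natural numbers -/

theorem isInductive_iff {x : M} : IsInductive mem x ↔ empty ε x ∧ ∀ n, n ε x → succ n ε x := by
  simp [IsInductive]

/-- The set of natural numbers. -/
noncomputable def omega : M :=
  sep (ZFM.infinity (M := M)).choose fun n => ∀ v, IsInductive mem v → n ε v

theorem mem_omega_iff {n : M} : n ε (omega : M) ↔ ∀ v, IsInductive mem v → n ε v :=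
  mem_sep.trans ⟨fun h => h.2, fun h => ⟨h _ (ZFM.infinity (M := M)).choose_spec, h⟩⟩

theorem isInductive_omega : IsInductive mem (omega : M) := by
  refine isInductive_iff.2 ⟨mem_omega_iff.2 fun v hv => (isInductive_iff.1 hv).1, fun n hn => ?_⟩
  exact mem_omega_iff.2 fun v hv => (isInductive_iff.1 hv).2 n (mem_omega_iff.1 hn v hv)

@[simp] theorem isOmega_iff {w : M} : IsOmega mem w ↔ w = omega := by
  constructor
  · rintro ⟨h1, h2⟩
    exact ext fun z => ⟨fun h => h2 _ isInductive_omega z h, fun h => mem_omega_iff.1 h w h1⟩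
  · rintro rfl
    exact ⟨isInductive_omega, fun v hv n hn => mem_omega_iff.1 hn v hv⟩

@[simp] theorem isNat_iff {n : M} : IsNat mem n ↔ n ε (omega : M) := by simp [IsNat]

@[simp] theorem empty_mem_omega : (empty : M) ε (omega : M) := (isInductive_iff.1 isInductive_omega).1
theorem succ_mem_omega {n : M} (h : n ε (omega : M)) : succ n ε (omega : M) :=
  (isInductive_iff.1 isInductive_omega).2 n h

theorem nat_induction {P : M → Prop} [hP : Dfn fun v : Fin 1 → M => P (v 0)] (h0 : P empty)
    (hs : ∀ n, n ε (omega : M) → P n → P (succ n)) {n : M} (hn : n ε (omega : M)) : P n := by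
  have : IsInductive mem (sep omega P) := by
    refine isInductive_iff.2 ⟨mem_sep.2 ⟨by simp, h0⟩, fun n hn => ?_⟩
    rw [mem_sep] at hn ⊢
    exact ⟨succ_mem_omega hn.1, hs n hn.1 hn.2⟩
  exact (mem_sep.1 (mem_omega_iff.1 hn _ this)).2

theorem isOrd_nat {n : M} (hn : n ε (omega : M)) : IsOrd mem n :=
  nat_induction (P := fun n => IsOrd mem n) isOrd_empty (fun _ _ h => h.succ) hn

theorem nat_trans {n m : M} (hn : n ε (omega : M)) (hm : m ε n) : m ε (omega : M) := by
  refine nat_induction (P := fun n => ∀ m, m ε n → m ε (omega : M)) ?_ ?_ hn m hm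
  · exact fun m h => (not_mem_empty h).elim
  · intro n hn ih m hm
    rcases mem_succ.1 hm with h | rfl
    · exact ih m h
    · exact hn

theorem isOrd_omega : IsOrd mem (omega : M) :=
  ⟨fun _ hn _ hm => nat_trans hn hm, fun _ hn => (isOrd_nat hn).1⟩

theorem nat_cases {n : M} (hn : n ε (omega : M)) : n = empty ∨ ∃ m, m ε (omega : M) ∧ n = succ m := by
  refine nat_induction (P := fun n => n = empty ∨ ∃ m, m ε (omega : M) ∧ n = succ m) (Or.inl rfl) ?_ hn
  exact fun n hn _ => Or.inr ⟨n, hn, rfl⟩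

/-- The internal numeral of a natural number. -/
noncomputable def num : ℕ → M
  | 0 => empty
  | k + 1 => succ (num k)

theorem num_mem_omega (k : ℕ) : (num k : M) ε (omega : M) := by
  induction k with
  | zero => exact empty_mem_omega
  | succ k ih => exact succ_mem_omega ih

theorem mem_num {k : ℕ} {x : M} : x ε (num k : M) ↔ ∃ i : Fin k, x = num i := by
  induction k with
  | zero => simp [num]
  | succ k ih => simp [num, ih, Fin.exists_fin_succ']

/-! ### Cumulative iteration along the ordinals -/

/-- `f` is the function on `d` with `f(β) = T ∪ ⋃_{γ ∈ β} H(f(γ))`. -/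
def IsIter (H : M → M) (T d f : M) : Prop :=
  ∃ c, IsFun mem f d c ∧ ∀ β, β ε d →
    ∀ x, x ε app f β ↔ x ε T ∨ ∃ γ, γ ε β ∧ γ ε d ∧ x ε H (app f γ)

/-- The recursion determines the values, so two approximations agree wherever both are defined. This
is what lets approximations be glued. -/
theorem IsIter.app_eq {H : M → M} (hH : DFun fun v : Fin 1 → M => H (v 0)) {T d e f g : M}
    (hd : IsOrd mem d) (he : IsOrd mem e) (hf : IsIter H T d f) (hg : IsIter H T e g) {β : M}
    (hβ : IsOrd mem β) : β ε d → β ε e → app f β = app g β := by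
  have hH' : ∀ {n : ℕ} {F : (Fin n → M) → M} [hF : DFun F], DFun fun v => H (F v) :=
    fun {_ _} [_] => hH.app1 inferInstance
  obtain ⟨c, hf, hf'⟩ := hf
  obtain ⟨c', hg, hg'⟩ := hg
  refine ord_induction (P := fun β => β ε d → β ε e → app f β = app g β) (fun β hβ ih h1 h2 => ?_) hβ
  refine ext fun x => (hf' β h1 x).trans (Iff.trans ?_ (hg' β h2 x).symm)
  refine or_congr_right (exists_congr fun γ => and_congr_right fun hγ => ?_)
  have h3 := hd.trans h1 hγ
  have h4 := he.trans h2 hγ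
  simp [h3, h4, ih γ hγ h3 h4]

open Classical in
/-- The `β`-th stage of the cumulative iteration of `H` starting with `T`. -/
noncomputable def iter (H : M → M) (T β : M) : M :=
  if h : ∃ f, IsOrd mem β ∧ IsIter H T (succ β) f then app h.choose β else empty

theorem iter_eq {H : M → M} (hH : DFun fun v : Fin 1 → M => H (v 0)) {T d f β : M}
    (hd : IsOrd mem d) (hf : IsIter H T d f) (hβ : β ε d) : iter H T β = app f β := by
  have ho := hd.mem hβ
  have h : ∃ f, IsOrd mem β ∧ IsIter H T (succ β) f := by
    have hsub : IsSubset mem (succ β) d := fun x hx => by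
      rcases mem_succ.1 hx with h | rfl
      · exact hd.trans hβ h
      · exact hβ
    obtain ⟨c, h1, h2⟩ := hf
    refine ⟨lam (succ β) fun γ => app f γ, ho, c, isFun_lam fun x hx => h1.app_mem (hsub x hx),
      fun γ hγ x => ?_⟩
    rw [app_lam hγ, h2 γ (hsub γ hγ)]
    refine or_congr_right (exists_congr fun δ => and_congr_right fun hδ => ?_)
    have h3 : δ ε succ β := ho.succ.trans hγ hδ
    simp only [h3, hsub δ h3, true_and, app_lam h3]
  rw [iter, dif_pos h]
  exact h.choose_spec.2.app_eq hH ho.succ hd hf ho (by simp) hβ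

/-- Induction on `d`: each approximation on some `β ∈ d` is extended to `β + 1`, which makes `iter`
correct at every `β ∈ d`; the approximation on `d` is then the restriction of `iter` to `d`. -/
theorem exists_isIter {H : M → M} (hH : DFun fun v : Fin 1 → M => H (v 0)) (T : M) {d : M}
    (hd : IsOrd mem d) : ∃ f, IsIter H T d f := by
  have hH' : ∀ {n : ℕ} {F : (Fin n → M) → M} [hF : DFun F], DFun fun v => H (F v) :=
    fun {_ _} [_] => hH.app1 inferInstance
  have hdf : Dfn fun v : Fin 1 → M => ∃ f, IsIter H T (v 0) f := by unfold IsIter; infer_instance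
  refine ord_induction (P := fun d => ∃ f, IsIter H T d f) (fun d hd ih => ?_) hd
  have hex : ∀ β, β ε d → ∀ x, (∃ f, IsIter H T (succ β) f) →
      (x ε iter H T β ↔ x ε T ∨ ∃ γ, γ ε β ∧ x ε H (iter H T γ)) := by
    rintro β hβ x ⟨f, hf⟩
    have ho := hd.mem hβ
    rw [iter_eq hH ho.succ hf (by simp), hf.choose_spec.2 β (by simp)]
    refine or_congr_right (exists_congr fun γ => and_congr_right fun hγ => ?_)
    have : γ ε succ β := mem_succ.2 (Or.inl hγ)
    rw [iter_eq hH ho.succ hf this]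
    simp [hγ]
  -- Which approximation `iter` selects is irrelevant, since all give the same value; hence its
  -- graph is definable.
  have hit : DFun fun v : Fin 1 → M => iter H T (v 0) := by
    refine DFun.of_graph (G := fun v y => (∃ f, IsOrd mem (v 0) ∧ IsIter H T (succ (v 0)) f ∧
      y = app f (v 0)) ∨ ((¬ ∃ f, IsOrd mem (v 0) ∧ IsIter H T (succ (v 0)) f) ∧ y = empty))
      (by unfold IsIter; infer_instance) fun v y => ?_
    by_cases h : ∃ f, IsOrd mem (v 0) ∧ IsIter H T (succ (v 0)) f
    · simp only [h, not_true_eq_false, false_and, or_false]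
      obtain ⟨f, h1, h2⟩ := h
      constructor
      · rintro rfl
        exact ⟨f, h1, h2, iter_eq hH h1.succ h2 (by simp)⟩
      · rintro ⟨g, _, h3, rfl⟩
        exact (iter_eq hH h1.succ h3 (by simp)).symm
    · rw [iter, dif_neg h]
      simp only [h, not_false_eq_true, true_and]
      refine ⟨Or.inr, ?_⟩
      rintro (⟨f, h1, h2, _⟩ | h')
      · exact (h ⟨f, h1, h2⟩).elim
      · exact h'
  have hstep : ∀ β, β ε d → ∃ f, IsIter H T (succ β) f := by
    intro β hβ
    have ho := hd.mem hβ
    obtain ⟨f, hf⟩ := ih β hβ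
    have hv : ∀ γ, γ ε β → iter H T γ = app f γ := fun γ hγ => iter_eq hH ho hf hγ
    have hX : DFun fun v : Fin 1 → M => union T (sUnion (img (v 0) fun γ => H (iter H T γ))) := by
      have : ∀ {n : ℕ} {F : (Fin n → M) → M} [hF : DFun F], DFun fun v => iter H T (F v) :=
        fun {_ _} [_] => hit.app1 inferInstance
      infer_instance
    have hm : DFun fun v : Fin 1 → M => H (iter H T (v 0)) := hH.app1 hit
    -- The right-hand side of the recursion. It agrees with `f` below `β` and also supplies the
    -- missing value at `β`.
    let F : M → M := fun γ => union T (sUnion (img γ fun δ => H (iter H T δ)))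
    have hFv : ∀ γ, γ ε β → F γ = app f γ := by
      intro γ hγ
      refine ext fun x => ?_
      rw [hf.choose_spec.2 γ hγ]
      simp only [F, mem_union, mem_sUnion, mem_img]
      refine or_congr_right ⟨?_, ?_⟩
      · rintro ⟨_, ⟨δ, hδ, rfl⟩, h⟩
        exact ⟨δ, hδ, ho.trans hγ hδ, hv δ (ho.trans hγ hδ) ▸ h⟩
      · rintro ⟨δ, hδ, hδ', h⟩
        exact ⟨_, ⟨δ, hδ, rfl⟩, (hv δ hδ').symm ▸ h⟩
    have hFD : DFun fun v : Fin 1 → M => F (v 0) := hX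
    refine ⟨lam (succ β) F, img (succ β) F, isFun_lam fun x hx => mem_img.2 ⟨x, hx, rfl⟩,
      fun γ hγ x => ?_⟩
    rw [app_lam hγ]
    simp only [F, mem_union, mem_sUnion, mem_img]
    refine or_congr_right ⟨?_, ?_⟩
    · rintro ⟨_, ⟨δ, hδ, rfl⟩, h⟩
      have h1 := ho.succ.trans hγ hδ
      have h2 : δ ε β := subset_of_mem_succ ho hγ δ hδ
      rw [hv δ h2, ← hFv δ h2] at h
      exact ⟨δ, hδ, h1, by rw [app_lam h1]; exact h⟩
    · rintro ⟨δ, hδ, h1, h⟩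
      rw [app_lam h1] at h
      have h2 : δ ε β := subset_of_mem_succ ho hγ δ hδ
      refine ⟨_, ⟨δ, hδ, rfl⟩, ?_⟩
      rw [hv δ h2, ← hFv δ h2]
      exact h
  refine ⟨lam d (iter H T), img d (iter H T), isFun_lam fun x hx => mem_img.2 ⟨x, hx, rfl⟩,
    fun β hβ x => ?_⟩
  rw [app_lam hβ, hex β hβ x (hstep β hβ)]
  refine or_congr_right (exists_congr fun γ => and_congr_right fun hγ => ?_)
  have := hd.trans hβ hγ
  simp [this, app_lam this]

theorem mem_iter {H : M → M} (hH : DFun fun v : Fin 1 → M => H (v 0)) {T β x : M}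
    (hβ : IsOrd mem β) :
    x ε iter H T β ↔ x ε T ∨ ∃ γ, γ ε β ∧ x ε H (iter H T γ) := by
  obtain ⟨f, hf⟩ := exists_isIter hH T hβ.succ
  rw [iter_eq hH hβ.succ hf (by simp), hf.choose_spec.2 β (by simp)]
  refine or_congr_right (exists_congr fun γ => and_congr_right fun hγ => ?_)
  have : γ ε succ β := mem_succ.2 (Or.inl hγ)
  rw [iter_eq hH hβ.succ hf this]
  simp [hγ]

theorem iter_of_not_ord {H : M → M} {T β : M} (hβ : ¬ IsOrd mem β) : iter H T β = empty := by
  rw [iter, dif_neg]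
  rintro ⟨_, h, _⟩
  exact hβ h

/-- Definability holds jointly in the stage, the starting set and a parameter of the iterated map,
as is needed when the iteration itself depends on a variable. -/
theorem DFun.iter_graph {H : M → M → M} (hH : DFun fun v : Fin 2 → M => H (v 0) (v 1)) :
    DFun fun v : Fin 3 → M => iter (H (v 0)) (v 1) (v 2) := by
  have hH1 : ∀ p, DFun fun v : Fin 1 → M => H p (v 0) := fun p => hH.app2 (DFun.const p) (DFun.proj 0)
  have hH' : ∀ {n : ℕ} {F G : (Fin n → M) → M} [hF : DFun F] [hG : DFun G],
      DFun fun v => H (F v) (G v) := fun {_ _ _} [_] [_] => hH.app2 inferInstance inferInstance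
  refine DFun.of_graph (G := fun v y => (IsOrd SetStr.mem (v 2) ∧ ∃ f,
    IsIter (H (v 0)) (v 1) (SetModel.succ (v 2)) f ∧ y = SetModel.app f (v 2)) ∨
    (¬ IsOrd SetStr.mem (v 2) ∧ y = empty)) (by unfold IsIter; infer_instance) fun v y => ?_
  by_cases h : IsOrd SetStr.mem (v 2)
  · simp only [h, true_and, not_true_eq_false, false_and, or_false]
    constructor
    · rintro rfl
      obtain ⟨f, hf⟩ := exists_isIter (hH1 (v 0)) (v 1) h.succ
      exact ⟨f, hf, iter_eq (hH1 _) h.succ hf (by simp)⟩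
    · rintro ⟨f, hf, rfl⟩
      exact (iter_eq (hH1 _) h.succ hf (by simp)).symm
  · simp [h, iter_of_not_ord]

theorem DFun.iter {H : M → M → M} (hH : DFun fun v : Fin 2 → M => H (v 0) (v 1)) {n : ℕ}
    {F G K : (Fin n → M) → M} (hF : DFun F) (hG : DFun G) (hK : DFun K) :
    DFun fun v => SetModel.iter (H (F v)) (G v) (K v) :=
  DFun.app3 (H := fun p T β => SetModel.iter (H p) T β) (DFun.iter_graph hH) hF hG hK

/-- Iterations of a function without parameters. -/
theorem DFun.iter₁ {H : M → M} (hH : DFun fun v : Fin 1 → M => H (v 0)) {n : ℕ}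
    {G K : (Fin n → M) → M} (hG : DFun G) (hK : DFun K) :
    DFun fun v => SetModel.iter H (G v) (K v) :=
  DFun.iter (H := fun _ => H) (hH.app1 (DFun.proj 1)) (DFun.const SetModel.empty) hG hK

end
end SetModel

namespace SetModel
universe u
open SetStr

section
variable {M : Type u} [SetStr M] [ZFM M]

theorem iter_mono {H : M → M} (hH : DFun fun v : Fin 1 → M => H (v 0)) {T α β x : M}
    (hβ : IsOrd mem β) (h : IsSubset mem α β) (hα : IsOrd mem α) (hx : x ε iter H T α) :
    x ε iter H T β := by
  rw [mem_iter hH hα] at hx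
  rw [mem_iter hH hβ]
  exact hx.imp_right fun ⟨γ, hγ, hx⟩ => ⟨γ, h γ hγ, hx⟩

theorem mem_iter_succ {H : M → M} (hH : DFun fun v : Fin 1 → M => H (v 0)) {T α x : M}
    (hα : IsOrd mem α) (hx : x ε H (iter H T α)) : x ε iter H T (succ α) :=
  (mem_iter hH hα.succ).2 (Or.inr ⟨α, by simp, hx⟩)

/-! ### Transitive closure -/

/-- The transitive closure of `{A}`. -/
noncomputable def tc (A : M) : M := iter sUnion (upair A A) omega

theorem mem_tc {A x : M} :
    x ε tc A ↔ x = A ∨ ∃ k, k ε (omega : M) ∧ x ε sUnion (iter sUnion (upair A A) k) := by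
  rw [tc, mem_iter inferInstance isOrd_omega]
  simp

theorem self_mem_tc (A : M) : A ε tc A := mem_tc.2 (Or.inl rfl)

theorem isTransSet_tc (A : M) : IsTransSet mem (tc A) := by
  have hU : DFun fun v : Fin 1 → M => sUnion (v 0) := inferInstance
  intro x hx y hy
  rcases mem_tc.1 hx with rfl | ⟨k, hk, hx⟩
  · refine mem_tc.2 (Or.inr ⟨empty, by simp, mem_sUnion.2 ⟨x, ?_, hy⟩⟩)
    exact (mem_iter hU isOrd_empty).2 (Or.inl (by simp))
  · refine mem_tc.2 (Or.inr ⟨succ k, succ_mem_omega hk, mem_sUnion.2 ⟨x, ?_, hy⟩⟩)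
    exact mem_iter_succ hU (isOrd_nat hk) hx

theorem tc_subset {A S : M} (hA : A ε S) (hS : IsTransSet mem S) : IsSubset mem (tc A) S := by
  have hU : DFun fun v : Fin 1 → M => sUnion (v 0) := inferInstance
  have key : ∀ k, IsOrd mem k → ∀ x, x ε iter sUnion (upair A A) k → x ε S := by
    have := DFun.iter₁ hU (DFun.const (n := 1) (upair A A)) (DFun.proj 0)
    intro k hk
    refine ord_induction (P := fun k => IsSubset mem (iter sUnion (upair A A) k) S) ?_ hk
    intro k hk ih x hx
    rcases (mem_iter hU hk).1 hx with h | ⟨j, hj, h⟩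
    · obtain rfl : x = A := by simpa using h
      exact hA
    · obtain ⟨y, hy, hx⟩ := mem_sUnion.1 h
      exact hS y (ih j hj y hy) x hx
  exact key _ isOrd_omega

@[simp] theorem isTC_iff {A T : M} : IsTC mem A T ↔ T = tc A := by
  constructor
  · rintro ⟨⟨h1, h2⟩, h3⟩
    exact ext fun z => ⟨h3 _ (self_mem_tc A) (isTransSet_tc A) z, tc_subset h1 h2 z⟩
  · rintro rfl
    exact ⟨⟨self_mem_tc A, isTransSet_tc A⟩, fun S => tc_subset⟩

instance DFun.tc {n : ℕ} {F : (Fin n → M) → M} [hF : DFun F] : DFun fun v => SetModel.tc (F v) :=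
  DFun.app1 (DFun.of_graph (G := fun v y => IsTC SetStr.mem (v 0) y) inferInstance
    fun _ _ => isTC_iff.symm) hF

/-! ### Finite sequences -/

theorem isFun_empty {X f : M} : IsFun mem f empty X ↔ f = empty := by
  rw [isFun_iff]
  constructor
  · rintro ⟨h, _⟩
    refine ext fun p => ⟨fun hp => ?_, fun hp => (not_mem_empty hp).elim⟩
    obtain ⟨x, hx, _⟩ := mem_prod.1 (h p hp)
    exact (not_mem_empty hx).elim
  · rintro rfl; simp

section
variable {n s x X : M}

theorem IsFun.not_mem_dom (hs : IsFun mem s n X) {y : M} : ¬ opair n y ε s :=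
  fun h => not_mem_self n (hs.dom h)

theorem IsFun.adj (hs : IsFun mem s n X) (hx : x ε X) :
    IsFun mem (adj s (opair n x)) (succ n) X := by
  have h := isFun_iff.1 hs
  refine isFun_iff.2 ⟨fun p hp => ?_, fun i hi => ?_, fun i y z hy hz => ?_⟩
  · rcases mem_adj.1 hp with hp | rfl
    · obtain ⟨i, hi, y, hy, rfl⟩ := mem_prod.1 (h.1 p hp)
      exact opair_mem_prod.2 ⟨mem_succ.2 (Or.inl hi), hy⟩
    · exact opair_mem_prod.2 ⟨by simp, hx⟩
  · rcases mem_succ.1 hi with hi | rfl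
    · obtain ⟨y, hy⟩ := h.2.1 i hi
      exact ⟨y, mem_adj.2 (Or.inl hy)⟩
    · exact ⟨x, mem_adj.2 (Or.inr rfl)⟩
  · rcases mem_adj.1 hy with hy' | hy' <;> rcases mem_adj.1 hz with hz' | hz'
    · exact h.2.2 i y z hy' hz'
    · exact (hs.not_mem_dom ((opair_inj.1 hz').1 ▸ hy')).elim
    · exact (hs.not_mem_dom ((opair_inj.1 hy').1 ▸ hz')).elim
    · rw [(opair_inj.1 hy').2, (opair_inj.1 hz').2]

theorem IsFun.app_adj_self (hs : IsFun mem s n X) : app (SetModel.adj s (opair n x)) n = x :=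
  SetModel.app_eq (by simp) fun z hz => by
    rcases mem_adj.1 hz with h | h
    · exact (hs.not_mem_dom h).elim
    · exact (opair_inj.1 h).2

theorem IsFun.app_adj (hs : IsFun mem s n X) {i : M} (hi : i ε n) :
    app (SetModel.adj s (opair n x)) i = app s i :=
  SetModel.app_eq (mem_adj.2 (Or.inl (hs.opair_app hi))) fun z hz => by
    rcases mem_adj.1 hz with h | h
    · exact (hs.app_eq h).symm
    · exact (not_mem_self n ((opair_inj.1 h).1 ▸ hi)).elim

/-- The definitions of projection and section speak of `s ⊆ t`; this turns it into `t = s⌢⟨t(n)⟩`.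
-/
theorem IsFun.subset_iff {t : M} (hs : IsFun mem s n X) (ht : IsFun mem t (succ n) X) :
    IsSubset mem s t ↔ t = SetModel.adj s (opair n (app t n)) := by
  constructor
  · intro h
    refine ht.funext (hs.adj (ht.app_mem (by simp))) fun i hi => ?_
    rcases mem_succ.1 hi with hi' | rfl
    · rw [hs.app_adj hi']
      exact ht.app_eq (h _ (hs.opair_app hi'))
    · rw [hs.app_adj_self]
  · intro h p hp
    rw [h]
    exact mem_adj.2 (Or.inl hp)

/-- The restriction of a sequence of length `n + 1` to `n`. -/
theorem IsFun.exists_eq_adj {t : M} (ht : IsFun mem t (succ n) X) :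
    ∃ s, IsFun mem s n X ∧ t = SetModel.adj s (opair n (app t n)) := by
  have h1 : IsFun mem (SetModel.lam n fun i => SetModel.app t i) n X :=
    isFun_lam fun i hi => ht.app_mem (mem_succ.2 (Or.inl hi))
  refine ⟨_, h1, (h1.subset_iff ht).1 fun p hp => ?_⟩
  obtain ⟨i, hi, rfl⟩ := h1.mem_iff.1 hp
  rw [app_lam hi]
  exact ht.opair_app (mem_succ.2 (Or.inl hi))

end

/-! ### Definable subsets -/

/-- The relation `s(i) ∈ s(j)`. -/
noncomputable def memRel (X n i j : M) : M := sep (funs n X) fun s => app s i ε app s j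
/-- The relation `s(i) = s(j)`. -/
noncomputable def eqRel (X n i j : M) : M := sep (funs n X) fun s => app s i = app s j
/-- The complement of an `n`-ary relation. -/
noncomputable def complRel (X n R : M) : M := sep (funs n X) fun s => ¬ s ε R
/-- The intersection of two sets. -/
noncomputable def inter (R S : M) : M := sep R fun s => s ε S
/-- The projection of an `(n + 1)`-ary relation. -/
noncomputable def projRel (X n R : M) : M := sep (funs n X) fun s => ∃ t, t ε R ∧ IsSubset mem s t
/-- The section of an `(n + 1)`-ary relation at `s`. -/
noncomputable def secRel (X n s R : M) : M :=
  sep X fun a => ∃ t, t ε R ∧ IsSubset mem s t ∧ opair n a ε t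

section
variable {n : ℕ} {F G H K : (Fin n → M) → M} [hF : DFun F] [hG : DFun G] [hH : DFun H] [hK : DFun K]
instance DFun.memRel : DFun fun v => SetModel.memRel (F v) (G v) (H v) (K v) := by
  have := hF.weaken; have := hG.weaken; have := hH.weaken; have := hK.weaken
  unfold SetModel.memRel; infer_instance
instance DFun.eqRel : DFun fun v => SetModel.eqRel (F v) (G v) (H v) (K v) := by
  have := hF.weaken; have := hG.weaken; have := hH.weaken; have := hK.weaken
  unfold SetModel.eqRel; infer_instance
instance DFun.complRel : DFun fun v => SetModel.complRel (F v) (G v) (H v) :=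
  DFun.app3 (by unfold SetModel.complRel; infer_instance) hF hG hH
instance DFun.inter : DFun fun v => SetModel.inter (F v) (G v) :=
  DFun.app2 (by unfold SetModel.inter; infer_instance) hF hG
instance DFun.projRel : DFun fun v => SetModel.projRel (F v) (G v) (H v) :=
  DFun.app3 (by unfold SetModel.projRel; infer_instance) hF hG hH
instance DFun.secRel : DFun fun v => SetModel.secRel (F v) (G v) (H v) (K v) := by
  have := hF.weaken; have := hG.weaken.weaken; have := hH.weaken.weaken; have := hK.weaken.weaken
  have := hG.weaken; have := hH.weaken; have := hK.weaken
  unfold SetModel.secRel; infer_instance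
end

theorem defClosed_iff {X D : M} : DefClosed mem X D ↔
    (∀ n, n ε (omega : M) → ∀ i, i ε n → ∀ j, j ε n → opair n (memRel X n i j) ε D) ∧
    (∀ n, n ε (omega : M) → ∀ i, i ε n → ∀ j, j ε n → opair n (eqRel X n i j) ε D) ∧
    (∀ n, n ε (omega : M) → ∀ R, opair n R ε D → opair n (complRel X n R) ε D) ∧
    (∀ n, n ε (omega : M) → ∀ R S, opair n R ε D → opair n S ε D → opair n (inter R S) ε D) ∧
    ∀ n, n ε (omega : M) → ∀ R, opair (succ n) R ε D → opair n (projRel X n R) ε D := by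
  have hm : ∀ n i j R, i ε n → j ε n → ((∀ s, s ε R ↔ IsFun mem s n X ∧
      ∃ a b, PairMem mem i a s ∧ PairMem mem j b s ∧ a ε b) ↔ R = memRel X n i j) := by
    intro n i j R hi hj
    have : ∀ s, (IsFun mem s n X ∧ ∃ a b, PairMem mem i a s ∧ PairMem mem j b s ∧ a ε b) ↔
        s ε memRel X n i j := by
      intro s
      simp only [memRel, mem_sep, mem_funs, pairMem_iff]
      refine and_congr_right fun hs => ?_
      simp [hs.opair_mem, hi, hj]
    simp only [this]
    exact ⟨ext, fun h s => h ▸ Iff.rfl⟩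
  have he : ∀ n i j R, i ε n → j ε n → ((∀ s, s ε R ↔ IsFun mem s n X ∧
      ∃ a, PairMem mem i a s ∧ PairMem mem j a s) ↔ R = eqRel X n i j) := by
    intro n i j R hi hj
    have : ∀ s, (IsFun mem s n X ∧ ∃ a, PairMem mem i a s ∧ PairMem mem j a s) ↔
        s ε eqRel X n i j := by
      intro s
      simp only [eqRel, mem_sep, mem_funs, pairMem_iff]
      refine and_congr_right fun hs => ?_
      simp [hs.opair_mem, hi, hj]
    simp only [this]
    exact ⟨ext, fun h s => h ▸ Iff.rfl⟩
  have hc : ∀ n R S, (∀ s, s ε S ↔ IsFun mem s n X ∧ ¬ s ε R) ↔ S = complRel X n R := fun n R S =>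
    ⟨fun h => ext fun s => by simp [h, complRel], fun h s => by simp [h, complRel]⟩
  have hn : ∀ R S T : M, (∀ s, s ε T ↔ s ε R ∧ s ε S) ↔ T = inter R S := fun R S T =>
    ⟨fun h => ext fun s => by simp [h, inter], fun h s => by simp [h, inter]⟩
  have hp : ∀ n R S, (∀ s, s ε S ↔ IsFun mem s n X ∧ ∃ t, t ε R ∧ IsSubset mem s t) ↔
      S = projRel X n R := fun n R S =>
    ⟨fun h => ext fun s => by simp [h, projRel], fun h s => by simp [h, projRel]⟩
  constructor
  · rintro ⟨h1, h2, h3, h4, h5⟩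
    simp only [isNat_iff, pairMem_iff, isSucc_iff] at h1 h2 h3 h4 h5
    refine ⟨fun n hn' i hi j hj => h1 n i j _ hn' hi hj ?_, fun n hn' i hi j hj => h2 n i j _ hn' hi hj ?_,
      fun n hn' R hR => h3 n R _ hn' hR ?_, fun n hn' R S hR hS => h4 n R S _ hn' hR hS ?_,
      fun n hn' R hR => h5 n _ R _ hn' rfl hR ?_⟩
    · simpa only [pairMem_iff] using (hm n i j _ hi hj).2 rfl
    · simpa only [pairMem_iff] using (he n i j _ hi hj).2 rfl
    · exact (hc _ _ _).2 rfl
    · exact (hn _ _ _).2 rfl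
    · exact (hp _ _ _).2 rfl
  · rintro ⟨h1, h2, h3, h4, h5⟩
    constructor
    · intro n i j R hn' hi hj hR
      rw [(hm n i j R hi hj).1 hR]
      exact pairMem_iff.2 (h1 n (isNat_iff.1 hn') i hi j hj)
    · intro n i j R hn' hi hj hR
      rw [(he n i j R hi hj).1 hR]
      exact pairMem_iff.2 (h2 n (isNat_iff.1 hn') i hi j hj)
    · intro n R S hn' hR hS
      rw [(hc n R S).1 hS]
      exact pairMem_iff.2 (h3 n (isNat_iff.1 hn') R (pairMem_iff.1 hR))
    · intro n R S T hn' hR hS hT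
      rw [(hn R S T).1 hT]
      exact pairMem_iff.2 (h4 n (isNat_iff.1 hn') R S (pairMem_iff.1 hR) (pairMem_iff.1 hS))
    · intro n m R S hn' hm' hR hS
      rw [(hp n R S).1 hS]
      obtain rfl := isSucc_iff.1 hm'
      exact pairMem_iff.2 (h5 n (isNat_iff.1 hn') R (pairMem_iff.1 hR))

/-! ### The definable relations generated in `ω` steps -/

/-- One step in the generation of the definable relations on `X`. -/
noncomputable def relStep (X Z : M) : M :=
  -- The ambient set only makes separation applicable: a relation of finite arity on `X` is a subset
  -- of the union of all the sets of functions `n → X`.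
  sep (prod omega (power (sUnion (img omega fun n => funs n X)))) fun p =>
    (∃ n i j, i ε n ∧ j ε n ∧ p = opair n (memRel X n i j)) ∨
    (∃ n i j, i ε n ∧ j ε n ∧ p = opair n (eqRel X n i j)) ∨
    (∃ n R, opair n R ε Z ∧ p = opair n (complRel X n R)) ∨
    (∃ n R S, opair n R ε Z ∧ opair n S ε Z ∧ p = opair n (inter R S)) ∨
    ∃ n R, opair (succ n) R ε Z ∧ p = opair n (projRel X n R)

set_option synthInstance.maxSize 2000 in
set_option synthInstance.maxHeartbeats 400000 in
theorem mem_relStep {X Z p : M} : p ε relStep X Z ↔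
    p ε prod omega (power (sUnion (img omega fun n => funs n X))) ∧
    ((∃ n i j, i ε n ∧ j ε n ∧ p = opair n (memRel X n i j)) ∨
    (∃ n i j, i ε n ∧ j ε n ∧ p = opair n (eqRel X n i j)) ∨
    (∃ n R, opair n R ε Z ∧ p = opair n (complRel X n R)) ∨
    (∃ n R S, opair n R ε Z ∧ opair n S ε Z ∧ p = opair n (inter R S)) ∨
    ∃ n R, opair (succ n) R ε Z ∧ p = opair n (projRel X n R)) := mem_sep

set_option synthInstance.maxSize 2000 in
set_option synthInstance.maxHeartbeats 400000 in
instance DFun.relStep {n : ℕ} {F G : (Fin n → M) → M} [hF : DFun F] [hG : DFun G] :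
    DFun fun v => SetModel.relStep (F v) (G v) :=
  DFun.app2 (by unfold SetModel.relStep; infer_instance) hF hG

/-- The set of pairs `(n, R)` with `R` an `n`-ary definable relation on `X`. -/
noncomputable def defRels (X : M) : M := iter (relStep X) empty omega

/-- `defRels X` is the least closed family. It is closed because the premises of each rule, at most
two, already occur at a common finite stage; it is least because induction places every stage inside
each closed family. -/
theorem isDefRel_iff {X n R : M} : IsDefRel mem X n R ↔ opair n R ε defRels X := by
  have hH : DFun fun v : Fin 1 → M => relStep X (v 0) := inferInstance
  have hI : DFun fun v : Fin 1 → M => iter (relStep X) empty (v 0) :=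
    DFun.iter₁ hH (DFun.const empty) (DFun.proj 0)
  have hmem : ∀ {x : M}, x ε defRels X ↔
      ∃ k, k ε (omega : M) ∧ x ε relStep X (iter (relStep X) empty k) := by
    intro x
    rw [defRels, mem_iter hH isOrd_omega]
    simp
  have hamb : ∀ {n R : M}, opair n R ε prod omega (power (sUnion (img omega fun n => funs n X))) ↔
      n ε (omega : M) ∧ ∀ s, s ε R → ∃ k, k ε (omega : M) ∧ IsFun mem s k X := by
    intro n R
    simp [IsSubset]
  have hclosed : DefClosed mem X (defRels X) := by
    have hup : ∀ {x : M}, x ε defRels X → ∃ k, k ε (omega : M) ∧ x ε iter (relStep X) empty k := by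
      intro x hx
      obtain ⟨k, hk, h⟩ := hmem.1 hx
      exact ⟨succ k, succ_mem_omega hk, mem_iter_succ hH (isOrd_nat hk) h⟩
    have hsub : ∀ {n R s : M}, opair n R ε defRels X → s ε R → ∃ k, k ε (omega : M) ∧ IsFun mem s k X := by
      intro n R s h hs
      obtain ⟨k, _, h⟩ := hmem.1 h
      exact (hamb.1 (mem_relStep.1 h).1).2 s hs
    refine defClosed_iff.2 ⟨fun n hn i hi j hj => ?_, fun n hn i hi j hj => ?_, fun n hn R hR => ?_,
      fun n hn R S hR hS => ?_, fun n hn R hR => ?_⟩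
    · refine hmem.2 ⟨empty, by simp, mem_relStep.2 ⟨hamb.2 ⟨hn, fun s hs => ⟨n, hn, ?_⟩⟩, ?_⟩⟩
      · exact mem_funs.1 (mem_sep.1 hs).1
      · exact Or.inl ⟨n, i, j, hi, hj, rfl⟩
    · refine hmem.2 ⟨empty, by simp, mem_relStep.2 ⟨hamb.2 ⟨hn, fun s hs => ⟨n, hn, ?_⟩⟩, ?_⟩⟩
      · exact mem_funs.1 (mem_sep.1 hs).1
      · exact Or.inr (Or.inl ⟨n, i, j, hi, hj, rfl⟩)
    · obtain ⟨k, hk, h⟩ := hup hR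
      refine hmem.2 ⟨k, hk, mem_relStep.2 ⟨hamb.2 ⟨hn, fun s hs => ⟨n, hn, ?_⟩⟩, ?_⟩⟩
      · exact mem_funs.1 (mem_sep.1 hs).1
      · exact Or.inr (Or.inr (Or.inl ⟨n, R, h, rfl⟩))
    · obtain ⟨k, hk, h⟩ := hup hR
      obtain ⟨l, hl, h'⟩ := hup hS
      have hsb : ∀ s, s ε inter R S → ∃ k, k ε (omega : M) ∧ IsFun mem s k X :=
        fun s hs => hsub hR (mem_sep.1 hs).1
      rcases ord_trichotomy (isOrd_nat hk) (isOrd_nat hl) with hkl | rfl | hkl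
      · refine hmem.2 ⟨l, hl, mem_relStep.2 ⟨hamb.2 ⟨hn, hsb⟩, ?_⟩⟩
        exact Or.inr (Or.inr (Or.inr (Or.inl ⟨n, R, S,
          iter_mono hH (isOrd_nat hl) ((isOrd_nat hl).1 k hkl) (isOrd_nat hk) h, h', rfl⟩)))
      · refine hmem.2 ⟨k, hk, mem_relStep.2 ⟨hamb.2 ⟨hn, hsb⟩, ?_⟩⟩
        exact Or.inr (Or.inr (Or.inr (Or.inl ⟨n, R, S, h, h', rfl⟩)))
      · refine hmem.2 ⟨k, hk, mem_relStep.2 ⟨hamb.2 ⟨hn, hsb⟩, ?_⟩⟩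
        exact Or.inr (Or.inr (Or.inr (Or.inl ⟨n, R, S, h,
          iter_mono hH (isOrd_nat hk) ((isOrd_nat hk).1 l hkl) (isOrd_nat hl) h', rfl⟩)))
    · obtain ⟨k, hk, h⟩ := hup hR
      refine hmem.2 ⟨k, hk, mem_relStep.2 ⟨hamb.2 ⟨hn, fun s hs => ⟨n, hn, ?_⟩⟩, ?_⟩⟩
      · exact mem_funs.1 (mem_sep.1 hs).1
      · exact Or.inr (Or.inr (Or.inr (Or.inr ⟨n, R, h, rfl⟩)))
  constructor
  · exact fun h => pairMem_iff.1 (h _ hclosed)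
  · intro h D hD
    obtain ⟨h1, h2, h3, h4, h5⟩ := defClosed_iff.1 hD
    have key : ∀ k, IsOrd mem k → IsSubset mem (iter (relStep X) empty k) D := by
      intro k hk
      refine ord_induction (P := fun k => IsSubset mem (iter (relStep X) empty k) D) ?_ hk
      intro k hk ih p hp
      rcases (mem_iter hH hk).1 hp with h | ⟨j, hj, h⟩
      · exact (not_mem_empty h).elim
      · obtain ⟨h, h'⟩ := mem_relStep.1 h
        rcases h' with ⟨n, i, j, hi, hj, rfl⟩ | ⟨n, i, j, hi, hj, rfl⟩ | ⟨n, R, hR, rfl⟩ |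
          ⟨n, R, S, hR, hS, rfl⟩ | ⟨n, R, hR, rfl⟩ <;> have hn := (hamb.1 h).1
        · exact h1 n hn i hi _ ‹_›
        · exact h2 n hn i hi _ ‹_›
        · exact h3 n hn R (ih _ hj _ hR)
        · exact h4 n hn R S (ih _ hj _ hR) (ih _ hj _ hS)
        · exact h5 n hn R (ih _ hj _ hR)
    exact pairMem_iff.2 (key _ isOrd_omega _ h)

theorem defClosed_defRels (X : M) : DefClosed mem X (defRels X) := by
  have : ∀ {n R D : M}, opair n R ε defRels X → DefClosed mem X D → opair n R ε D :=
    fun h hD => pairMem_iff.1 (isDefRel_iff.2 h _ hD)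
  refine defClosed_iff.2 ⟨fun n hn i hi j hj => ?_, fun n hn i hi j hj => ?_, fun n hn R hR => ?_,
      fun n hn R S hR hS => ?_, fun n hn R hR => ?_⟩ <;>
    refine isDefRel_iff.1 fun D hD => pairMem_iff.2 ?_ <;>
    obtain ⟨h1, h2, h3, h4, h5⟩ := defClosed_iff.1 hD
  · exact h1 n hn i hi j hj
  · exact h2 n hn i hi j hj
  · exact h3 n hn R (this hR hD)
  · exact h4 n hn R S (this hR hD) (this hS hD)
  · exact h5 n hn R (this hR hD)

theorem inDef_iff {X x : M} : InDef mem X x ↔ ∃ n, n ε (omega : M) ∧ ∃ s R, IsFun mem s n X ∧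
    opair (succ n) R ε defRels X ∧ x = secRel X n s R := by
  have hx : ∀ n s R, (∀ a, a ε x ↔ a ε X ∧ ∃ t, t ε R ∧ IsSubset mem s t ∧ PairMem mem n a t) ↔
      x = secRel X n s R := by
    intro n s R
    have : ∀ a, a ε secRel X n s R ↔ a ε X ∧ ∃ t, t ε R ∧ IsSubset mem s t ∧ opair n a ε t :=
      fun a => by rw [secRel, mem_sep]
    simp only [pairMem_iff, ← this]
    exact ⟨ext, fun h a => h ▸ Iff.rfl⟩
  simp only [InDef, isNat_iff, isSucc_iff, isDefRel_iff, hx]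
  constructor
  · rintro ⟨n, m, s, R, hn, rfl, hs, hR, hx⟩; exact ⟨n, hn, s, R, hs, hR, hx⟩
  · rintro ⟨n, hn, s, R, hs, hR, hx⟩; exact ⟨n, _, s, R, hn, rfl, hs, hR, hx⟩

/-- The set of definable subsets of `X`. -/
noncomputable def defSet (X : M) : M := sep (power X) fun x => InDef mem X x

@[simp] theorem mem_defSet {X x : M} : x ε defSet X ↔ InDef mem X x := by
  refine mem_sep.trans ⟨fun h => h.2, fun h => ⟨mem_power.2 fun a ha => ?_, h⟩⟩
  obtain ⟨n, _, s, R, _, _, rfl⟩ := inDef_iff.1 h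
  exact (mem_sep.1 ha).1

instance DFun.defSet {n : ℕ} {F : (Fin n → M) → M} [hF : DFun F] :
    DFun fun v => SetModel.defSet (F v) :=
  DFun.app1 (H := fun X => SetModel.defSet X) (by unfold SetModel.defSet; infer_instance) hF

/-! ### Satisfaction by internal finite sequences -/

/-- Satisfaction, with quantifiers over the class `Q`, by an internal finite sequence. -/
noncomputable def Fml.SatS (Q : M → Prop) : {n : ℕ} → Fml n → M → Prop
  | _, .mem i j, s => app s (num i) ε app s (num j)
  | _, .eq i j, s => app s (num i) = app s (num j)
  | _, .neg φ, s => ¬ φ.SatS Q s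
  | _, .and φ ψ, s => φ.SatS Q s ∧ ψ.SatS Q s
  | n, .ex φ, s => ∃ y, Q y ∧ φ.SatS Q (adj s (opair (num n) y))

theorem Fml.dfn_satS {Q : M → Prop} (hQ : Dfn fun v : Fin 1 → M => Q (v 0)) {k : ℕ} (φ : Fml k) :
    Dfn fun v : Fin 1 → M => φ.SatS Q (v 0) := by
  induction φ with
  | mem i j => unfold Fml.SatS; infer_instance
  | eq i j => unfold Fml.SatS; infer_instance
  | neg φ ih => unfold Fml.SatS; infer_instance
  | and φ ψ ih1 ih2 => unfold Fml.SatS; infer_instance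
  | @ex k φ ih =>
    unfold Fml.SatS
    have h1 : Dfn fun w : Fin 2 → M => Q (w 1) := hQ.app1 (DFun.proj 1)
    have h2 : Dfn fun w : Fin 2 → M => φ.SatS Q (adj (w 0) (opair (num k) (w 1))) :=
      ih.app1 inferInstance
    exact Dfn.ex (hP := Dfn.and (hP := h1) (hQ := h2))

/-- The internal sequence with the given entries. -/
noncomputable def seqOf : {n : ℕ} → (Fin n → M) → M
  | 0, _ => empty
  | n + 1, v => adj (seqOf fun i : Fin n => v i.castSucc) (opair (num n) (v (Fin.last n)))

theorem seqOf_snoc {n : ℕ} (v : Fin n → M) (y : M) :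
    seqOf (snoc v y) = adj (seqOf v) (opair (num n) y) := by
  simp [seqOf, snoc]

theorem isFun_seqOf {n : ℕ} {v : Fin n → M} {X : M} (h : ∀ i, v i ε X) :
    IsFun mem (seqOf v) (num n) X := by
  induction n with
  | zero => exact isFun_empty.2 rfl
  | succ n ih => exact (ih fun i => h i.castSucc).adj (h _)

theorem app_seqOf {n : ℕ} {v : Fin n → M} {X : M} (h : ∀ i, v i ε X) (i : Fin n) :
    app (seqOf v) (num i) = v i := by
  induction n with
  | zero => exact i.elim0
  | succ n ih =>
    have hs := isFun_seqOf fun i : Fin n => h i.castSucc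
    refine Fin.lastCases ?_ (fun i => ?_) i
    · exact hs.app_adj_self
    · exact (hs.app_adj (mem_num.2 ⟨i, rfl⟩)).trans (ih (fun i => h i.castSucc) i)

/-- The set of values of a finite tuple. -/
theorem exists_tuple_set {n : ℕ} (v : Fin n → M) : ∃ X, ∀ i, v i ε X := by
  induction n with
  | zero => exact ⟨empty, fun i => i.elim0⟩
  | succ n ih =>
    obtain ⟨X, hX⟩ := ih fun i => v i.castSucc
    refine ⟨adj X (v (Fin.last n)), fun i => ?_⟩
    refine Fin.lastCases ?_ (fun i => ?_) i
    · simp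
    · exact mem_adj.2 (Or.inl (hX i))

/-- External tuples are replaced by finite sequences of the model, over which the model can quantify
and collect. -/
theorem Fml.sat_iff_satS {Q : M → Prop} {k : ℕ} (φ : Fml k) (v : Fin k → {x // Q x}) :
    φ.Sat v ↔ φ.SatS Q (seqOf fun i => (v i).1) := by
  induction φ with
  | mem i j =>
    obtain ⟨X, hX⟩ := exists_tuple_set fun i => (v i).1
    simp only [Fml.Sat, Fml.SatS, app_seqOf hX]
    exact Iff.rfl
  | eq i j =>
    obtain ⟨X, hX⟩ := exists_tuple_set fun i => (v i).1
    simp only [Fml.Sat, Fml.SatS, app_seqOf hX]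
    exact Subtype.ext_iff
  | neg φ ih => exact not_congr (ih v)
  | and φ ψ ih1 ih2 => exact and_congr (ih1 v) (ih2 v)
  | @ex k φ ih =>
    have hs : ∀ y : {x // Q x}, (fun i => (snoc v y i).1) = snoc (fun i => (v i).1) y.1 := by
      intro y
      funext i
      refine Fin.lastCases ?_ (fun i => ?_) i <;> simp [snoc]
    simp only [Fml.Sat, Fml.SatS, ih, hs, seqOf_snoc, Subtype.exists, exists_prop]

/-- Every formula defines a relation. -/
theorem Fml.exists_rel (X : M) {k : ℕ} (φ : Fml k) : ∃ R, opair (num k) R ε defRels X ∧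
    ∀ s, s ε R ↔ IsFun SetStr.mem s (num k) X ∧ φ.SatS (fun x => x ε X) s := by
  obtain ⟨h1, h2, h3, h4, h5⟩ := defClosed_iff.1 (defClosed_defRels X)
  induction φ with
  | mem i j =>
    refine ⟨_, h1 _ (num_mem_omega _) _ (mem_num.2 ⟨i, rfl⟩) _ (mem_num.2 ⟨j, rfl⟩), fun s => ?_⟩
    rw [memRel, mem_sep, mem_funs]; rfl
  | eq i j =>
    refine ⟨_, h2 _ (num_mem_omega _) _ (mem_num.2 ⟨i, rfl⟩) _ (mem_num.2 ⟨j, rfl⟩), fun s => ?_⟩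
    rw [eqRel, mem_sep, mem_funs]; rfl
  | neg φ ih =>
    obtain ⟨R, hR, h⟩ := ih
    refine ⟨_, h3 _ (num_mem_omega _) R hR, fun s => ?_⟩
    rw [complRel, mem_sep, mem_funs, h]
    simp only [Fml.SatS]
    tauto
  | and φ ψ ih1 ih2 =>
    obtain ⟨R, hR, h⟩ := ih1
    obtain ⟨S, hS, h'⟩ := ih2
    refine ⟨_, h4 _ (num_mem_omega _) R S hR hS, fun s => ?_⟩
    rw [inter, mem_sep, h, h']
    simp only [Fml.SatS]
    tauto
  | @ex k φ ih =>
    obtain ⟨R, hR, h⟩ := ih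
    refine ⟨_, h5 _ (num_mem_omega _) R hR, fun s => ?_⟩
    rw [projRel, mem_sep, mem_funs]
    simp only [Fml.SatS]
    refine and_congr_right fun hs => ⟨?_, ?_⟩
    · rintro ⟨t, ht, hst⟩
      obtain ⟨ht, ht'⟩ := (h t).1 ht
      refine ⟨_, ht.app_mem (mem_succ.2 (Or.inr rfl)), ?_⟩
      rw [← (hs.subset_iff ht).1 hst]
      exact ht'
    · rintro ⟨y, hy, h'⟩
      exact ⟨_, (h _).2 ⟨hs.adj hy, h'⟩, fun p hp => mem_adj.2 (Or.inl hp)⟩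

/-- The internal notion `Def` captures definability by each external formula: the parameters form
the sequence `s`, and the last variable supplies the section. -/
theorem Fml.inDef {X x : M} {k : ℕ} (φ : Fml (k + 1)) (v : Fin k → M) (hv : ∀ i, v i ε X)
    (hx : ∀ a, a ε x ↔ a ε X ∧ φ.SatS (fun x => x ε X) (seqOf (snoc v a))) : InDef SetStr.mem X x := by
  obtain ⟨R, hR, h⟩ := φ.exists_rel X
  have hs := isFun_seqOf hv
  refine inDef_iff.2 ⟨num k, num_mem_omega k, seqOf v, R, hs, hR, ext fun a => ?_⟩
  rw [hx, secRel, mem_sep]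
  refine and_congr_right fun ha => ?_
  rw [seqOf_snoc]
  constructor
  · exact fun h' => ⟨_, (h _).2 ⟨hs.adj ha, h'⟩, fun p hp => mem_adj.2 (Or.inl hp), by simp⟩
  · rintro ⟨t, ht, hst, hat⟩
    obtain ⟨ht, ht'⟩ := (h t).1 ht
    have := (hs.subset_iff ht).1 hst
    rw [ht.app_eq hat] at this
    rwa [← this]

/-- A subset of `X` that is definable over the structure `X` belongs to `Def(X)`. -/
theorem inDef_of_dfn {X x : M} {P : {y // y ε X} → Prop}
    (hP : Dfn fun v : Fin 1 → {y // y ε X} => P (v 0)) (hx : ∀ a, a ε x ↔ ∃ h : a ε X, P ⟨a, h⟩) :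
    InDef mem X x := by
  obtain ⟨k, φ, t, h⟩ := hP.last
  refine φ.inDef (fun i => (ev Fin.elim0 (t i)).1) (fun i => (ev Fin.elim0 (t i)).2) fun a => ?_
  rw [hx]
  refine (exists_congr fun ha => ?_).trans exists_prop
  have h' := (h Fin.elim0 ⟨a, ha⟩).trans (φ.sat_iff_satS _)
  have e1 : ∀ y : {y // y ε X}, (snoc Fin.elim0 y : Fin 1 → _) 0 = y := fun y => rfl
  rw [e1] at h'
  rw [h']
  refine iff_of_eq (congrArg _ (congrArg _ (funext fun i => ?_)))
  refine Fin.lastCases ?_ (fun i => ?_) i <;> simp [snoc]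

theorem self_mem_defSet (X : M) : X ε defSet X :=
  mem_defSet.2 (inDef_of_dfn (P := fun _ => True) inferInstance fun a => by simp)

theorem mem_defSet_of_mem {X x : M} (hX : IsTransSet mem X) (hx : x ε X) : x ε defSet X :=
  mem_defSet.2 (inDef_of_dfn (P := fun a => a ε (⟨x, hx⟩ : {y // y ε X})) inferInstance fun a =>
    ⟨fun h => ⟨hX x hx a h, h⟩, fun ⟨_, h⟩ => h⟩)

/-! ### The hierarchy `L_β(A)` -/

/-- The level `L_β(A)`. -/
noncomputable def Lv (A β : M) : M := iter defSet (tc A) β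

theorem dFun_defSet : DFun fun v : Fin 1 → M => defSet (v 0) := inferInstance

instance DFun.lv {n : ℕ} {F G : (Fin n → M) → M} [hF : DFun F] [hG : DFun G] :
    DFun fun v => Lv (F v) (G v) :=
  DFun.iter₁ dFun_defSet (DFun.tc (F := F)) hG

theorem mem_Lv {A β x : M} (hβ : IsOrd mem β) :
    x ε Lv A β ↔ x ε tc A ∨ ∃ γ, γ ε β ∧ x ε defSet (Lv A γ) := mem_iter dFun_defSet hβ

theorem isHierarchy_iff {A d f : M} :
    IsHierarchy mem A d f ↔ IsIter defSet (tc A) d f := by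
  simp only [IsHierarchy, isTC_iff, IsIter, exists_and_left, exists_eq_left, pairMem_iff]
  refine exists_congr fun c => and_congr_right fun hf => ?_
  simp only [hf.opair_mem, and_imp, mem_defSet]
  constructor
  · intro h β hβ x
    rw [h β _ hβ rfl]
    exact or_congr_right (exists_congr fun γ => and_congr_right fun hγ => by simp)
  · rintro h β Y hβ rfl x
    rw [h β hβ]
    exact or_congr_right (exists_congr fun γ => and_congr_right fun hγ => by simp)

theorem inL_iff {A x : M} : InL mem A x ↔ ∃ β, IsOrd mem β ∧ x ε Lv A β := by
  constructor
  · rintro ⟨d, f, β, Y, hd, hf, hY, hx⟩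
    rw [isHierarchy_iff] at hf
    have hfun := hf.choose_spec.1
    obtain ⟨hβ, rfl⟩ := hfun.opair_mem.1 (pairMem_iff.1 hY)
    refine ⟨β, hd.mem hβ, ?_⟩
    rwa [Lv, iter_eq dFun_defSet hd hf hβ]
  · rintro ⟨β, hβ, hx⟩
    obtain ⟨f, hf⟩ := exists_isIter dFun_defSet (tc A) hβ.succ
    have hβ' : β ε succ β := by simp
    refine ⟨succ β, f, β, app f β, hβ.succ, isHierarchy_iff.2 hf,
      pairMem_iff.2 (hf.choose_spec.1.opair_app hβ'), ?_⟩
    rwa [Lv, iter_eq dFun_defSet hβ.succ hf hβ'] at hx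

theorem isTransSet_Lv (A : M) {β : M} (hβ : IsOrd mem β) : IsTransSet mem (Lv A β) := by
  refine ord_induction (P := fun β => IsTransSet mem (Lv A β)) (fun β hβ ih => ?_) hβ
  intro x hx y hy
  rw [mem_Lv hβ] at hx ⊢
  rcases hx with hx | ⟨γ, hγ, hx⟩
  · exact Or.inl (isTransSet_tc A x hx y hy)
  · refine Or.inr ⟨γ, hγ, mem_defSet_of_mem (ih γ hγ) ?_⟩
    exact mem_power.1 (mem_sep.1 hx).1 y hy

theorem Lv_subset {A α β : M} (hβ : IsOrd mem β) (hα : α ε β) : IsSubset mem (Lv A α) (Lv A β) :=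
  fun _ hx => iter_mono dFun_defSet hβ (hβ.1 α hα) (hβ.mem hα) hx

theorem Lv_mem {A α β : M} (hβ : IsOrd mem β) (hα : α ε β) : Lv A α ε Lv A β :=
  (mem_Lv hβ).2 (Or.inr ⟨α, hα, self_mem_defSet _⟩)

theorem mem_Lv_succ {A β x : M} (hβ : IsOrd mem β) (hx : InDef mem (Lv A β) x) :
    x ε Lv A (succ β) := (mem_Lv hβ.succ).2 (Or.inr ⟨β, by simp, mem_defSet.2 hx⟩)

theorem tc_subset_Lv {A β x : M} (hβ : IsOrd mem β) (hx : x ε tc A) : x ε Lv A β :=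
  (mem_Lv hβ).2 (Or.inl hx)

end
end SetModel

namespace SetModel
universe u
open SetStr

section
variable {M : Type u} [SetStr M] [ZFM M]

/-! ### Reflection for `L(A)` -/

theorem InL.trans {A x y : M} (h : InL mem A x) (hy : y ε x) : InL mem A y := by
  obtain ⟨β, hβ, hx⟩ := inL_iff.1 h
  exact inL_iff.2 ⟨β, hβ, isTransSet_Lv A hβ x hx y hy⟩

theorem inL_of_mem_Lv {A β x : M} (hβ : IsOrd mem β) (hx : x ε Lv A β) : InL mem A x :=
  inL_iff.2 ⟨β, hβ, hx⟩

theorem inL_Lv (A : M) {β : M} (hβ : IsOrd mem β) : InL mem A (Lv A β) :=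
  inL_iff.2 ⟨succ β, hβ.succ, Lv_mem hβ.succ (by simp)⟩

theorem exists_Lv_superset {A a : M} (h : ∀ x, x ε a → InL mem A x) :
    ∃ β, IsOrd mem β ∧ IsSubset mem a (Lv A β) := by
  obtain ⟨δ, hδ, h'⟩ := ord_collection (Q := fun x α => x ε Lv A α) a
  refine ⟨δ, hδ, fun x hx => ?_⟩
  obtain ⟨α, hα, hx'⟩ := h' x hx (inL_iff.1 (h x hx))
  exact Lv_subset hδ hα x hx'

/-- Existential subformulas of `φ` with parameters in `X` have witnesses in `Y` if they have
witnesses in `Q`. -/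
def Fml.Wit (Q : M → Prop) : {n : ℕ} → Fml n → M → M → Prop
  | _, .mem _ _, _, _ => True
  | _, .eq _ _, _, _ => True
  | _, .neg φ, X, Y => φ.Wit Q X Y
  | _, .and φ ψ, X, Y => φ.Wit Q X Y ∧ ψ.Wit Q X Y
  | n, .ex φ, X, Y => φ.Wit Q X Y ∧ ∀ s, IsFun SetStr.mem s (num n) X →
      (∃ y, Q y ∧ φ.SatS Q (adj s (opair (num n) y))) →
      ∃ y, y ε Y ∧ φ.SatS Q (adj s (opair (num n) y))

theorem Fml.Wit.mono {Q : M → Prop} {n : ℕ} {φ : Fml n} {X Y Z : M} (h : φ.Wit Q X Y)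
    (hYZ : IsSubset SetStr.mem Y Z) : φ.Wit Q X Z := by
  induction φ with
  | mem i j => trivial
  | eq i j => trivial
  | neg φ ih => exact ih h
  | and φ ψ ih1 ih2 => exact ⟨ih1 h.1, ih2 h.2⟩
  | ex φ ih =>
    refine ⟨ih h.1, fun s hs hy => ?_⟩
    obtain ⟨y, hy, h⟩ := h.2 s hs hy
    exact ⟨y, hYZ y hy, h⟩

theorem Fml.dfn_wit {Q : M → Prop} (hQ : Dfn fun v : Fin 1 → M => Q (v 0)) {n : ℕ} (φ : Fml n) :
    Dfn fun v : Fin 2 → M => φ.Wit Q (v 0) (v 1) := by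
  induction φ with
  | mem i j => unfold Fml.Wit; infer_instance
  | eq i j => unfold Fml.Wit; infer_instance
  | neg φ ih => unfold Fml.Wit; infer_instance
  | and φ ψ ih1 ih2 => unfold Fml.Wit; infer_instance
  | ex φ ih =>
    unfold Fml.Wit
    have h1 : ∀ {n : ℕ} {F : (Fin n → M) → M} [hF : DFun F], Dfn fun v => Q (F v) :=
      fun {_ _} [_] => hQ.app1 inferInstance
    have h2 : ∀ {n : ℕ} {F : (Fin n → M) → M} [hF : DFun F], Dfn fun v => φ.SatS Q (F v) :=
      fun {_ _} [_] => (φ.dfn_satS hQ).app1 inferInstance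
    infer_instance

/-- Finite parameter sequences from `L_β(A)` form a set, so collection bounds the levels at which
witnesses for an existential subformula first appear. The finitely many subformulas are then
combined. -/
theorem Fml.exists_wit (A : M) {n : ℕ} (φ : Fml n) {β : M} (hβ : IsOrd SetStr.mem β) :
    ∃ γ, IsOrd SetStr.mem γ ∧ φ.Wit (InL SetStr.mem A) (Lv A β) (Lv A γ) := by
  have union_ord : ∀ {α γ : M}, IsOrd SetStr.mem α → IsOrd SetStr.mem γ →
      ∃ δ, IsOrd SetStr.mem δ ∧ IsSubset SetStr.mem (Lv A α) (Lv A δ) ∧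
        IsSubset SetStr.mem (Lv A γ) (Lv A δ) := by
    intro α γ hα hγ
    rcases ord_trichotomy hα hγ with h | rfl | h
    · exact ⟨γ, hγ, Lv_subset hγ h, fun _ h => h⟩
    · exact ⟨α, hα, fun _ h => h, fun _ h => h⟩
    · exact ⟨α, hα, fun _ h => h, Lv_subset hα h⟩
  induction φ with
  | mem i j => exact ⟨β, hβ, trivial⟩
  | eq i j => exact ⟨β, hβ, trivial⟩
  | neg φ ih => exact ih
  | and φ ψ ih1 ih2 =>
    obtain ⟨γ, hγ, h⟩ := ih1
    obtain ⟨γ', hγ', h'⟩ := ih2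
    obtain ⟨δ, hδ, h1, h2⟩ := union_ord hγ hγ'
    exact ⟨δ, hδ, h.mono h1, h'.mono h2⟩
  | @ex n φ ih =>
    obtain ⟨γ, hγ, h⟩ := ih
    have h2 : ∀ {n : ℕ} {F : (Fin n → M) → M} [hF : DFun F],
        Dfn fun v => φ.SatS (InL SetStr.mem A) (F v) :=
      fun {_ _} [_] => (φ.dfn_satS inferInstance).app1 inferInstance
    obtain ⟨δ, hδ, h'⟩ := ord_collection (Q := fun s α => ∃ y, y ε Lv A α ∧
      φ.SatS (InL SetStr.mem A) (adj s (opair (num n) y))) (funs (num n) (Lv A β))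
    obtain ⟨η, hη, h3, h4⟩ := union_ord hγ hδ
    refine ⟨η, hη, h.mono h3, fun s hs ⟨y, hy, hφ⟩ => ?_⟩
    obtain ⟨α, hα, hy⟩ := inL_iff.1 hy
    obtain ⟨α, hα, y, hy, hφ⟩ := h' s (mem_funs.2 hs) ⟨α, hα, y, hy, hφ⟩
    exact ⟨y, h4 y (Lv_subset hδ hα y hy), hφ⟩

/-- The Tarski–Vaught criterion, for one formula and its subformulas. -/
theorem Fml.satS_iff_of_wit {Q : M → Prop} {X : M} (hX : ∀ x, x ε X → Q x) {n : ℕ} {φ : Fml n}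
    (h : φ.Wit Q X X) {s : M} (hs : IsFun SetStr.mem s (num n) X) :
    φ.SatS (fun x => x ε X) s ↔ φ.SatS Q s := by
  induction φ generalizing s with
  | mem i j => exact Iff.rfl
  | eq i j => exact Iff.rfl
  | neg φ ih => exact not_congr (ih h hs)
  | and φ ψ ih1 ih2 => exact and_congr (ih1 h.1 hs) (ih2 h.2 hs)
  | ex φ ih =>
    constructor
    · rintro ⟨y, hy, hφ⟩
      exact ⟨y, hX y hy, (ih h.1 (hs.adj hy)).1 hφ⟩
    · intro hy
      obtain ⟨y, hy, hφ⟩ := h.2 s hs hy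
      exact ⟨y, hy, (ih h.1 (hs.adj hy)).2 hφ⟩

/-- A finite sequence in the union of an increasing `ω`-chain lies in a member of the chain. -/
theorem isFun_of_chain {G : M → M} [hG : DFun fun v : Fin 1 → M => G (v 0)]
    (hmono : ∀ j k, j ε k → k ε (omega : M) → IsSubset mem (G j) (G k)) {X : M}
    (hX : ∀ x, x ε X → ∃ k, k ε (omega : M) ∧ x ε G k) {n : M} (hn : n ε (omega : M)) :
    ∀ s, IsFun mem s n X → ∃ k, k ε (omega : M) ∧ IsFun mem s n (G k) := by
  have hG' : ∀ {n : ℕ} {F : (Fin n → M) → M} [hF : DFun F], DFun fun v => G (F v) :=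
    fun {_ _} [_] => hG.app1 inferInstance
  refine nat_induction
    (P := fun n => ∀ s, IsFun mem s n X → ∃ k, k ε (omega : M) ∧ IsFun mem s n (G k)) ?_ ?_ hn
  · intro s hs
    obtain rfl := isFun_empty.1 hs
    exact ⟨empty, by simp, isFun_empty.2 rfl⟩
  · intro n hn ih t ht
    obtain ⟨s, hs, he⟩ := ht.exists_eq_adj
    obtain ⟨k, hk, hs'⟩ := ih s hs
    obtain ⟨l, hl, hx⟩ := hX _ (ht.app_mem (mem_succ.2 (Or.inr rfl)))
    rw [he]
    rcases ord_trichotomy (isOrd_nat hk) (isOrd_nat hl) with h | rfl | h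
    · exact ⟨l, hl, (hs'.mono (hmono k l h hl)).adj hx⟩
    · exact ⟨k, hk, hs'.adj hx⟩
    · exact ⟨k, hk, hs'.adj (hmono l k h hk _ hx)⟩

/-- A level closed under witnesses is reached by alternating `ω` times between a level and one
containing the witnesses for it. -/
theorem Fml.reflection (A : M) {n : ℕ} (φ : Fml n) {β : M} (hβ : IsOrd SetStr.mem β) :
    ∃ δ, IsOrd SetStr.mem δ ∧ β ε δ ∧ ∀ s, IsFun SetStr.mem s (num n) (Lv A δ) →
      (φ.SatS (fun x => x ε Lv A δ) s ↔ φ.SatS (InL SetStr.mem A) s) := by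
  have hW : ∀ {n : ℕ} {F G : (Fin n → M) → M} [hF : DFun F] [hG : DFun G],
      Dfn fun v => φ.Wit (InL SetStr.mem A) (F v) (G v) :=
    fun {_ _ _} [_] [_] => (φ.dfn_wit inferInstance).app2 inferInstance inferInstance
  -- A level with witnesses for all parameters from `L_ξ(A)`; the demand `ξ ε γ` makes the chain
  -- strictly increasing.
  let G : M → M := fun ξ => least fun γ => ξ ε γ ∧ φ.Wit (InL SetStr.mem A) (Lv A ξ) (Lv A γ)
  have hG : DFun fun v : Fin 1 → M => G (v 0) := by unfold G; infer_instance
  have hGs : ∀ ξ, IsOrd SetStr.mem ξ → IsOrd SetStr.mem (G ξ) ∧ ξ ε G ξ ∧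
      φ.Wit (InL SetStr.mem A) (Lv A ξ) (Lv A (G ξ)) := by
    intro ξ hξ
    obtain ⟨γ, hγ, hw⟩ := φ.exists_wit A hξ
    have hm : IsOrd SetStr.mem (union γ (succ ξ)) := isOrd_sUnion fun α hα => by
      rcases mem_upair.1 hα with rfl | rfl
      exacts [hγ, hξ.succ]
    obtain ⟨h1, h2, _⟩ := least_spec
      (P := fun γ => ξ ε γ ∧ φ.Wit (InL SetStr.mem A) (Lv A ξ) (Lv A γ)) hm
      ⟨by simp, hw.mono fun x hx => iter_mono dFun_defSet hm (fun z hz => by simp [hz]) hγ hx⟩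
    exact ⟨h1, h2⟩
  -- Here `f(k)` is the union of `β + 1` and the `G(f(j))` for `j < k`. Starting from `β + 1` rather
  -- than `β` ensures `β ∈ f(ω)`.
  let f : M → M := fun k => iter G (succ β) k
  have hf : DFun fun v : Fin 1 → M => f (v 0) := DFun.iter₁ hG (DFun.const _) (DFun.proj 0)
  have hfo : ∀ {k : M}, IsOrd SetStr.mem k → IsOrd SetStr.mem (f k) := by
    intro k hk
    refine ord_induction (P := fun k => IsOrd SetStr.mem (f k)) (fun k hk ih => ?_) hk
    constructor
    · intro x hx y hy
      rcases (mem_iter hG hk).1 hx with h | ⟨j, hj, h⟩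
      · exact (mem_iter hG hk).2 (Or.inl (hβ.succ.trans h hy))
      · exact (mem_iter hG hk).2 (Or.inr ⟨j, hj, (hGs _ (ih j hj)).1.trans h hy⟩)
    · intro x hx
      rcases (mem_iter hG hk).1 hx with h | ⟨j, hj, h⟩
      · exact hβ.succ.2 x h
      · exact (hGs _ (ih j hj)).1.2 x h
  have hsub : ∀ {j k : M}, j ε k → IsOrd SetStr.mem k → IsSubset SetStr.mem (G (f j)) (f k) :=
    fun hj hk x hx => (mem_iter hG hk).2 (Or.inr ⟨_, hj, hx⟩)
  have hmem : ∀ {j k : M}, j ε k → IsOrd SetStr.mem k → f j ε f k :=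
    fun hj hk => hsub hj hk _ (hGs _ (hfo (hk.mem hj))).2.1
  have ho : IsOrd SetStr.mem (f omega) := hfo isOrd_omega
  have hLf : DFun fun v : Fin 1 → M => Lv A (f (v 0)) := DFun.lv (hG := hf)
  have hchain : ∀ x, x ε Lv A (f omega) → ∃ k, k ε (omega : M) ∧ x ε Lv A (f k) := by
    intro x hx
    rcases (mem_Lv ho).1 hx with h | ⟨γ, hγ, h⟩
    · exact ⟨empty, by simp, tc_subset_Lv (hfo isOrd_empty) h⟩
    · rcases (mem_iter hG isOrd_omega).1 hγ with h' | ⟨j, hj, h'⟩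
      · exact ⟨empty, by simp, (mem_Lv (hfo isOrd_empty)).2
          (Or.inr ⟨γ, (mem_iter hG isOrd_empty).2 (Or.inl h'), h⟩)⟩
      · have hjo := isOrd_nat (succ_mem_omega hj)
        exact ⟨succ j, succ_mem_omega hj, (mem_Lv (hfo hjo)).2
          (Or.inr ⟨γ, hsub (by simp) hjo γ h', h⟩)⟩
  have hfin : ∀ {n s : M}, n ε (omega : M) → IsFun SetStr.mem s n (Lv A (f omega)) →
      ∃ k, k ε (omega : M) ∧ IsFun SetStr.mem s n (Lv A (f k)) := fun hn hs =>
    isFun_of_chain (G := fun k => Lv A (f k))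
      (fun j k hj hk => Lv_subset (hfo (isOrd_nat hk)) (hmem hj (isOrd_nat hk))) hchain hn _ hs
  have hw : ∀ k, k ε (omega : M) → φ.Wit (InL SetStr.mem A) (Lv A (f k)) (Lv A (f omega)) := by
    intro k hk
    have h1 := hGs _ (hfo (isOrd_nat hk))
    exact h1.2.2.mono fun x hx => iter_mono dFun_defSet ho (hsub hk isOrd_omega) h1.1 hx
  -- A finite parameter sequence from `L_{f(ω)}(A)` already lies in some `L_{f(k)}(A)`, and
  -- witnesses for it occur before level `f(ω)`.
  have hww : φ.Wit (InL SetStr.mem A) (Lv A (f omega)) (Lv A (f omega)) := by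
    clear_value f G
    clear hGs hG hf hsub hmem hchain
    induction φ with
    | mem i j => trivial
    | eq i j => trivial
    | neg φ ih => exact ih hW hw
    | and φ ψ ih1 ih2 =>
      exact ⟨ih1 ((φ.dfn_wit inferInstance).app2 inferInstance inferInstance) fun k hk => (hw k hk).1,
        ih2 ((ψ.dfn_wit inferInstance).app2 inferInstance inferInstance) fun k hk => (hw k hk).2⟩
    | ex φ ih =>
      refine ⟨ih ((φ.dfn_wit inferInstance).app2 inferInstance inferInstance)
        fun k hk => (hw k hk).1, fun s hs hy => ?_⟩
      obtain ⟨k, hk, hs⟩ := hfin (num_mem_omega _) hs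
      exact (hw k hk).2 s hs hy
  refine ⟨f omega, ho, (mem_iter hG isOrd_omega).2 (Or.inl (by simp)), fun s hs => ?_⟩
  exact Fml.satS_iff_of_wit (fun x hx => inL_of_mem_Lv ho hx) hww hs

/-! ### `L(A)` is a model of `ZF` -/

theorem exists_tuple_Lv {A : M} {n : ℕ} (v : Fin n → M) (hv : ∀ i, InL mem A (v i)) :
    ∃ β, IsOrd mem β ∧ ∀ i, v i ε Lv A β := by
  obtain ⟨X, hX⟩ := exists_tuple_set v
  obtain ⟨β, hβ, h⟩ := exists_Lv_superset (A := A) (a := sep X fun x => InL mem A x)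
    fun x hx => (mem_sep.1 hx).2
  exact ⟨β, hβ, fun i => h _ (mem_sep.2 ⟨hX i, hv i⟩)⟩

/-- Reflection moves the defining formula to some `L_δ(A)` containing the parameters and the part of
`a` in `L(A)`; the class is then a definable subset of `L_δ(A)`. The bound `a` is any set of the
ambient model, so this one lemma serves pairing, union, power set, separation and replacement. -/
theorem inL_comprehension {A : M} {P : {x // InL mem A x} → Prop}
    (hP : Dfn fun v : Fin 1 → {x // InL mem A x} => P (v 0)) {a : M}
    (ha : ∀ x, P x → x.1 ε a) : ∃ b : {x // InL mem A x}, ∀ x, x ε b ↔ P x := by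
  obtain ⟨k, φ, t, h⟩ := hP.last
  let c : Fin k → M := fun i => (ev Fin.elim0 (t i)).1
  obtain ⟨β, hβ, hc⟩ := exists_tuple_Lv c fun i => (ev Fin.elim0 (t i)).2
  obtain ⟨γ, hγ, hs⟩ := exists_Lv_superset (A := A) (a := sep a fun x => InL mem A x)
    fun x hx => (mem_sep.1 hx).2
  have hm : IsOrd mem (union β γ) := isOrd_sUnion fun α hα => by
    rcases mem_upair.1 hα with rfl | rfl
    exacts [hβ, hγ]
  obtain ⟨δ, hδ, hlt, href⟩ := φ.reflection A hm
  have hβδ : IsSubset mem (Lv A β) (Lv A δ) := fun x hx => Lv_subset hδ hlt x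
    (iter_mono dFun_defSet hm (fun z hz => by simp [hz]) hβ hx)
  have hγδ : IsSubset mem (Lv A γ) (Lv A δ) := fun x hx => Lv_subset hδ hlt x
    (iter_mono dFun_defSet hm (fun z hz => by simp [hz]) hγ hx)
  have hcδ : ∀ i, c i ε Lv A δ := fun i => hβδ _ (hc i)
  have hS : Dfn fun v : Fin 1 → M => φ.SatS (fun x => x ε Lv A δ) (seqOf (snoc c (v 0))) := by
    simp only [seqOf_snoc]
    exact (φ.dfn_satS inferInstance).app1 inferInstance
  have hbin : InDef mem (Lv A δ)
      (sep (Lv A δ) fun x => φ.SatS (fun x => x ε Lv A δ) (seqOf (snoc c x))) :=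
    φ.inDef c hcδ fun x => mem_sep
  refine ⟨⟨_, inL_of_mem_Lv hδ.succ (mem_Lv_succ hδ hbin)⟩, fun x => ?_⟩
  have hPx : P x ↔ φ.SatS (InL mem A) (seqOf (snoc c x.1)) := by
    refine (h Fin.elim0 x).trans ((φ.sat_iff_satS _).trans
      (iff_of_eq (congrArg _ (congrArg _ (funext fun i => ?_)))))
    refine Fin.lastCases ?_ (fun i => ?_) i <;> simp [snoc, c]
  refine mem_sep.trans ?_
  rw [hPx]
  have hsn : x.1 ε Lv A δ → IsFun mem (seqOf (snoc c x.1)) (num (k + 1)) (Lv A δ) := fun hx =>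
    isFun_seqOf fun i => by
      refine Fin.lastCases ?_ (fun i => ?_) i
      · simpa [snoc] using hx
      · simpa [snoc] using hcδ i
  constructor
  · rintro ⟨hx, hφ⟩
    exact (href _ (hsn hx)).1 hφ
  · intro hφ
    have hx : x.1 ε Lv A δ := hγδ _ (hs _ (mem_sep.2 ⟨ha x (hPx.2 hφ), x.2⟩))
    exact ⟨hx, (href _ (hsn hx)).2 hφ⟩

theorem succ_mem_defSet {X x : M} (hX : IsTransSet mem X) (hx : x ε X) : succ x ε defSet X :=
  mem_defSet.2 (inDef_of_dfn
    (P := fun a => a ε (⟨x, hx⟩ : {y // y ε X}) ∨ a = (⟨x, hx⟩ : {y // y ε X})) inferInstance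
    fun a => by
      rw [mem_succ]
      constructor
      · rintro (h | rfl)
        · exact ⟨hX x hx a h, Or.inl h⟩
        · exact ⟨hx, Or.inr rfl⟩
      · rintro ⟨h, h' | h'⟩
        · exact Or.inl h'
        · exact Or.inr (congrArg Subtype.val h'))

theorem empty_mem_defSet (X : M) : empty ε defSet X :=
  mem_defSet.2 (inDef_of_dfn (P := fun _ => False) inferInstance fun a => by simp)

instance InL.zfm (A : M) : ZFM {x : M // InL mem A x} where
  ext' x y h := Subtype.ext (ext fun z =>
    ⟨fun hz => (h ⟨z, x.2.trans hz⟩).1 hz, fun hz => (h ⟨z, y.2.trans hz⟩).2 hz⟩)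
  foundation x := by
    rintro ⟨y, hy⟩
    obtain ⟨z, hz, h⟩ := ZFM.foundation x.1 ⟨y.1, hy⟩
    exact ⟨⟨z, x.2.trans hz⟩, hz, fun w hw => h w.1 hw⟩
  pairing a b := inL_comprehension (P := fun z => z = a ∨ z = b) inferInstance
    (a := upair a.1 b.1) fun z hz => mem_upair.2
      (hz.imp (fun h => congrArg Subtype.val h) fun h => congrArg Subtype.val h)
  union x := inL_comprehension (P := fun z => ∃ y, y ε x ∧ z ε y) inferInstance
    (a := sUnion x.1) fun z ⟨y, hy, hz⟩ => mem_sUnion.2 ⟨y.1, hy, hz⟩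
  powerset x := inL_comprehension (P := fun z => IsSubset mem z x) inferInstance
    (a := power x.1) fun z hz => mem_power.2 fun w hw => hz ⟨w, z.2.trans hw⟩ hw
  infinity := by
    -- The level `L_ω(A)` is itself inductive, since a successor appears at most one level after its
    -- argument.
    refine ⟨⟨Lv A omega, inL_Lv A isOrd_omega⟩, ?_, ?_⟩
    · have h : empty ε Lv A omega :=
        (mem_Lv isOrd_omega).2 (Or.inr ⟨empty, by simp, empty_mem_defSet _⟩)
      exact ⟨⟨empty, inL_of_mem_Lv isOrd_omega h⟩, fun z hz => not_mem_empty hz, h⟩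
    · intro n hn
      have h : succ n.1 ε Lv A omega := by
        rw [mem_Lv isOrd_omega]
        rcases (mem_Lv isOrd_omega).1 hn with h | ⟨k, hk, h⟩
        · exact Or.inr ⟨empty, by simp, succ_mem_defSet (isTransSet_Lv A isOrd_empty)
            (tc_subset_Lv isOrd_empty h)⟩
        · have hk' := isOrd_nat (succ_mem_omega hk)
          exact Or.inr ⟨succ k, succ_mem_omega hk, succ_mem_defSet (isTransSet_Lv A hk')
            (mem_Lv_succ (isOrd_nat hk) (mem_defSet.1 h))⟩
      refine ⟨⟨_, inL_of_mem_Lv isOrd_omega h⟩, fun z => ?_, h⟩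
      exact mem_succ.trans (or_congr_right Subtype.ext_iff.symm)
  separation P hP a := inL_comprehension (P := fun x => x ε a ∧ P x) inferInstance
    (a := a.1) fun x hx => hx.1
  replacement F hF a := by
    -- `F` lives on the subclass; once relativized, its graph is definable in `M`, and collection
    -- there bounds the levels of its values.
    have hR : Dfn fun v : Fin 2 → M => ∃ h : ∀ i, InL mem A (v i),
        (⟨v 1, h 1⟩ : {x // InL mem A x}) = F ⟨v 0, h 0⟩ := Dfn.relativize hF.out
    have hF' : ∀ {n : ℕ} {G : (Fin n → {x // InL mem A x}) → {x // InL mem A x}} [DFun G],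
        DFun fun v => F (G v) := fun {_ _} [_] => hF.app1 inferInstance
    have hR' : ∀ {n : ℕ} {G H : (Fin n → M) → M} [DFun G] [DFun H], Dfn fun v =>
        ∃ h : ∀ i, InL mem A (![G v, H v] i),
        (⟨H v, h 1⟩ : {x // InL mem A x}) = F ⟨G v, h 0⟩ := fun {_ _ _} [_] [_] =>
      Dfn.app2 (R := fun x y => ∃ h : ∀ i, InL mem A (![x, y] i),
        (⟨y, h 1⟩ : {x // InL mem A x}) = F ⟨x, h 0⟩) (hR.congr fun v => by
          have : ![v 0, v 1] = v := by funext i; fin_cases i <;> rfl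
          constructor
          · rintro ⟨h, h'⟩; exact ⟨fun i => by simpa [this] using h i, h'⟩
          · rintro ⟨h, h'⟩; exact ⟨fun i => by simpa [this] using h i, h'⟩)
        inferInstance inferInstance
    obtain ⟨δ, hδ, h⟩ := ord_collection (Q := fun x α => ∃ y, y ε Lv A α ∧
      ∃ h : ∀ i, InL mem A (![x, y] i), (⟨y, h 1⟩ : {x // InL mem A x}) = F ⟨x, h 0⟩) a.1
    refine inL_comprehension (P := fun y => ∃ x, x ε a ∧ y = F x) inferInstance (a := Lv A δ) ?_
    rintro y ⟨x, hx, rfl⟩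
    obtain ⟨α, hα, hy⟩ := inL_iff.1 (F x).2
    obtain ⟨α, hα, y, hy, h1, h2⟩ := h x.1 hx ⟨α, hα, (F x).1, hy,
      fun i => by fin_cases i <;> [exact x.2; exact (F x).2], rfl⟩
    rw [← congrArg Subtype.val h2]
    exact Lv_subset hδ hα y hy

end
end SetModel

namespace SetModel
universe u
open SetStr

/-! ### Absoluteness for transitive classes -/

/-- The class `P` is transitive. -/
class TransClass {M : Type u} [SetStr M] (P : M → Prop) : Prop where
  trans : ∀ {x y : M}, P x → y ε x → P y

section
variable {M : Type u} [SetStr M] {P : M → Prop} [TransClass P] {a b p r x y f : {x // P x}}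

theorem prop_of_mem (x : {x // P x}) {y : M} (h : y ε x.1) : P y := TransClass.trans x.2 h

theorem forall_mem_val {Q : M → Prop} :
    (∀ z, z ε x.1 → Q z) ↔ ∀ z : {x // P x}, z ε x → Q z.1 :=
  ⟨fun h z hz => h z.1 hz, fun h z hz => h ⟨z, prop_of_mem x hz⟩ hz⟩

theorem isSubset_val : IsSubset mem x y ↔ IsSubset mem x.1 y.1 :=
  (forall_mem_val (Q := fun z => z ε y.1)).symm

theorem isUPair_val : IsUPair mem a b p ↔ IsUPair mem a.1 b.1 p.1 := by
  constructor
  · intro h z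
    constructor
    · exact fun hz => ((h ⟨z, prop_of_mem p hz⟩).1 hz).imp (congrArg Subtype.val)
        (congrArg Subtype.val)
    · rintro (rfl | rfl)
      · exact (h a).2 (Or.inl rfl)
      · exact (h b).2 (Or.inr rfl)
  · exact fun h z => (h z.1).trans (or_congr Subtype.ext_iff.symm Subtype.ext_iff.symm)

theorem isOPair_val : IsOPair mem a b p ↔ IsOPair mem a.1 b.1 p.1 := by
  constructor
  · rintro ⟨s, t, h1, h2, h3⟩
    exact ⟨s.1, t.1, isUPair_val.1 h1, isUPair_val.1 h2, isUPair_val.1 h3⟩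
  · rintro ⟨s, t, h1, h2, h3⟩
    have hs : P s := prop_of_mem p ((h3 s).2 (Or.inl rfl))
    have ht : P t := prop_of_mem p ((h3 t).2 (Or.inr rfl))
    exact ⟨⟨s, hs⟩, ⟨t, ht⟩, isUPair_val.2 h1, isUPair_val.2 h2, isUPair_val.2 h3⟩

theorem pairMem_val : PairMem mem a b r ↔ PairMem mem a.1 b.1 r.1 := by
  constructor
  · rintro ⟨p, h1, h2⟩; exact ⟨p.1, isOPair_val.1 h1, h2⟩
  · rintro ⟨p, h1, h2⟩; exact ⟨⟨p, prop_of_mem r h2⟩, isOPair_val.2 h1, h2⟩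

/-- The components of a Kuratowski pair are members of members of it, so transitivity puts them into
the class. -/
theorem prop_of_pairMem (r : {x // P x}) {a b : M} (h : PairMem mem a b r.1) : P a ∧ P b := by
  obtain ⟨p, ⟨s, t, h1, h2, h3⟩, hp⟩ := h
  have ht : P t := TransClass.trans (prop_of_mem r hp) ((h3 t).2 (Or.inr rfl))
  exact ⟨TransClass.trans ht ((h2 a).2 (Or.inl rfl)), TransClass.trans ht ((h2 b).2 (Or.inr rfl))⟩

theorem isSucc_val : IsSucc mem x y ↔ IsSucc mem x.1 y.1 := by
  constructor
  · intro h z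
    constructor
    · exact fun hz => ((h ⟨z, prop_of_mem y hz⟩).1 hz).imp_right (congrArg Subtype.val)
    · rintro (hz | rfl)
      · exact (h ⟨z, prop_of_mem x hz⟩).2 (Or.inl hz)
      · exact (h x).2 (Or.inr rfl)
  · exact fun h z => (h z.1).trans (or_congr_right Subtype.ext_iff.symm)

theorem isEmptySet_val : IsEmptySet mem x ↔ IsEmptySet mem x.1 :=
  ⟨fun h z hz => h ⟨z, prop_of_mem x hz⟩ hz, fun h z => h z.1⟩

theorem isTransSet_val : IsTransSet mem x ↔ IsTransSet mem x.1 := by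
  refine Iff.trans ?_ forall_mem_val.symm
  exact forall_congr' fun z => imp_congr_right fun _ => isSubset_val

theorem isOrd_val : IsOrd mem x ↔ IsOrd mem x.1 := by
  refine and_congr isTransSet_val (Iff.trans ?_ forall_mem_val.symm)
  exact forall_congr' fun z => imp_congr_right fun _ => isTransSet_val

theorem isInductive_val : IsInductive mem x ↔ IsInductive mem x.1 := by
  refine and_congr ⟨?_, ?_⟩ ⟨fun h => forall_mem_val.2 fun n hn => ?_, fun h n hn => ?_⟩
  · rintro ⟨e, h1, h2⟩; exact ⟨e.1, isEmptySet_val.1 h1, h2⟩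
  · rintro ⟨e, h1, h2⟩; exact ⟨⟨e, prop_of_mem x h2⟩, isEmptySet_val.2 h1, h2⟩
  · obtain ⟨s, h1, h2⟩ := h n hn; exact ⟨s.1, isSucc_val.1 h1, h2⟩
  · obtain ⟨s, h1, h2⟩ := h n.1 hn; exact ⟨⟨s, prop_of_mem x h2⟩, isSucc_val.2 h1, h2⟩

theorem isFun_val : IsFun mem f a b ↔ IsFun mem f.1 a.1 b.1 := by
  refine and_congr ⟨fun h => forall_mem_val.2 fun p hp => ?_, fun h p hp => ?_⟩
    ⟨fun h => forall_mem_val.2 fun x hx => ?_, fun h x hx => ?_⟩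
  · obtain ⟨x, y, hx, hy, h⟩ := h p hp
    exact ⟨x.1, y.1, hx, hy, isOPair_val.1 h⟩
  · obtain ⟨x, y, hx, hy, h⟩ := h p.1 hp
    exact ⟨⟨x, prop_of_mem a hx⟩, ⟨y, prop_of_mem b hy⟩, hx, hy, isOPair_val.2 h⟩
  · obtain ⟨y, hy, hu⟩ := h x hx
    refine ⟨y.1, pairMem_val.1 hy, fun z hz => ?_⟩
    exact congrArg Subtype.val (hu ⟨z, (prop_of_pairMem f hz).2⟩ (pairMem_val.2 hz))
  · obtain ⟨y, hy, hu⟩ := h x.1 hx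
    refine ⟨⟨y, (prop_of_pairMem f hy).2⟩, pairMem_val.2 hy, fun z hz => Subtype.ext ?_⟩
    exact hu z.1 (pairMem_val.1 hz)

end

theorem opair_mem_relStep {M : Type u} [SetStr M] [ZFM M] {X Z n R : M} :
    opair n R ε relStep X Z ↔ n ε (omega : M) ∧ (∀ s, s ε R → ∃ k, k ε (omega : M) ∧ IsFun mem s k X) ∧
      ((∃ i j, i ε n ∧ j ε n ∧ R = memRel X n i j) ∨ (∃ i j, i ε n ∧ j ε n ∧ R = eqRel X n i j) ∨
      (∃ S, opair n S ε Z ∧ R = complRel X n S) ∨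
      (∃ S T, opair n S ε Z ∧ opair n T ε Z ∧ R = inter S T) ∨
      ∃ S, opair (succ n) S ε Z ∧ R = projRel X n S) := by
  rw [mem_relStep, opair_mem_prod, and_assoc]
  refine and_congr_right fun _ => and_congr (by simp [IsSubset]) ?_
  simp only [opair_inj]
  constructor
  · rintro (⟨n, i, j, hi, hj, rfl, rfl⟩ | ⟨n, i, j, hi, hj, rfl, rfl⟩ | ⟨n, R, hR, rfl, rfl⟩ |
      ⟨n, R, S, hR, hS, rfl, rfl⟩ | ⟨n, R, hR, rfl, rfl⟩)
    · exact Or.inl ⟨i, j, hi, hj, rfl⟩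
    · exact Or.inr (Or.inl ⟨i, j, hi, hj, rfl⟩)
    · exact Or.inr (Or.inr (Or.inl ⟨R, hR, rfl⟩))
    · exact Or.inr (Or.inr (Or.inr (Or.inl ⟨R, S, hR, hS, rfl⟩)))
    · exact Or.inr (Or.inr (Or.inr (Or.inr ⟨R, hR, rfl⟩)))
  · rintro (⟨i, j, hi, hj, rfl⟩ | ⟨i, j, hi, hj, rfl⟩ | ⟨R, hR, rfl⟩ | ⟨R, S, hR, hS, rfl⟩ |
      ⟨R, hR, rfl⟩)
    · exact Or.inl ⟨n, i, j, hi, hj, rfl, rfl⟩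
    · exact Or.inr (Or.inl ⟨n, i, j, hi, hj, rfl, rfl⟩)
    · exact Or.inr (Or.inr (Or.inl ⟨n, R, hR, rfl, rfl⟩))
    · exact Or.inr (Or.inr (Or.inr (Or.inl ⟨n, R, S, hR, hS, rfl, rfl⟩)))
    · exact Or.inr (Or.inr (Or.inr (Or.inr ⟨n, R, hR, rfl, rfl⟩)))

theorem exists_opair_of_mem_relStep {M : Type u} [SetStr M] [ZFM M] {X Z p : M}
    (h : p ε relStep X Z) : ∃ n R, p = opair n R := by
  obtain ⟨n, _, R, _, h⟩ := mem_prod.1 (mem_relStep.1 h).1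
  exact ⟨n, R, h⟩

/-! ### Absoluteness for transitive classes that satisfy `ZF` -/

section
variable {M : Type u} [SetStr M] [ZFM M] {P : M → Prop} [TransClass P]

theorem val_eq {z : {x // P x}} {t : M} (h : ∀ w : {x // P x}, w ε z ↔ w.1 ε t)
    (ht : ∀ w, w ε t → P w) : z.1 = t :=
  ext fun w => ⟨fun hw => (h ⟨w, prop_of_mem z hw⟩).1 hw, fun hw => (h ⟨w, ht w hw⟩).2 hw⟩

variable [ZFM {x // P x}]

@[simp] theorem val_opair (a b : {x // P x}) : (opair a b).1 = opair a.1 b.1 :=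
  isOPair_iff.1 (isOPair_val.1 (isOPair_iff.2 rfl))

@[simp] theorem val_succ (a : {x // P x}) : (succ a).1 = succ a.1 :=
  isSucc_iff.1 (isSucc_val.1 (isSucc_iff.2 rfl))

@[simp] theorem val_empty : (empty : {x // P x}).1 = empty :=
  isEmptySet_iff.1 (isEmptySet_val.1 (isEmptySet_iff.2 rfl))

@[simp] theorem val_upair (a b : {x // P x}) : (upair a b).1 = upair a.1 b.1 :=
  isUPair_iff.1 (isUPair_val.1 (isUPair_iff.2 rfl))

@[simp] theorem val_sUnion (a : {x // P x}) : (sUnion a).1 = sUnion a.1 := by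
  refine val_eq (fun w => ?_) fun w hw => ?_
  · rw [mem_sUnion, mem_sUnion]
    exact ⟨fun ⟨y, h1, h2⟩ => ⟨y.1, h1, h2⟩, fun ⟨y, h1, h2⟩ => ⟨⟨y, prop_of_mem a h1⟩, h1, h2⟩⟩
  · obtain ⟨y, h1, h2⟩ := mem_sUnion.1 hw
    exact TransClass.trans (prop_of_mem a h1) h2

@[simp] theorem val_adj (a b : {x // P x}) : (adj a b).1 = adj a.1 b.1 := by
  simp [adj, union]

theorem prop_opair {a b : M} (ha : P a) (hb : P b) : P (opair a b) :=
  val_opair (P := P) ⟨a, ha⟩ ⟨b, hb⟩ ▸ (opair (⟨a, ha⟩ : {x // P x}) ⟨b, hb⟩).2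

theorem prop_adj {a b : M} (ha : P a) (hb : P b) : P (adj a b) :=
  val_adj (P := P) ⟨a, ha⟩ ⟨b, hb⟩ ▸ (adj (⟨a, ha⟩ : {x // P x}) ⟨b, hb⟩).2

theorem val_sep {a : {x // P x}} {Q : {x // P x} → Prop} {Q' : M → Prop}
    [Dfn fun v : Fin 1 → {x // P x} => Q (v 0)] [Dfn fun v : Fin 1 → M => Q' (v 0)]
    (h : ∀ x, x ε a → (Q x ↔ Q' x.1)) : (sep a Q).1 = sep a.1 Q' :=
  val_eq (fun w => by rw [mem_sep, mem_sep]; exact and_congr_right fun hw => h w hw)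
    fun w hw => prop_of_mem a (mem_sep.1 hw).1

theorem opair_mem_val {a b r : {x // P x}} : opair a.1 b.1 ε r.1 ↔ opair a b ε r := by
  rw [← val_opair]; exact Iff.rfl

@[simp] theorem val_app (f x : {x // P x}) : (app f x).1 = app f.1 x.1 := by
  rw [app, app, val_sUnion, val_sep (Q' := fun y => opair x.1 y ε f.1)
    fun y _ => (opair_mem_val (a := x) (b := y) (r := f)).symm]
  simp

@[simp] theorem val_omega : (omega : {x // P x}).1 = omega := by
  refine ext fun n => ⟨fun hn => ?_, fun hn => ?_⟩
  -- An `∈`-minimal element of the inner `ω` outside the outer one would be `∅` or a successor, and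
  -- both notions are absolute.
  · by_contra hn'
    obtain ⟨m, hm, hmin⟩ := ZFM.foundation (sep (omega : {x // P x}).1 fun n => ¬ n ε (omega : M))
      ⟨n, mem_sep.2 ⟨hn, hn'⟩⟩
    obtain ⟨hm, hm'⟩ := mem_sep.1 hm
    rcases nat_cases (n := (⟨m, prop_of_mem _ hm⟩ : {x // P x})) hm with h | ⟨k, hk, h⟩
    · have := congrArg Subtype.val h
      simp only [val_empty] at this
      exact hm' (this ▸ empty_mem_omega)
    · have h' := congrArg Subtype.val h
      simp only [val_succ] at h'
      subst h'
      have := hmin k.1 (by simp)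
      rw [mem_sep] at this
      push Not at this
      exact hm' (succ_mem_omega (this hk))
  · exact mem_omega_iff.1 hn _ (isInductive_val.1 isInductive_omega)

theorem mem_omega_val {n : {x // P x}} : n.1 ε (omega : M) ↔ n ε (omega : {x // P x}) := by
  rw [← val_omega (P := P)]; exact Iff.rfl

theorem prop_nat {n : M} (hn : n ε (omega : M)) : P n :=
  prop_of_mem (omega : {x // P x}) (by rwa [val_omega])

/-- Finite sequences arise by adjoining one pair at a time, so induction on the length keeps them in
`P`. The induction takes place in `M`, hence the definability of `P`. This is what makes `Def`
absolute although power sets are not. -/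
theorem prop_finite_seq [hP : Dfn fun v : Fin 1 → M => P (v 0)] {n X : M} (hn : n ε (omega : M))
    (hX : ∀ x, x ε X → P x) : ∀ s, IsFun mem s n X → P s := by
  have hP' : ∀ {n : ℕ} {F : (Fin n → M) → M} [hF : DFun F], Dfn fun v => P (F v) :=
    fun {_ _} [_] => hP.app1 inferInstance
  refine nat_induction (P := fun n => ∀ s, IsFun mem s n X → P s) ?_ ?_ hn
  · intro s hs
    rw [isFun_empty.1 hs, ← val_empty (P := P)]
    exact Subtype.property _
  · intro n hn ih t ht
    obtain ⟨s, hs, he⟩ := ht.exists_eq_adj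
    rw [he]
    exact prop_adj (ih s hs) (prop_opair (prop_nat hn) (hX _ (ht.app_mem (by simp))))

theorem val_inter (R S : {x // P x}) : (inter R S).1 = inter R.1 S.1 := by
  rw [inter, inter]
  exact val_sep fun x _ => Iff.rfl

theorem val_secRel (X n s R : {x // P x}) : (secRel X n s R).1 = secRel X.1 n.1 s.1 R.1 := by
  rw [secRel, secRel]
  refine val_sep fun x _ => ⟨?_, ?_⟩
  · rintro ⟨t, h1, h2, h3⟩; exact ⟨t.1, h1, isSubset_val.1 h2, opair_mem_val.2 h3⟩
  · rintro ⟨t, h1, h2, h3⟩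
    exact ⟨⟨t, prop_of_mem R h1⟩, h1, isSubset_val.2 h2, opair_mem_val.1 h3⟩

/-- An approximation inside `P` is also one outside, because its clauses only quantify over members;
uniqueness of approximations does the rest. -/
theorem val_iter {H : {x // P x} → {x // P x}} {H' : M → M}
    (hH : DFun fun v : Fin 1 → {x // P x} => H (v 0)) (hH' : DFun fun v : Fin 1 → M => H' (v 0))
    (h : ∀ Z, (H Z).1 = H' Z.1) (T : {x // P x}) {β : {x // P x}} (hβ : IsOrd mem β) :
    (iter H T β).1 = iter H' T.1 β.1 := by
  obtain ⟨f, hf⟩ := exists_isIter hH T hβ.succ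
  have hβ' := isOrd_val.1 hβ
  rw [iter_eq hH hβ.succ hf (by simp)]
  have hf' : IsIter H' T.1 (succ β.1) f.1 := by
    obtain ⟨c, h1, h2⟩ := hf
    rw [← val_succ]
    refine ⟨c.1, isFun_val.1 h1, fun γ hγ x => ?_⟩
    have hPγ := prop_of_mem _ hγ
    have e : app f.1 γ = (app f ⟨γ, hPγ⟩).1 := (val_app f ⟨γ, hPγ⟩).symm
    rw [e]
    have h3 := h2 ⟨γ, hPγ⟩ hγ
    constructor
    · intro hx
      rcases (h3 ⟨x, prop_of_mem _ hx⟩).1 hx with h4 | ⟨δ, h4, h5, h6⟩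
      · exact Or.inl h4
      · refine Or.inr ⟨δ.1, h4, h5, ?_⟩
        rw [← val_app, ← h]; exact h6
    · rintro (h4 | ⟨δ, h4, h5, h6⟩)
      · exact (h3 ⟨x, prop_of_mem T h4⟩).2 (Or.inl h4)
      · have hδ := prop_of_mem (⟨γ, hPγ⟩ : {x // P x}) h4
        have e2 : H' (app f.1 δ) = (H (app f ⟨δ, hδ⟩)).1 := by rw [h, val_app]
        rw [e2] at h6
        exact (h3 ⟨x, prop_of_mem _ h6⟩).2 (Or.inr ⟨⟨δ, hδ⟩, h4, h5, h6⟩)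
  rw [iter_eq hH' hβ'.succ hf' (by simp), val_app]

theorem val_tc (A : {x // P x}) : (tc A).1 = tc A.1 := by
  rw [tc, tc, val_iter (H := sUnion) inferInstance (H' := sUnion) inferInstance (fun Z => val_sUnion Z) _
    isOrd_omega, val_upair, val_omega]

variable [hP : Dfn fun v : Fin 1 → M => P (v 0)]

theorem val_funs {n : {x // P x}} (X : {x // P x}) (hn : n ε (omega : {x // P x})) :
    (funs n X).1 = funs n.1 X.1 := by
  refine val_eq (fun w => ?_) fun w hw => ?_
  · rw [mem_funs, mem_funs, isFun_val]
  · exact prop_finite_seq (mem_omega_val.2 hn) (fun x hx => prop_of_mem X hx) w (mem_funs.1 hw)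

section
variable {n : {x // P x}} {X i j R S s : {x // P x}}

theorem val_memRel (hn : n ε (omega : {x // P x})) : (memRel X n i j).1 = memRel X.1 n.1 i.1 j.1 := by
  rw [memRel, memRel, ← val_funs X hn]
  refine val_sep fun x _ => ?_
  rw [← val_app, ← val_app]; exact Iff.rfl

theorem val_eqRel (hn : n ε (omega : {x // P x})) : (eqRel X n i j).1 = eqRel X.1 n.1 i.1 j.1 := by
  rw [eqRel, eqRel, ← val_funs X hn]
  refine val_sep fun x _ => ?_
  rw [← val_app, ← val_app]; exact Subtype.ext_iff

theorem val_complRel (hn : n ε (omega : {x // P x})) : (complRel X n R).1 = complRel X.1 n.1 R.1 := by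
  rw [complRel, complRel, ← val_funs X hn]
  exact val_sep fun x _ => Iff.rfl

theorem val_projRel (hn : n ε (omega : {x // P x})) : (projRel X n R).1 = projRel X.1 n.1 R.1 := by
  rw [projRel, projRel, ← val_funs X hn]
  refine val_sep fun x _ => ⟨?_, ?_⟩
  · rintro ⟨t, h1, h2⟩; exact ⟨t.1, h1, isSubset_val.1 h2⟩
  · rintro ⟨t, h1, h2⟩; exact ⟨⟨t, prop_of_mem R h1⟩, h1, isSubset_val.2 h2⟩

end

theorem opair_mem_relStep_val {X Z n R : {x // P x}} :
    opair n R ε relStep X Z ↔ opair n.1 R.1 ε relStep X.1 Z.1 := by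
  have hopZ : ∀ {a b : M}, opair a b ε Z.1 → P a ∧ P b := fun h =>
    prop_of_pairMem Z (pairMem_iff.2 h)
  rw [opair_mem_relStep, opair_mem_relStep, mem_omega_val]
  refine and_congr_right fun hn => and_congr ?_ (or_congr ?_ (or_congr ?_ (or_congr ?_
    (or_congr ?_ ?_))))
  · rw [forall_mem_val]
    refine forall_congr' fun s => imp_congr_right fun _ => ⟨?_, ?_⟩
    · rintro ⟨k, h1, h2⟩; exact ⟨k.1, mem_omega_val.2 h1, isFun_val.1 h2⟩
    · rintro ⟨k, h1, h2⟩
      exact ⟨⟨k, prop_nat h1⟩, mem_omega_val.1 h1, isFun_val.2 h2⟩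
  · constructor
    · rintro ⟨i, j, hi, hj, rfl⟩; exact ⟨i.1, j.1, hi, hj, val_memRel hn⟩
    · rintro ⟨i, j, hi, hj, h⟩
      let i' : {x // P x} := ⟨i, prop_of_mem n hi⟩
      let j' : {x // P x} := ⟨j, prop_of_mem n hj⟩
      have h' : R.1 = (memRel X n i' j').1 := by rw [val_memRel hn, h]
      exact ⟨i', j', hi, hj, Subtype.ext h'⟩
  · constructor
    · rintro ⟨i, j, hi, hj, rfl⟩; exact ⟨i.1, j.1, hi, hj, val_eqRel hn⟩
    · rintro ⟨i, j, hi, hj, h⟩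
      let i' : {x // P x} := ⟨i, prop_of_mem n hi⟩
      let j' : {x // P x} := ⟨j, prop_of_mem n hj⟩
      have h' : R.1 = (eqRel X n i' j').1 := by rw [val_eqRel hn, h]
      exact ⟨i', j', hi, hj, Subtype.ext h'⟩
  · constructor
    · rintro ⟨S, hS, rfl⟩; exact ⟨S.1, opair_mem_val.2 hS, val_complRel hn⟩
    · rintro ⟨S, hS, h⟩
      let S' : {x // P x} := ⟨S, (hopZ hS).2⟩
      have h' : R.1 = (complRel X n S').1 := by rw [val_complRel hn, h]
      exact ⟨S', opair_mem_val.1 hS, Subtype.ext h'⟩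
  · constructor
    · rintro ⟨S, T, hS, hT, rfl⟩
      exact ⟨S.1, T.1, opair_mem_val.2 hS, opair_mem_val.2 hT, val_inter S T⟩
    · rintro ⟨S, T, hS, hT, h⟩
      let S' : {x // P x} := ⟨S, (hopZ hS).2⟩
      let T' : {x // P x} := ⟨T, (hopZ hT).2⟩
      have h' : R.1 = (inter S' T').1 := by rw [val_inter, h]
      exact ⟨S', T', opair_mem_val.1 hS, opair_mem_val.1 hT, Subtype.ext h'⟩
  · constructor
    · rintro ⟨S, hS, rfl⟩
      exact ⟨S.1, val_succ n ▸ opair_mem_val.2 hS, val_projRel hn⟩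
    · rintro ⟨S, hS, h⟩
      let S' : {x // P x} := ⟨S, (hopZ hS).2⟩
      have h' : R.1 = (projRel X n S').1 := by rw [val_projRel hn, h]
      refine ⟨S', opair_mem_val.1 ?_, Subtype.ext h'⟩
      rw [val_succ]; exact hS

/-- Each rule, applied to data in `P`, gives the set that `P` itself computes, so a step of the
generation never leaves `P`. -/
theorem prop_of_mem_relStep {X Z : {x // P x}} {w : M} (hw : w ε relStep X.1 Z.1) : P w := by
  have hopZ : ∀ {a b : M}, opair a b ε Z.1 → P a ∧ P b := fun h =>
    prop_of_pairMem Z (pairMem_iff.2 h)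
  obtain ⟨n, R, rfl⟩ := exists_opair_of_mem_relStep hw
  obtain ⟨hn, hs, h⟩ := opair_mem_relStep.1 hw
  have hPn : P n := prop_nat hn
  let n' : {x // P x} := ⟨n, hPn⟩
  have hn' : n' ε (omega : {x // P x}) := mem_omega_val.1 hn
  refine prop_opair hPn ?_
  rcases h with ⟨i, j, hi, hj, h⟩ | ⟨i, j, hi, hj, h⟩ | ⟨S, hS, h⟩ | ⟨S, T, hS, hT, h⟩ | ⟨S, hS, h⟩
  · let i' : {x // P x} := ⟨i, prop_of_mem n' hi⟩
    let j' : {x // P x} := ⟨j, prop_of_mem n' hj⟩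
    have h' : R = (memRel X n' i' j').1 := by rw [val_memRel hn', h]
    rw [h']; exact Subtype.property _
  · let i' : {x // P x} := ⟨i, prop_of_mem n' hi⟩
    let j' : {x // P x} := ⟨j, prop_of_mem n' hj⟩
    have h' : R = (eqRel X n' i' j').1 := by rw [val_eqRel hn', h]
    rw [h']; exact Subtype.property _
  · let S' : {x // P x} := ⟨S, (hopZ hS).2⟩
    have h' : R = (complRel X n' S').1 := by rw [val_complRel hn', h]
    rw [h']; exact Subtype.property _
  · let S' : {x // P x} := ⟨S, (hopZ hS).2⟩
    let T' : {x // P x} := ⟨T, (hopZ hT).2⟩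
    have h' : R = (inter S' T').1 := by rw [val_inter, h]
    rw [h']; exact Subtype.property _
  · let S' : {x // P x} := ⟨S, (hopZ hS).2⟩
    have h' : R = (projRel X n' S').1 := by rw [val_projRel hn', h]
    rw [h']; exact Subtype.property _

theorem val_relStep (X Z : {x // P x}) : (relStep X Z).1 = relStep X.1 Z.1 := by
  refine val_eq (fun w => ⟨fun hw => ?_, fun hw => ?_⟩) fun w hw => prop_of_mem_relStep hw
  · obtain ⟨n, R, rfl⟩ := exists_opair_of_mem_relStep hw
    rw [val_opair]
    exact opair_mem_relStep_val.1 hw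
  · obtain ⟨n, R, h⟩ := exists_opair_of_mem_relStep hw
    have hnR : P n ∧ P R := prop_of_pairMem (P := P) (upair w w) (pairMem_iff.2 (by simp [h]))
    have hw' : w = opair (⟨n, hnR.1⟩ : {x // P x}) ⟨R, hnR.2⟩ := Subtype.ext (by simp [h])
    rw [hw'] at hw ⊢
    rw [val_opair] at hw
    exact opair_mem_relStep_val.2 hw

theorem val_defRels (X : {x // P x}) : (defRels X).1 = defRels X.1 := by
  rw [defRels, defRels, val_iter inferInstance (H' := relStep X.1) inferInstance
    (fun Z => val_relStep X Z) _ isOrd_omega, val_empty, val_omega]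

theorem val_defSet (X : {x // P x}) : (defSet X).1 = defSet X.1 := by
  refine val_eq (fun w => ?_) fun w hw => ?_
  · rw [mem_defSet, mem_defSet, inDef_iff, inDef_iff]
    constructor
    · rintro ⟨n, hn, s, R, hs, hR, rfl⟩
      refine ⟨n.1, mem_omega_val.2 hn, s.1, R.1, isFun_val.1 hs, ?_, val_secRel _ _ _ _⟩
      rw [← val_succ, ← val_defRels]
      exact opair_mem_val.2 hR
    · rintro ⟨n, hn, s, R, hs, hR, h⟩
      have hn' : P n := prop_nat hn
      have hs' : P s := prop_finite_seq hn (fun x hx => prop_of_mem X hx) s hs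
      rw [← val_defRels] at hR
      have hR' : P R := (prop_of_pairMem _ (pairMem_iff.2 hR)).2
      refine ⟨⟨n, hn'⟩, mem_omega_val.1 hn, ⟨s, hs'⟩, ⟨R, hR'⟩, isFun_val.2 hs, opair_mem_val.1 ?_,
        Subtype.ext (h.trans (val_secRel X ⟨n, hn'⟩ ⟨s, hs'⟩ ⟨R, hR'⟩).symm)⟩
      rw [val_succ]; exact hR
  · obtain ⟨n, hn, s, R, hs, hR, rfl⟩ := inDef_iff.1 (mem_defSet.1 hw)
    have hn' : P n := prop_nat hn
    have hs' : P s := prop_finite_seq hn (fun x hx => prop_of_mem X hx) s hs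
    rw [← val_defRels] at hR
    have hR' : P R := (prop_of_pairMem _ (pairMem_iff.2 hR)).2
    exact val_secRel X ⟨n, hn'⟩ ⟨s, hs'⟩ ⟨R, hR'⟩ ▸ Subtype.property _

theorem val_Lv (A : {x // P x}) {β : {x // P x}} (hβ : IsOrd mem β) :
    (Lv A β).1 = Lv A.1 β.1 := by
  rw [Lv, Lv, val_iter (H := defSet) dFun_defSet (H' := defSet) dFun_defSet (fun Z => val_defSet Z) _ hβ,
    val_tc]

/-- `L(A)` is contained in every inner model containing `A`. -/
theorem prop_of_inL (hO : ∀ α, IsOrd mem α → P α) {A x : M} (hA : P A) (hx : InL mem A x) : P x := by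
  obtain ⟨β, hβ, hx⟩ := inL_iff.1 hx
  have := val_Lv (P := P) ⟨A, hA⟩ (β := ⟨β, hO β hβ⟩) (isOrd_val.2 hβ)
  rw [← this] at hx
  exact prop_of_mem _ hx

end

/-! ### Ordinals in `L(A)`, and inclusions between such models -/

section
variable {M : Type u} [SetStr M] [ZFM M]

instance InL.transClass (A : M) : TransClass (InL mem A) := ⟨InL.trans⟩

theorem inL_self (A : M) : InL mem A A :=
  inL_of_mem_Lv isOrd_empty (tc_subset_Lv isOrd_empty (self_mem_tc A))

/-- By induction `β` is contained in some `L_δ(A)`. If `β` is not an element of that level, then by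
transitivity the ordinals in the level are exactly those below `β`, so comprehension in `L(A)`
yields `β`. -/
theorem inL_ord (A : M) {α : M} (hα : IsOrd mem α) : InL mem A α := by
  refine ord_induction (P := fun α => InL mem A α) (fun β hβ ih => ?_) hα
  obtain ⟨δ, hδ, h⟩ := exists_Lv_superset ih
  by_cases hβδ : β ε Lv A δ
  · exact inL_of_mem_Lv hδ hβδ
  · obtain ⟨b, hb⟩ := inL_comprehension (A := A)
      (P := fun x => x ε (⟨Lv A δ, inL_Lv A hδ⟩ : {x // InL mem A x}) ∧ IsOrd mem x) inferInstance
      (a := Lv A δ) fun x hx => hx.1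
    have : b.1 = β := by
      refine val_eq (fun x => (hb x).trans ⟨fun ⟨h1, h2⟩ => ?_, fun hx => ?_⟩) ih
      · rcases ord_trichotomy (isOrd_val.1 h2) hβ with h3 | h3 | h3
        · exact h3
        · exact (hβδ (h3 ▸ h1)).elim
        · exact (hβδ (isTransSet_Lv A hδ _ h1 _ h3)).elim
      · exact ⟨h _ hx, isOrd_val.2 (hβ.mem hx)⟩
    exact this ▸ b.2

theorem inL_of_inL {A B x : M} (hA : InL mem B A) (hx : InL mem A x) : InL mem B x :=
  prop_of_inL (P := InL mem B) (fun _ hα => inL_ord B hα) hA hx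

end
end SetModel

namespace SetModel
universe u
open SetStr

/-! ### Enumerated hulls

For a finite list of definable functions with a parameter `a`, we enumerate along the ordinals a class
that contains all ordinals and is closed under the functions. -/

section
variable {M : Type u} [SetStr M] [ZFM M]

/-- `u` is a value of `g`. -/
def InRan (g u : M) : Prop := ∃ x, opair x u ε g

/-- The domain of `g`. -/
noncomputable def dom (g : M) : M := sep (sUnion (sUnion g)) fun x => ∃ y, opair x y ε g

theorem mem_dom {g x : M} : x ε dom g ↔ ∃ y, opair x y ε g :=
  mem_sep.trans ⟨fun h => h.2, fun ⟨y, hy⟩ => ⟨(mem_sUnion_sUnion hy).1, y, hy⟩⟩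

section
variable {n : ℕ} {F G : (Fin n → M) → M} [hF : DFun F] [hG : DFun G]
instance Dfn.inRan : Dfn fun v => InRan (F v) (G v) :=
  Dfn.app2 (by unfold InRan; infer_instance) hF hG
instance DFun.dom : DFun fun v => SetModel.dom (F v) :=
  DFun.app1 (by unfold SetModel.dom; infer_instance) hF
end

/-! ### Transfinite recursion derived from cumulative iteration -/

/-- The initial segment of length `ξ` of `ordRec F`. -/
noncomputable def recSeg (F : M → M) (ξ : M) : M :=
  iter (fun g => upair (opair (dom g) (F g)) (opair (dom g) (F g))) empty ξ

/-- The function defined by transfinite recursion: its value at `ξ` is obtained by applying `F` to its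
restriction to `ξ`. -/
noncomputable def ordRec (F : M → M) (ξ : M) : M := F (recSeg F ξ)

theorem DFun.recSeg {H : M → M → M} (hH : DFun fun v : Fin 2 → M => H (v 0) (v 1)) {n : ℕ}
    {F G : (Fin n → M) → M} (hF : DFun F) (hG : DFun G) :
    DFun fun v => recSeg (H (F v)) (G v) := by
  have : ∀ {n : ℕ} {F G : (Fin n → M) → M} [hF : DFun F] [hG : DFun G],
      DFun fun v => H (F v) (G v) := fun {_ _ _} [_] [_] => hH.app2 inferInstance inferInstance
  exact DFun.iter (H := fun a g => SetModel.upair (SetModel.opair (SetModel.dom g) (H a g))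
    (SetModel.opair (SetModel.dom g) (H a g))) (by clear hF hG; infer_instance) hF (DFun.const _) hG

theorem DFun.ordRec {H : M → M → M} (hH : DFun fun v : Fin 2 → M => H (v 0) (v 1)) {n : ℕ}
    {F G : (Fin n → M) → M} (hF : DFun F) (hG : DFun G) :
    DFun fun v => ordRec (H (F v)) (G v) :=
  hH.app2 hF (DFun.recSeg hH hF hG)

section
variable {F : M → M}

/-- The iterated map sends `g` to the singleton of `(dom g, F(g))`. By induction the `γ`-th stage
has domain `γ`, so the pair it contributes has first component `γ`, and the union of these pairs is
the function being defined. -/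
theorem mem_recSeg (hF : DFun fun v : Fin 1 → M => F (v 0)) {ξ p : M} (hξ : IsOrd mem ξ) :
    p ε recSeg F ξ ↔ ∃ γ, γ ε ξ ∧ p = opair γ (ordRec F γ) := by
  have hE : DFun fun v : Fin 1 → M => recSeg F (v 0) :=
    DFun.recSeg (H := fun _ => F) (hF.app1 (DFun.proj 1)) (DFun.const empty) (DFun.proj 0)
  have key : ∀ {ξ p : M}, IsOrd mem ξ → (p ε recSeg F ξ ↔
      ∃ γ, γ ε ξ ∧ p = opair (dom (recSeg F γ)) (ordRec F γ)) := by
    intro ξ p hξ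
    rw [recSeg, mem_iter inferInstance hξ]
    simp only [not_mem_empty, false_or, mem_upair, or_self]
    rfl
  have hdom : ∀ ξ, IsOrd mem ξ → dom (recSeg F ξ) = ξ := by
    intro ξ hξ
    refine ord_induction (P := fun ξ => dom (recSeg F ξ) = ξ) (fun ξ hξ ih => ?_) hξ
    refine ext fun x => mem_dom.trans ⟨?_, fun hx => ?_⟩
    · rintro ⟨y, hy⟩
      obtain ⟨γ, hγ, h⟩ := (key hξ).1 hy
      rw [(opair_inj.1 h).1, ih γ hγ]
      exact hγ
    · exact ⟨_, (key hξ).2 ⟨x, hx, by rw [ih x hx]⟩⟩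
  rw [key hξ]
  refine exists_congr fun γ => and_congr_right fun hγ => ?_
  rw [hdom γ (hξ.mem hγ)]

theorem dom_recSeg (hF : DFun fun v : Fin 1 → M => F (v 0)) {ξ : M} (hξ : IsOrd mem ξ) :
    dom (recSeg F ξ) = ξ := by
  refine ext fun x => mem_dom.trans ⟨?_, fun hx => ⟨_, (mem_recSeg hF hξ).2 ⟨x, hx, rfl⟩⟩⟩
  rintro ⟨y, hy⟩
  obtain ⟨γ, hγ, h⟩ := (mem_recSeg hF hξ).1 hy
  rwa [(opair_inj.1 h).1]

theorem app_recSeg (hF : DFun fun v : Fin 1 → M => F (v 0)) {ξ γ : M} (hξ : IsOrd mem ξ)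
    (hγ : γ ε ξ) : app (recSeg F ξ) γ = ordRec F γ := by
  refine app_eq ((mem_recSeg hF hξ).2 ⟨γ, hγ, rfl⟩) fun z hz => ?_
  obtain ⟨δ, _, h⟩ := (mem_recSeg hF hξ).1 hz
  rw [(opair_inj.1 h).2, (opair_inj.1 h).1]

end

theorem sUnion_succ {α : M} (hα : IsOrd mem α) : sUnion (succ α) = α := by
  refine ext fun x => ⟨fun hx => ?_, fun hx => mem_sUnion.2 ⟨α, by simp, hx⟩⟩
  obtain ⟨y, hy, hx⟩ := mem_sUnion.1 hx
  exact subset_of_mem_succ hα hy x hx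

open Classical in
/-- Recursion along `ω`. -/
theorem exists_nat_rec (x₀ : M) {S : M → M → M} (hS : DFun fun v : Fin 2 → M => S (v 0) (v 1)) :
    ∃ e : M → M, (DFun fun v : Fin 1 → M => e (v 0)) ∧ e empty = x₀ ∧
      ∀ n, n ε (omega : M) → e (succ n) = S n (e n) := by
  have hS' : ∀ {n : ℕ} {F G : (Fin n → M) → M} [hF : DFun F] [hG : DFun G],
      DFun fun v => S (F v) (G v) := fun {_ _ _} [_] [_] => hS.app2 inferInstance inferInstance
  -- When `dom g` is a successor, `sUnion (dom g)` is its predecessor.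
  let H : M → M := fun g => if dom g = empty then x₀ else S (sUnion (dom g)) (app g (sUnion (dom g)))
  have hH : DFun fun v : Fin 1 → M => H (v 0) := by simp only [H]; infer_instance
  refine ⟨ordRec H, DFun.ordRec (H := fun _ => H) (hH.app1 (DFun.proj 1)) (DFun.const empty)
    (DFun.proj 0), ?_, fun n hn => ?_⟩
  · simp [ordRec, H, dom_recSeg hH isOrd_empty]
  · have hn' := isOrd_nat hn
    rw [ordRec]
    simp only [H, dom_recSeg hH hn'.succ, succ_ne_empty, if_false, sUnion_succ hn']
    rw [app_recSeg hH hn'.succ (by simp)]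

/-! ### The hull enumerated by always adding a new value of least stage -/

open Classical in
/-- The first value of a function of the list at `(g(z₁), g(z₂))` that is not a value of `g`, and `m`
if there is none. -/
noncomputable def pick : List (M → M → M → M) → M → M → M → M → M → M
  -- This default puts every ordinal `m` into the hull.
  | [], _, _, m, _, _ => m
  | f :: fs, a, g, m, z₁, z₂ =>
    if InRan g (f a (app g z₁) (app g z₂)) then pick fs a g m z₁ z₂ else f a (app g z₁) (app g z₂)

theorem pick_cases (fs : List (M → M → M → M)) (a g m z₁ z₂ : M) :
    pick fs a g m z₁ z₂ = m ∨ ∃ f ∈ fs, pick fs a g m z₁ z₂ = f a (app g z₁) (app g z₂) := by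
  induction fs with
  | nil => exact Or.inl rfl
  | cons f fs ih =>
    rw [pick]
    split
    · rcases ih with h | ⟨f', hf, h⟩
      · exact Or.inl h
      · exact Or.inr ⟨f', List.mem_cons_of_mem _ hf, h⟩
    · exact Or.inr ⟨f, List.mem_cons_self, rfl⟩

theorem inRan_of_pick {fs : List (M → M → M → M)} {a g m z₁ z₂ : M}
    (h : InRan g (pick fs a g m z₁ z₂)) :
    InRan g m ∧ ∀ f ∈ fs, InRan g (f a (app g z₁) (app g z₂)) := by
  induction fs with
  | nil => exact ⟨h, by simp⟩
  | cons f fs ih =>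
    rw [pick] at h
    split at h
    · next hnew => exact ⟨(ih h).1, by simpa [hnew] using (ih h).2⟩
    · next hnew => exact (hnew h).elim

/-- All functions of the list are definable. -/
class DfnList (fs : List (M → M → M → M)) : Prop where
  dfun : ∀ f ∈ fs, DFun fun v : Fin 3 → M => f (v 0) (v 1) (v 2)

instance DFun.pick {fs : List (M → M → M → M)} [hfs : DfnList fs] {n : ℕ}
    {F G H K L : (Fin n → M) → M} [hF : DFun F] [hG : DFun G] [hH : DFun H] [hK : DFun K]
    [hL : DFun L] : DFun fun v => SetModel.pick fs (F v) (G v) (H v) (K v) (L v) := by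
  obtain ⟨hfs⟩ := hfs
  induction fs with
  | nil => exact hH
  | cons f fs ih =>
    have h1 := ih fun f' hf' => hfs f' (List.mem_cons_of_mem _ hf')
    have h2 : DFun fun v => f (F v) (SetModel.app (G v) (K v)) (SetModel.app (G v) (L v)) :=
      (hfs f List.mem_cons_self).app3 inferInstance inferInstance inferInstance
    unfold SetModel.pick
    infer_instance

/-- Stage `m` of `g` yields a new element by means of `z₁` and `z₂`. -/
def Cand (fs : List (M → M → M → M)) (a g m z₁ z₂ : M) : Prop :=
  -- Being an ordinal is recorded because `least` searches ordinals only. The bound by `m` on both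
  -- arguments leaves only a set of data up to a given stage.
  (IsOrd mem z₁ ∧ IsOrd mem z₂) ∧ m ε dom g ∧ z₁ ε succ m ∧ z₂ ε succ m ∧
    ¬ InRan g (pick fs a g m z₁ z₂)

/-- The least stage yielding a new element. -/
noncomputable def stage₀ (fs : List (M → M → M → M)) (a g : M) : M :=
  least fun m => ∃ z₁ z₂, Cand fs a g m z₁ z₂
/-- The first argument yielding a new element. -/
noncomputable def stage₁ (fs : List (M → M → M → M)) (a g : M) : M :=
  least fun z₁ => ∃ z₂, Cand fs a g (stage₀ fs a g) z₁ z₂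
/-- The second argument yielding a new element. -/
noncomputable def stage₂ (fs : List (M → M → M → M)) (a g : M) : M :=
  least fun z₂ => Cand fs a g (stage₀ fs a g) (stage₁ fs a g) z₂
/-- The next element in the enumeration after `g`. -/
noncomputable def next (fs : List (M → M → M → M)) (a g : M) : M :=
  pick fs a g (stage₀ fs a g) (stage₁ fs a g) (stage₂ fs a g)

section
variable {fs : List (M → M → M → M)} [hfs : DfnList fs] {n : ℕ}
  {F G : (Fin n → M) → M} [hF : DFun F] [hG : DFun G]

instance Dfn.cand {H K L : (Fin n → M) → M} [hH : DFun H] [hK : DFun K] [hL : DFun L] :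
    Dfn fun v => Cand fs (F v) (G v) (H v) (K v) (L v) := by
  unfold Cand
  infer_instance

instance DFun.stage₀ : DFun fun v => SetModel.stage₀ fs (F v) (G v) :=
  DFun.app2 (H := fun a g => SetModel.stage₀ fs a g) (by
    unfold SetModel.stage₀
    infer_instance) hF hG

instance DFun.stage₁ : DFun fun v => SetModel.stage₁ fs (F v) (G v) :=
  DFun.app2 (H := fun a g => SetModel.stage₁ fs a g) (by
    unfold SetModel.stage₁
    infer_instance) hF hG

instance DFun.stage₂ : DFun fun v => SetModel.stage₂ fs (F v) (G v) :=
  DFun.app2 (H := fun a g => SetModel.stage₂ fs a g) (by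
    unfold SetModel.stage₂
    infer_instance) hF hG

instance DFun.next : DFun fun v => SetModel.next fs (F v) (G v) := by
  exact DFun.pick

end

section
variable {fs : List (M → M → M → M)} [hfs : DfnList fs]

/-- Taking the least stage means that any candidate at `m` forces the element added next to be new
and to come from data at most `m`. -/
theorem next_spec {a g m z₁ z₂ : M} (hm : IsOrd mem m)
    (h : Cand fs a g m z₁ z₂) : ¬ InRan g (next fs a g) ∧ ∃ m' z₁' z₂', m' ε succ m ∧
      z₁' ε succ m ∧ z₂' ε succ m ∧ m' ε dom g ∧ z₁' ε succ m' ∧ z₂' ε succ m' ∧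
      next fs a g = pick fs a g m' z₁' z₂' := by
  have h0 : Dfn fun v : Fin 1 → M => ∃ z₁ z₂, Cand fs a g (v 0) z₁ z₂ := by
    infer_instance
  have h1 : Dfn fun v : Fin 1 → M => ∃ z₂, Cand fs a g (stage₀ fs a g) (v 0) z₂ := by
    infer_instance
  have h2 : Dfn fun v : Fin 1 → M => Cand fs a g (stage₀ fs a g) (stage₁ fs a g) (v 0) :=
    Dfn.cand
  obtain ⟨ho, ⟨y₁, y₂, hy⟩, _⟩ := least_spec (P := fun m => ∃ z₁ z₂, Cand fs a g m z₁ z₂) hm ⟨_, _, h⟩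
  have hle := least_mem_succ (P := fun m => ∃ z₁ z₂, Cand fs a g m z₁ z₂) hm ⟨_, _, h⟩
  obtain ⟨_, ⟨y₂, hy⟩, _⟩ := least_spec (P := fun z₁ => ∃ z₂, Cand fs a g (stage₀ fs a g) z₁ z₂)
    hy.1.1 ⟨y₂, hy⟩
  obtain ⟨_, hy, _⟩ := least_spec (P := fun z₂ => Cand fs a g (stage₀ fs a g) (stage₁ fs a g) z₂)
    hy.1.2 hy
  have hup : ∀ {z}, z ε succ (stage₀ fs a g) → z ε succ m := by
    intro z hz
    rcases mem_succ.1 hz with hz | rfl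
    · exact hm.succ.trans hle hz
    · exact hle
  exact ⟨hy.2.2.2.2, _, _, _, hle, hup hy.2.2.1, hup hy.2.2.2.1, hy.2.1, hy.2.2.1, hy.2.2.2.1, rfl⟩

/-- The enumeration of the hull. -/
noncomputable def enum (fs : List (M → M → M → M)) (a ξ : M) : M := ordRec (next fs a) ξ

/-- The initial segment of length `ξ` of the enumeration. -/
noncomputable abbrev enumSeg (fs : List (M → M → M → M)) (a ξ : M) : M := recSeg (next fs a) ξ

instance DFun.enum {n : ℕ} {F G : (Fin n → M) → M} [hF : DFun F]
    [hG : DFun G] : DFun fun v => enum fs (F v) (G v) :=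
  DFun.ordRec (H := SetModel.next fs) DFun.next hF hG

theorem dFun_next (a : M) : DFun fun v : Fin 1 → M => next fs a (v 0) := inferInstance

theorem dom_enumSeg {a ξ : M} (hξ : IsOrd mem ξ) : dom (enumSeg fs a ξ) = ξ :=
  dom_recSeg (dFun_next a) hξ

theorem inRan_enumSeg {a ξ u : M} (hξ : IsOrd mem ξ) :
    InRan (enumSeg fs a ξ) u ↔ ∃ γ, γ ε ξ ∧ u = enum fs a γ := by
  constructor
  · rintro ⟨x, hx⟩
    obtain ⟨γ, hγ, h⟩ := (mem_recSeg (dFun_next a) hξ).1 hx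
    exact ⟨γ, hγ, (opair_inj.1 h).2⟩
  · rintro ⟨γ, hγ, rfl⟩
    exact ⟨γ, (mem_recSeg (dFun_next a) hξ).2 ⟨γ, hγ, rfl⟩⟩

theorem app_enumSeg {a ξ γ : M} (hξ : IsOrd mem ξ) (hγ : γ ε ξ) :
    app (enumSeg fs a ξ) γ = enum fs a γ := app_recSeg (dFun_next a) hξ hγ

/-- The hull of `a` under the functions of the list. -/
def Hull (fs : List (M → M → M → M)) (a u : M) : Prop := ∃ ξ, IsOrd mem ξ ∧ u = enum fs a ξ

instance Dfn.hull {n : ℕ} {F G : (Fin n → M) → M} [hF : DFun F] [hG : DFun G] :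
    Dfn fun v => Hull fs (F v) (G v) :=
  Dfn.app2 (R := Hull fs) (by
    unfold Hull
    infer_instance) hF hG

/-- The list is external and finite, so induction on it combines one application of replacement for
each function. -/
theorem exists_value_set (gs : List (M → M → M → M)) [hgs : DfnList gs] (a m : M) :
    ∃ B, ∀ f ∈ gs, ∀ z₁ z₂, z₁ ε succ m → z₂ ε succ m → f a (enum fs a z₁) (enum fs a z₂) ε B := by
  obtain ⟨hgs⟩ := hgs
  induction gs with
  | nil => exact ⟨empty, by simp⟩
  | cons f gs ih =>
    obtain ⟨B, hB⟩ := ih fun f' hf' => hgs f' (List.mem_cons_of_mem _ hf')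
    have h1 : DFun fun v : Fin 1 → M => enum fs a (fst (v 0)) := DFun.enum
    have h2 : DFun fun v : Fin 1 → M => enum fs a (snd (v 0)) := DFun.enum
    have h3 : DFun fun v : Fin 1 → M => f a (enum fs a (fst (v 0))) (enum fs a (snd (v 0))) :=
      (hgs f List.mem_cons_self).app3 inferInstance h1 h2
    refine ⟨union B (img (prod (succ m) (succ m))
      fun p => f a (enum fs a (fst p)) (enum fs a (snd p))), fun f' hf' z₁ z₂ hz₁ hz₂ => ?_⟩
    rcases List.mem_cons.1 hf' with rfl | hf'
    · refine mem_union.2 (Or.inr (mem_img.2 ⟨opair z₁ z₂, opair_mem_prod.2 ⟨hz₁, hz₂⟩, by simp⟩))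
    · exact mem_union.2 (Or.inl (hB f' hf' z₁ z₂ hz₁ hz₂))

/-- If `u` were never enumerated, the data `(m, η₁, η₂)` would remain a candidate at every stage
after `m`. Each of these stages would add a new element arising from data at most `m`, hence an
element of one fixed set, and the ordinals above `m` would inject into that set. -/
theorem hull_of_new {a u m η₁ η₂ : M} (hm : IsOrd mem m) (h₁ : η₁ ε succ m)
    (h₂ : η₂ ε succ m) (hu : u = m ∨ ∃ f ∈ fs, u = f a (enum fs a η₁) (enum fs a η₂)) :
    Hull fs a u := by
  by_contra hnot
  obtain ⟨B, hB⟩ := exists_value_set fs a m (fs := fs)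
  have hsub : ∀ {z ξ : M}, IsOrd mem ξ → m ε ξ → z ε succ m → z ε ξ := by
    intro z ξ hξ hmξ hz
    rcases mem_succ.1 hz with h | rfl
    · exact hξ.trans hmξ h
    · exact hmξ
  have hcand : ∀ {ξ : M}, IsOrd mem ξ → m ε ξ → Cand fs a (enumSeg fs a ξ) m η₁ η₂ := by
    intro ξ hξ hmξ
    refine ⟨⟨hm.succ.mem h₁, hm.succ.mem h₂⟩, by rwa [dom_enumSeg hξ], h₁, h₂, fun hr => ?_⟩
    obtain ⟨h3, h4⟩ := inRan_of_pick hr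
    have : InRan (enumSeg fs a ξ) u := by
      rcases hu with rfl | ⟨f, hf, rfl⟩
      · exact h3
      · have := h4 f hf
        rwa [app_enumSeg hξ (hsub hξ hmξ h₁), app_enumSeg hξ (hsub hξ hmξ h₂)] at this
    obtain ⟨γ, hγ, h⟩ := (inRan_enumSeg hξ).1 this
    exact hnot ⟨γ, hξ.mem hγ, h⟩
  have hE : DFun fun v : Fin 1 → M => enum fs a (v 0) := DFun.enum
  refine no_ord_injection (F := fun ξ => enum fs a ξ) (b := union B (succ m)) hm ?_ ?_
  · intro ξ hξ hmξ
    obtain ⟨_, m', z₁, z₂, hm', hz₁, hz₂, _, _, _, h⟩ := next_spec hm (hcand hξ hmξ)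
    rw [show enum fs a ξ = next fs a (enumSeg fs a ξ) from rfl, h]
    rcases pick_cases fs a (enumSeg fs a ξ) m' z₁ z₂ with h' | ⟨f, hf, h'⟩
    · rw [h']; exact mem_union.2 (Or.inr hm')
    · rw [h', app_enumSeg hξ (hsub hξ hmξ hz₁), app_enumSeg hξ (hsub hξ hmξ hz₂)]
      exact mem_union.2 (Or.inl (hB f hf z₁ z₂ hz₁ hz₂))
  · intro α β hα hβ hmα hαβ he
    have := (next_spec hm (hcand hβ (hβ.trans hαβ hmα))).1
    exact this ((inRan_enumSeg hβ).2 ⟨α, hαβ, he.symm⟩)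

theorem Hull.ord {a α : M} (hα : IsOrd mem α) : Hull fs a α :=
  hull_of_new hα (η₁ := α) (η₂ := α) (by simp) (by simp) (Or.inl rfl)

theorem Hull.closed {f : M → M → M → M} (hf : f ∈ fs) {a p q : M}
    (hp : Hull fs a p) (hq : Hull fs a q) : Hull fs a (f a p q) := by
  obtain ⟨ξ, hξ, rfl⟩ := hp
  obtain ⟨ζ, hζ, rfl⟩ := hq
  rcases ord_trichotomy hξ hζ with h | rfl | h
  · exact hull_of_new hζ (mem_succ.2 (Or.inl h)) (mem_succ.2 (Or.inr rfl)) (Or.inr ⟨f, hf, rfl⟩)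
  · exact hull_of_new hξ (mem_succ.2 (Or.inr rfl)) (mem_succ.2 (Or.inr rfl)) (Or.inr ⟨f, hf, rfl⟩)
  · exact hull_of_new hξ (mem_succ.2 (Or.inr rfl)) (mem_succ.2 (Or.inl h)) (Or.inr ⟨f, hf, rfl⟩)

/-- The element of `S` enumerated first. -/
noncomputable def first (fs : List (M → M → M → M)) (a S : M) : M :=
  enum fs a (least fun ξ => enum fs a ξ ε S)

instance DFun.first {n : ℕ} {F G : (Fin n → M) → M} [hF : DFun F] [hG : DFun G] :
    DFun fun v => first fs (F v) (G v) :=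
  DFun.app2 (H := SetModel.first fs) (by unfold SetModel.first; infer_instance) hF hG

theorem first_mem {a S y : M} (hy : Hull fs a y) (hS : y ε S) : first fs a S ε S := by
  obtain ⟨ξ, hξ, rfl⟩ := hy
  exact (least_spec (P := fun ξ => enum fs a ξ ε S) hξ hS).2.1

end
end
end SetModel

namespace SetModel
universe u
open SetStr

/-! ### Coding sequences of sequences -/

section
variable {M : Type u} [SetStr M] [ZFM M]

/-- The pair of sequences `P, Q : ω → ω` enumerates `ω × ω`. -/
def IsPairing (P Q : M) : Prop := IsFun mem P omega omega ∧ IsFun mem Q omega omega ∧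
  ∀ n k, n ε (omega : M) → k ε (omega : M) → ∃ m, m ε (omega : M) ∧ app P m = n ∧ app Q m = k

-- A state `(i, k, j)` runs through the square of all `i, k ≤ j`, with `i` moving fastest, and then
-- restarts at `(0, 0, j + 1)`; the pair `(n, k)` is met at the latest in the square of side `max(n,
-- k)`. Repetitions are harmless, since `code` takes the least index.
open Classical in
theorem exists_pairing : ∃ P Q : M, IsPairing P Q := by
  let tri : M → M → M → M := fun i k j => opair i (opair k j)
  let step : M → M := fun s =>
    if fst s ε snd (snd s) then tri (succ (fst s)) (fst (snd s)) (snd (snd s))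
    else if fst (snd s) ε snd (snd s) then tri empty (succ (fst (snd s))) (snd (snd s))
    else tri empty empty (succ (snd (snd s)))
  have hstep : DFun fun v : Fin 1 → M => step (v 0) := by simp only [step, tri]; infer_instance
  obtain ⟨e, he, h0, hs⟩ := exists_nat_rec (tri empty empty empty) (S := fun _ s => step s)
    (hstep.app1 (DFun.proj 1))
  have he' : ∀ {n : ℕ} {F : (Fin n → M) → M} [hF : DFun F], DFun fun v => e (F v) :=
    fun {_ _} [_] => he.app1 inferInstance
  let Reach : M → M → M → Prop := fun i k j => ∃ m, m ε (omega : M) ∧ e m = opair i (opair k j)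
  have hr1 : ∀ {i k j}, Reach i k j → i ε j → Reach (succ i) k j := by
    rintro i k j ⟨m, hm, h⟩ hi
    exact ⟨succ m, succ_mem_omega hm, by simp [hs m hm, h, step, tri, hi]⟩
  have hr2 : ∀ {k j}, Reach j k j → k ε j → Reach empty (succ k) j := by
    rintro k j ⟨m, hm, h⟩ hk
    exact ⟨succ m, succ_mem_omega hm, by simp [hs m hm, h, step, tri, not_mem_self, hk]⟩
  have hr3 : ∀ {j}, Reach j j j → Reach empty empty (succ j) := by
    rintro j ⟨m, hm, h⟩
    exact ⟨succ m, succ_mem_omega hm, by simp [hs m hm, h, step, tri, not_mem_self]⟩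
  have hlt : ∀ {i j : M}, j ε (omega : M) → succ i ε succ j → i ε j := fun hj h =>
    subset_of_mem_succ (isOrd_nat hj) h _ (by simp)
  have row : ∀ {k j}, j ε (omega : M) → Reach empty k j → ∀ i, i ε (omega : M) → i ε succ j →
      Reach i k j := by
    intro k j hj h i hi
    refine nat_induction (P := fun i => i ε succ j → Reach i k j) (fun _ => h)
      (fun i hi ih hij => hr1 (ih ?_) (hlt hj hij)) hi
    exact mem_succ.2 (Or.inl (hlt hj hij))
  have col : ∀ {j}, j ε (omega : M) → Reach empty empty j → ∀ k, k ε (omega : M) → k ε succ j →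
      Reach empty k j := by
    intro j hj h k hk
    refine nat_induction (P := fun k => k ε succ j → Reach empty k j) (fun _ => h)
      (fun k hk ih hkj => hr2 (row hj (ih ?_) j hj (by simp)) (hlt hj hkj)) hk
    exact mem_succ.2 (Or.inl (hlt hj hkj))
  have corner : ∀ j, j ε (omega : M) → Reach empty empty j := by
    intro j hj
    exact nat_induction (P := fun j => Reach empty empty j) ⟨empty, by simp, h0⟩
      (fun j hj ih => hr3 (row hj (col hj ih j hj (by simp)) j hj (by simp))) hj
  -- The default `∅` forces the values into `ω`, which saves proving that every state consists of
  -- natural numbers.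
  let tot : M → M := fun x => if x ε (omega : M) then x else empty
  have htot : ∀ {n : ℕ} {F : (Fin n → M) → M} [hF : DFun F], DFun fun v => tot (F v) := by
    intro n F hF; simp only [tot]; infer_instance
  have htot' : ∀ x, tot x ε (omega : M) := by
    intro x; simp only [tot]; split
    · assumption
    · simp
  refine ⟨lam omega fun m => tot (fst (e m)), lam omega fun m => tot (fst (snd (e m))),
    isFun_lam fun m _ => htot' _, isFun_lam fun m _ => htot' _, fun n k hn hk => ?_⟩
  have key : ∃ j, j ε (omega : M) ∧ n ε succ j ∧ k ε succ j := by
    rcases ord_trichotomy (isOrd_nat hn) (isOrd_nat hk) with h | rfl | h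
    · exact ⟨k, hk, by simp [h], by simp⟩
    · exact ⟨n, hn, by simp, by simp⟩
    · exact ⟨n, hn, by simp, by simp [h]⟩
  obtain ⟨j, hj, hnj, hkj⟩ := key
  obtain ⟨m, hm, h⟩ := row hj (col hj (corner j hj) k hk hkj) n hn hnj
  exact ⟨m, hm, by simp [app_lam hm, h, tot, hn], by simp [app_lam hm, h, tot, hk]⟩

/-- The least index of the pair `(n, k)`. -/
noncomputable def code (P Q n k : M) : M :=
  least fun m => m ε (omega : M) ∧ app P m = n ∧ app Q m = k

/-- The `k`-th of the sequences coded by `a`. -/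
noncomputable def row (P Q a k : M) : M := lam omega fun n => app a (code P Q k n)

/-- The sequence coding the sequences `r(0), r(1), …`. -/
noncomputable def enc (P Q : M) (r : M → M) : M := lam omega fun m => app (r (app P m)) (app Q m)

section
variable {n : ℕ} {F G : (Fin n → M) → M} [hF : DFun F] [hG : DFun G]
instance DFun.code (P Q : M) : DFun fun v => SetModel.code P Q (F v) (G v) :=
  DFun.app2 (H := SetModel.code P Q) (by unfold SetModel.code; infer_instance) hF hG
instance DFun.row (P Q : M) : DFun fun v => SetModel.row P Q (F v) (G v) :=
  DFun.app2 (H := SetModel.row P Q) (by unfold SetModel.row; infer_instance) hF hG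
end

variable {P Q θ : M}

theorem IsPairing.code (hPQ : IsPairing P Q) {n k : M} (hn : n ε (omega : M)) (hk : k ε (omega : M)) :
    code P Q n k ε (omega : M) ∧ app P (code P Q n k) = n ∧ app Q (code P Q n k) = k := by
  obtain ⟨m, hm, h⟩ := hPQ.2.2 n k hn hk
  exact (least_spec (P := fun m => m ε (omega : M) ∧ app P m = n ∧ app Q m = k) (isOrd_nat hm)
    ⟨hm, h⟩).2.1

theorem app_row {a k n : M} (hn : n ε (omega : M)) : app (row P Q a k) n = app a (code P Q k n) :=
  app_lam hn

theorem IsPairing.isFun_row (hPQ : IsPairing P Q) {a k : M} (ha : IsFun mem a omega θ)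
    (hk : k ε (omega : M)) : IsFun mem (row P Q a k) omega θ :=
  isFun_lam fun _ hn => ha.app_mem (hPQ.code hk hn).1

theorem IsPairing.isFun_enc (hPQ : IsPairing P Q) {r : M → M}
    (hr : DFun fun v : Fin 1 → M => r (v 0)) (h : ∀ k, k ε (omega : M) → IsFun mem (r k) omega θ) :
    IsFun mem (enc P Q r) omega θ := by
  have hr' : ∀ {n : ℕ} {F : (Fin n → M) → M} [hF : DFun F], DFun fun v => r (F v) :=
    fun {_ _} [_] => hr.app1 inferInstance
  exact isFun_lam fun m hm => (h _ (hPQ.1.app_mem hm)).app_mem (hPQ.2.1.app_mem hm)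

theorem IsPairing.app_enc (hPQ : IsPairing P Q) {r : M → M}
    (hr : DFun fun v : Fin 1 → M => r (v 0)) {k n : M} (hk : k ε (omega : M)) (hn : n ε (omega : M)) :
    app (enc P Q r) (SetModel.code P Q k n) = app (r k) n := by
  have hr' : ∀ {n : ℕ} {F : (Fin n → M) → M} [hF : DFun F], DFun fun v => r (F v) :=
    fun {_ _} [_] => hr.app1 inferInstance
  obtain ⟨h1, h2, h3⟩ := hPQ.code hk hn
  rw [enc, app_lam h1, h2, h3]

theorem IsPairing.row_enc (hPQ : IsPairing P Q) {r : M → M}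
    (hr : DFun fun v : Fin 1 → M => r (v 0)) (h : ∀ k, k ε (omega : M) → IsFun mem (r k) omega θ)
    {k : M} (hk : k ε (omega : M)) : row P Q (enc P Q r) k = r k :=
  (hPQ.isFun_row (hPQ.isFun_enc hr h) hk).funext (h k hk) fun n hn => by
    rw [app_row hn, hPQ.app_enc hr hk hn]

end
end SetModel

namespace SetModel
universe u
open SetStr

/-! ### Every element of `L(θ^ω)` is in the hull of an `ω`-sequence in `θ` -/

section
variable {M : Type u} [SetStr M] [ZFM M]

/-- The functions generating `L(A)` from ordinals and a sequence. -/
noncomputable def rules (A P Q : M) : List (M → M → M → M) :=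
  -- Every rule has two arguments besides the parameter `a`; operations with three or four take them
  -- packed into pairs, which adjunction builds.
  [fun _ p q => adj p q, fun _ _ _ => A, fun a p _ => row P Q a p, fun _ p _ => Lv A p,
    fun _ p q => memRel (fst p) (snd p) (fst q) (snd q),
    fun _ p q => eqRel (fst p) (snd p) (fst q) (snd q),
    fun _ p q => complRel (fst p) (snd p) q, fun _ p q => inter p q,
    fun _ p q => projRel (fst p) (snd p) q, fun _ p q => secRel (fst p) (snd p) (fst q) (snd q)]

instance DfnList.rules (A P Q : M) : DfnList (rules A P Q) where
  dfun f hf := by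
    simp only [SetModel.rules, List.mem_cons, List.not_mem_nil, or_false] at hf
    rcases hf with rfl | rfl | rfl | rfl | rfl | rfl | rfl | rfl | rfl | rfl <;> infer_instance

variable {A P Q θ a p q : M}

theorem Hull.adj (hp : Hull (rules A P Q) a p) (hq : Hull (rules A P Q) a q) :
    Hull (rules A P Q) a (adj p q) :=
  Hull.closed (f := fun _ p q => SetModel.adj p q) (by simp [rules]) hp hq

theorem hull_empty : Hull (rules A P Q) a empty := Hull.ord isOrd_empty

theorem hull_self : Hull (rules A P Q) a A :=
  Hull.closed (f := fun _ _ _ => A) (by simp [rules]) hull_empty hull_empty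

theorem Hull.row (hp : Hull (rules A P Q) a p) : Hull (rules A P Q) a (row P Q a p) :=
  Hull.closed (f := fun a p _ => SetModel.row P Q a p) (by simp [rules]) hp hull_empty

theorem Hull.lv (hp : Hull (rules A P Q) a p) : Hull (rules A P Q) a (Lv A p) :=
  Hull.closed (f := fun _ p _ => Lv A p) (by simp [rules]) hp hull_empty

theorem Hull.upair (hp : Hull (rules A P Q) a p) (hq : Hull (rules A P Q) a q) :
    Hull (rules A P Q) a (upair p q) := by
  have : SetModel.upair p q = SetModel.adj (SetModel.adj empty p) q := ext fun z => by simp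
  exact this ▸ (hull_empty.adj hp).adj hq

theorem Hull.opair (hp : Hull (rules A P Q) a p) (hq : Hull (rules A P Q) a q) :
    Hull (rules A P Q) a (opair p q) := (hp.upair hp).upair (hp.upair hq)

theorem Hull.secRel {X n s R : M} (hX : Hull (rules A P Q) a X) (hn : Hull (rules A P Q) a n)
    (hs : Hull (rules A P Q) a s) (hR : Hull (rules A P Q) a R) :
    Hull (rules A P Q) a (secRel X n s R) := by
  simpa using Hull.closed (fs := rules A P Q)
    (f := fun _ p q => SetModel.secRel (fst p) (snd p) (fst q) (snd q)) (by simp [rules])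
    (hX.opair hn) (hs.opair hR)

theorem Hull.nat {n : M} (hn : n ε (omega : M)) : Hull (rules A P Q) a n := Hull.ord (isOrd_nat hn)

/-- The pairs in `defRels X` whose relation lies in the hull form a closed family, because the rules
contain every generating operation. By leastness this family is all of `defRels X`. -/
theorem Hull.defRel {X n R : M} (hX : Hull (rules A P Q) a X) (h : SetModel.opair n R ε defRels X) :
    Hull (rules A P Q) a R := by
  let D := sep (defRels X) fun p => Hull (rules A P Q) a (snd p)
  have hD : ∀ {n R : M}, SetModel.opair n R ε D ↔
      SetModel.opair n R ε defRels X ∧ Hull (rules A P Q) a R := by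
    intro n R
    simp only [D, mem_sep, snd_opair]
  have cl : ∀ {f : M → M → M → M}, f ∈ rules A P Q → ∀ {p q}, Hull (rules A P Q) a p →
      Hull (rules A P Q) a q → Hull (rules A P Q) a (f a p q) := fun hf _ _ => Hull.closed hf
  obtain ⟨h1, h2, h3, h4, h5⟩ := defClosed_iff.1 (defClosed_defRels X)
  have : DefClosed SetStr.mem X D := defClosed_iff.2
    ⟨fun n hn i hi j hj => hD.2 ⟨h1 n hn i hi j hj, by
      simpa using cl (f := fun _ p q => memRel (fst p) (snd p) (fst q) (snd q)) (by simp [rules])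
        (hX.opair (Hull.nat hn)) ((Hull.nat (nat_trans hn hi)).opair (Hull.nat (nat_trans hn hj)))⟩,
    fun n hn i hi j hj => hD.2 ⟨h2 n hn i hi j hj, by
      simpa using cl (f := fun _ p q => eqRel (fst p) (snd p) (fst q) (snd q)) (by simp [rules])
        (hX.opair (Hull.nat hn)) ((Hull.nat (nat_trans hn hi)).opair (Hull.nat (nat_trans hn hj)))⟩,
    fun n hn R hR => hD.2 ⟨h3 n hn R (hD.1 hR).1, by
      simpa using cl (f := fun _ p q => complRel (fst p) (snd p) q) (by simp [rules])
        (hX.opair (Hull.nat hn)) (hD.1 hR).2⟩,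
    fun n hn R S hR hS => hD.2 ⟨h4 n hn R S (hD.1 hR).1 (hD.1 hS).1,
      cl (f := fun _ p q => inter p q) (by simp [rules]) (hD.1 hR).2 (hD.1 hS).2⟩,
    fun n hn R hR => hD.2 ⟨h5 n hn R (hD.1 hR).1, by
      simpa using cl (f := fun _ p q => projRel (fst p) (snd p) q) (by simp [rules])
        (hX.opair (Hull.nat hn)) (hD.1 hR).2⟩⟩
  exact (hD.1 (pairMem_iff.1 (isDefRel_iff.2 h D this))).2

/-! ### Sequences that suffice to generate a given element -/

/-- `x` is in the hull of every sequence in `A` coding at least the sequences coded by `a`. -/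
def Good (A P Q a x : M) : Prop := a ε A ∧ ∀ b, b ε A →
  (∀ k, k ε (omega : M) → ∃ l, l ε (omega : M) ∧ row P Q a k = row P Q b l) → Hull (rules A P Q) b x

instance Dfn.good {n : ℕ} {F G : (Fin n → M) → M} [hF : DFun F] [hG : DFun G] :
    Dfn fun v => Good A P Q (F v) (G v) :=
  Dfn.app2 (R := Good A P Q) (by unfold Good; infer_instance) hF hG

-- A single sequence lists the rows of both `a` and `b`, which is why `Good` refers only to the set
-- of coded rows and not to their order.
open Classical in
theorem Good.merge (hPQ : IsPairing P Q) {a b x y : M} (ha : Good (funs omega θ) P Q a x)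
    (hb : Good (funs omega θ) P Q b y) :
    ∃ c, Good (funs omega θ) P Q c x ∧ Good (funs omega θ) P Q c y := by
  -- An index `i` with `P(i) = 0` carries row `Q(i)` of `a`, any other index row `Q(i)` of `b`;
  -- below, `P(i) = 1` is used to find the rows of `b`.
  let r : M → M := fun i => if app P i = empty then row P Q a (app Q i) else row P Q b (app Q i)
  have hr : DFun fun v : Fin 1 → M => r (v 0) := by simp only [r]; infer_instance
  have hr' : ∀ k, k ε (omega : M) → IsFun mem (r k) omega θ := by
    intro k hk
    simp only [r]
    split
    · exact hPQ.isFun_row (mem_funs.1 ha.1) (hPQ.2.1.app_mem hk)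
    · exact hPQ.isFun_row (mem_funs.1 hb.1) (hPQ.2.1.app_mem hk)
  have hc : enc P Q r ε funs omega θ := mem_funs.2 (hPQ.isFun_enc hr hr')
  refine ⟨enc P Q r, ⟨hc, fun d hd h => ha.2 d hd fun k hk => ?_⟩,
    ⟨hc, fun d hd h => hb.2 d hd fun k hk => ?_⟩⟩
  · obtain ⟨i, hi, h1, h2⟩ := hPQ.2.2 empty k (by simp) hk
    obtain ⟨l, hl, h⟩ := h i hi
    refine ⟨l, hl, h ▸ ?_⟩
    rw [hPQ.row_enc hr hr' hi]
    simp [r, h1, h2]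
  · obtain ⟨i, hi, h1, h2⟩ := hPQ.2.2 (succ empty) k (succ_mem_omega (by simp)) hk
    obtain ⟨l, hl, h⟩ := h i hi
    refine ⟨l, hl, h ▸ ?_⟩
    rw [hPQ.row_enc hr hr' hi]
    simp [r, h1, h2, succ_ne_empty]

theorem Good.self {x : M} (h : Good A P Q a x) : Hull (rules A P Q) a x :=
  h.2 a h.1 fun k hk => ⟨k, hk, rfl⟩

/-- An element of every hull needs no coded rows, so any sequence will do. The constant zero
sequence is at hand because `0 ∈ θ`. -/
theorem exists_good_of_hull (hθ : empty ε θ) {x : M}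
    (h : ∀ b, b ε funs omega θ → Hull (rules (funs omega θ) P Q) b x) :
    ∃ a, Good (funs omega θ) P Q a x :=
  ⟨lam omega fun _ => empty, mem_funs.2 (isFun_lam fun _ _ => hθ), fun b hb _ => h b hb⟩

/-- All rows of the code are `x`; any `b` coding at least these rows has `x` as some row, and the
row map is one of the rules. -/
theorem exists_good_seq (hPQ : IsPairing P Q) {x : M} (hx : x ε funs omega θ) :
    ∃ a, Good (funs omega θ) P Q a x := by
  have hc : DFun fun v : Fin 1 → M => (fun _ => x) (v 0) := DFun.const x
  have hx' := fun k (_ : k ε (omega : M)) => mem_funs.1 hx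
  refine ⟨enc P Q fun _ => x, mem_funs.2 (hPQ.isFun_enc hc hx'), fun b hb h => ?_⟩
  obtain ⟨l, hl, h⟩ := h empty (by simp)
  rw [hPQ.row_enc hc hx' (by simp)] at h
  exact h ▸ (Hull.nat hl).row

/-- Below `θ^ω` there are only its functions, their pairs, the unordered pairs inside these, and
ordinals; together with `θ^ω` these form a transitive collection. -/
theorem mem_tc_funs {x : M} (hθ : IsOrd mem θ) (hx : x ε tc (funs omega θ)) :
    x = funs omega θ ∨ x ε funs omega θ ∨ x ε prod omega θ ∨
      (∃ p, p ε prod omega θ ∧ x ε p) ∨ IsOrd mem x := by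
  refine (mem_sep.1 (tc_subset (S := sep (tc (funs omega θ)) fun x => x = funs omega θ ∨
    x ε funs omega θ ∨ x ε prod omega θ ∨ (∃ p, p ε prod omega θ ∧ x ε p) ∨ IsOrd mem x) ?_ ?_ x hx)).2
  · exact mem_sep.2 ⟨self_mem_tc _, Or.inl rfl⟩
  · intro x hx y hy
    obtain ⟨hx, h⟩ := mem_sep.1 hx
    refine mem_sep.2 ⟨isTransSet_tc _ x hx y hy, ?_⟩
    rcases h with rfl | h | h | ⟨p, hp, h⟩ | h
    · exact Or.inr (Or.inl hy)
    · exact Or.inr (Or.inr (Or.inl ((isFun_iff.1 (mem_funs.1 h)).1 y hy)))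
    · exact Or.inr (Or.inr (Or.inr (Or.inl ⟨x, h, hy⟩)))
    · obtain ⟨n, hn, α, hα, rfl⟩ := mem_prod.1 hp
      have h1 := isOrd_nat hn
      have h2 := hθ.mem hα
      refine Or.inr (Or.inr (Or.inr (Or.inr ?_)))
      rcases mem_upair.1 h with rfl | rfl
      · rcases mem_upair.1 hy with rfl | rfl <;> assumption
      · rcases mem_upair.1 hy with rfl | rfl <;> assumption
    · exact Or.inr (Or.inr (Or.inr (Or.inr (h.mem hy))))

theorem exists_good_tc (hPQ : IsPairing P Q) (hθ : IsOrd mem θ) (h0 : empty ε θ) {x : M}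
    (hx : x ε tc (funs omega θ)) : ∃ a, Good (funs omega θ) P Q a x := by
  rcases mem_tc_funs hθ hx with rfl | h | h | ⟨p, hp, h⟩ | h
  · exact exists_good_of_hull h0 fun b _ => hull_self
  · exact exists_good_seq hPQ h
  · obtain ⟨n, hn, α, hα, rfl⟩ := mem_prod.1 h
    exact exists_good_of_hull h0 fun b _ => (Hull.nat hn).opair (Hull.ord (hθ.mem hα))
  · obtain ⟨n, hn, α, hα, rfl⟩ := mem_prod.1 hp
    refine exists_good_of_hull h0 fun b _ => ?_
    rcases mem_upair.1 h with rfl | rfl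
    · exact (Hull.nat hn).upair (Hull.nat hn)
    · exact (Hull.nat hn).upair (Hull.ord (hθ.mem hα))
  · exact exists_good_of_hull h0 fun b _ => Hull.ord h

theorem exists_good_finite_seq (hPQ : IsPairing P Q) (h0 : empty ε θ) {X : M}
    (hX : ∀ x, x ε X → ∃ a, Good (funs omega θ) P Q a x) {n : M} (hn : n ε (omega : M)) :
    ∀ s, IsFun mem s n X → ∃ a, Good (funs omega θ) P Q a s := by
  refine nat_induction (P := fun n => ∀ s, IsFun mem s n X → ∃ a, Good (funs omega θ) P Q a s)
    (fun s hs => ?_) (fun n hn ih t ht => ?_) hn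
  · rw [isFun_empty.1 hs]
    exact exists_good_of_hull h0 fun b _ => hull_empty
  · obtain ⟨s, hs, h⟩ := ht.exists_eq_adj
    obtain ⟨a, ha⟩ := ih s hs
    obtain ⟨b, hb⟩ := hX _ (ht.app_mem (x := n) (by simp))
    obtain ⟨c, h1, h2⟩ := ha.merge hPQ hb
    refine ⟨c, h1.1, fun d hd hcd => ?_⟩
    rw [h]
    exact (h1.2 d hd hcd).adj ((Hull.nat hn).opair (h2.2 d hd hcd))

/-- An element of `Def(L_γ(A))` is a section of a definable relation at a finite sequence `s`. The
relation lies in every hull together with `L_γ(A)`, and the codes for the entries of `s` are merged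
by induction on its length, so no infinite choice of codes occurs. -/
theorem exists_good_Lv (hPQ : IsPairing P Q) (hθ : IsOrd mem θ) (h0 : empty ε θ) {β : M}
    (hβ : IsOrd mem β) : ∀ x, x ε Lv (funs omega θ) β → ∃ a, Good (funs omega θ) P Q a x := by
  refine ord_induction (P := fun β => ∀ x, x ε Lv (funs omega θ) β →
    ∃ a, Good (funs omega θ) P Q a x) (fun β hβ ih x hx => ?_) hβ
  rcases (mem_Lv hβ).1 hx with hx | ⟨γ, hγ, hx⟩
  · exact exists_good_tc hPQ hθ h0 hx
  · obtain ⟨n, hn, s, R, hs, hR, rfl⟩ := inDef_iff.1 (mem_defSet.1 hx)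
    obtain ⟨a, ha⟩ := exists_good_finite_seq hPQ h0 (ih γ hγ) hn s hs
    have hL : ∀ b, Hull (rules (funs omega θ) P Q) b (Lv (funs omega θ) γ) :=
      fun b => (Hull.ord (hβ.mem hγ)).lv
    exact ⟨a, ha.1, fun b hb h => (hL b).secRel (Hull.nat hn) (ha.2 b hb h) ((hL b).defRel hR)⟩

end
end SetModel

namespace SetModel
universe u
open SetStr

/-! ### Dependent choice in `L(θ^ω)` -/

section
variable {M : Type u} [SetStr M] [ZFM M]

theorem IsPairing.val {P : M → Prop} [TransClass P] [ZFM {x // P x}] {p q : {x // P x}}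
    (h : IsPairing p q) : IsPairing p.1 q.1 := by
  have h1 := isFun_val.1 h.1
  have h2 := isFun_val.1 h.2.1
  rw [val_omega] at h1 h2
  refine ⟨h1, h2, fun n k hn hk => ?_⟩
  obtain ⟨m, hm, h3, h4⟩ := h.2.2 ⟨n, prop_nat hn⟩ ⟨k, prop_nat hk⟩ (mem_omega_val.1 hn)
    (mem_omega_val.1 hk)
  exact ⟨m.1, mem_omega_val.2 hm, by rw [← val_app, h3], by rw [← val_app, h4]⟩

/-- The inner model `L(A)`. -/
abbrev Inner (A : M) : Type u := {x : M // InL mem A x}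

/-- The covering by hulls is applied inside `L(A)`, whose levels and whose version of `θ^ω` are the
true ones; hence the hulls, and the orderings they provide, are available to `L(A)`. -/
theorem exists_hull_inL {θ : M} (hθ : IsOrd mem θ) (h0 : empty ε θ) :
    ∃ A P Q : Inner (funs omega θ), A.1 = funs omega θ ∧ IsPairing P Q ∧
      ∀ x, ∃ a, a ε A ∧ Hull (rules A P Q) a x := by
  obtain ⟨P, Q, hPQ⟩ := exists_pairing (M := Inner (funs omega θ))
  let A : Inner (funs omega θ) := ⟨funs omega θ, inL_self _⟩
  let θ' : Inner (funs omega θ) := ⟨θ, inL_ord _ hθ⟩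
  have hA : A = funs omega θ' := ext fun z => by
    rw [mem_funs, isFun_val, val_omega, ← mem_funs]
    exact Iff.rfl
  refine ⟨A, P, Q, rfl, hPQ, fun x => ?_⟩
  obtain ⟨β, hβ, hx⟩ := inL_iff.1 x.2
  let β' : Inner (funs omega θ) := ⟨β, inL_ord _ hβ⟩
  have hβ' : IsOrd mem β' := isOrd_val.2 hβ
  have hx' : x ε Lv A β' := by
    change x.1 ε (Lv A β').1
    rw [val_Lv A hβ']
    exact hx
  rw [hA] at hx' ⊢
  have h0' : empty ε θ' := by
    change (empty : Inner (funs omega θ)).1 ε θ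
    rwa [val_empty]
  obtain ⟨a, ha⟩ := exists_good_Lv hPQ (isOrd_val.2 hθ) h0' hβ' x hx'
  exact ⟨a, ha.1, ha.self⟩

/-- The sequence of rows `r` is only known to `V`, but its code `h` lies in the class. Decoding `h`
there returns the original rows, since values and least indices are absolute. -/
theorem val_row_enc {P : M → Prop} [TransClass P] [ZFM {x // P x}] {p q h : {x // P x}}
    (hpq : IsPairing p q) {θ : M} {r : M → M} (hr : DFun fun v : Fin 1 → M => r (v 0))
    (hr' : ∀ k, k ε (omega : M) → IsFun mem (r k) omega θ) (hh : h.1 = enc p.1 q.1 r)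
    {k : {x // P x}} (hk : k ε (omega : {x // P x})) : (row p q h k).1 = r k.1 := by
  have hr1 : ∀ {n : ℕ} {F : (Fin n → M) → M} [hF : DFun F], DFun fun v => r (F v) :=
    fun {_ _} [_] => hr.app1 inferInstance
  have hk' := mem_omega_val.2 hk
  have hval : ∀ n, n ε (omega : M) → app (row p q h k).1 n = app (r k.1) n := by
    intro n hn
    have hn' : (⟨n, prop_nat hn⟩ : {x // P x}) ε (omega : {x // P x}) := mem_omega_val.1 hn
    obtain ⟨h1, h2, h3⟩ := hpq.code hk hn'
    have h4 := val_app (row p q h k) ⟨n, prop_nat hn⟩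
    rw [app_row hn', val_app, hh, enc,
      app_lam (mem_omega_val.2 h1), ← val_app, ← val_app, h2, h3] at h4
    exact h4.symm
  have hf : IsFun mem (row p q h k).1 omega (sUnion (sUnion (row p q h k).1)) := by
    have : IsFun mem (row p q h k) omega (sUnion (sUnion (row p q h k))) :=
      isFun_lam fun n hn => (mem_sUnion_sUnion (f := row p q h k) (x := n)
        (opair_mem_lam.2 ⟨hn, rfl⟩)).2
    simpa using isFun_val.1 this
  exact hf.funext (hr' k.1 hk') hval

/-- Dependent choice in `L(θ^ω)` for non-empty `θ`. -/
theorem dc_inL_funs (hDC : DC (mem : M → M → Prop)) {θ : M} (hθ : IsOrd mem θ) (h0 : empty ε θ) :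
    DC (restrict mem (InL mem (funs omega θ))) := by
  obtain ⟨A, P, Q, hA, hPQ, hull⟩ := exists_hull_inL hθ h0
  change DC (mem : Inner (funs omega θ) → _ → Prop)
  intro X R ⟨x₁, hx₁⟩ htot
  let S : Inner (funs omega θ) → Inner (funs omega θ) :=
    fun x => sep X fun y => opair x y ε R
  -- Together, `x` and `a` determine `y`, so only the sequences `a` have to be remembered.
  let C : Inner (funs omega θ) → Inner (funs omega θ) →
      Inner (funs omega θ) → Prop :=
    fun x y a => y = first (rules A P Q) a (S x) ∧ y ε S x
  have hC : Dfn fun v : Fin 3 → Inner (funs omega θ) => C (v 0) (v 1) (v 2) := by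
    simp only [C, S]; infer_instance
  have hchoice : ∀ x, x ε X → ∃ y a, y ε X ∧ a ε A ∧ C x y a := by
    intro x hx
    obtain ⟨y, hy, h⟩ := htot x hx
    obtain ⟨a, ha, hay⟩ := hull y
    have := first_mem hay (S := S x) (mem_sep.2 ⟨hy, pairMem_iff.1 h⟩)
    exact ⟨_, a, (mem_sep.1 this).1, ha, rfl, this⟩
  -- `C` as seen from `V`, where `DC` is applied.
  let C' : M → M → M → Prop := fun x y a =>
    ∃ h : ∀ i, InL mem (funs omega θ) (![x, y, a] i), C ⟨_, h 0⟩ ⟨_, h 1⟩ ⟨_, h 2⟩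
  have hC' : Dfn fun v : Fin 3 → M => C' (v 0) (v 1) (v 2) := by
    refine (Dfn.relativize hC).congr fun v => ?_
    have : v = ![v 0, v 1, v 2] := by ext i; fin_cases i <;> rfl
    rw [this]
    exact Iff.rfl
  have hC'' : ∀ {n : ℕ} {F G H : (Fin n → M) → M} [DFun F] [DFun G] [DFun H],
      Dfn fun v => C' (F v) (G v) (H v) :=
    fun {_ _ _ _} [_] [_] [_] => hC'.app3 inferInstance inferInstance inferInstance
  -- The sequence in the old pair plays no role: the transition from `(x, a)` to `(y, b)` demands
  -- that `y` be the `b`-first successor of `x`.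
  obtain ⟨w, f, hw, hf, hfR⟩ := hDC (prod X.1 A.1) (sep (prod (prod X.1 A.1) (prod X.1 A.1))
    fun p => C' (fst (fst p)) (fst (snd p)) (snd (snd p))) (by
      obtain ⟨_, a, _, ha, _⟩ := hchoice x₁ hx₁
      exact ⟨opair x₁.1 a.1, opair_mem_prod.2 ⟨hx₁, ha⟩⟩) (by
      intro p hp
      obtain ⟨x, hx, a, ha, rfl⟩ := mem_prod.1 hp
      obtain ⟨y, b, hy, hb, h⟩ := hchoice ⟨x, prop_of_mem X hx⟩ hx
      refine ⟨opair y.1 b.1, opair_mem_prod.2 ⟨hy, hb⟩, pairMem_iff.2 (mem_sep.2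
        ⟨opair_mem_prod.2 ⟨hp, opair_mem_prod.2 ⟨hy, hb⟩⟩, ?_⟩)⟩
      simp only [fst_opair, snd_opair]
      refine ⟨fun i => ?_, h⟩
      fin_cases i
      · exact prop_of_mem X hx
      · exact y.2
      · exact b.2)
  obtain rfl := isOmega_iff.1 hw
  have hfst : ∀ n, n ε (omega : M) → fst (app f n) ε X.1 ∧ snd (app f n) ε A.1 := by
    intro n hn
    obtain ⟨x, hx, a, ha, h⟩ := mem_prod.1 (hf.app_mem hn)
    rw [h, fst_opair, snd_opair]
    exact ⟨hx, ha⟩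
  have hstep : ∀ n, n ε (omega : M) →
      C' (fst (app f n)) (fst (app f (succ n))) (snd (app f (succ n))) := by
    intro n hn
    have := hfR n (succ n) _ _ hn (isSucc_iff.2 rfl) (pairMem_iff.2 (hf.opair_app hn))
      (pairMem_iff.2 (hf.opair_app (succ_mem_omega hn)))
    simpa using (mem_sep.1 (pairMem_iff.1 this)).2
  have hr : DFun fun v : Fin 1 → M => (fun n => snd (app f n)) (v 0) := by
    dsimp only; infer_instance
  have hr' : ∀ n, n ε (omega : M) → IsFun mem (snd (app f n)) omega θ := by
    intro n hn
    have := (hfst n hn).2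
    rwa [hA, mem_funs] at this
  -- The coding takes place in `V`. The code is again a function from `ω` to `θ`, hence a member of
  -- `A` and so of `L(A)`.
  have hcode : enc P.1 Q.1 (fun n => snd (app f n)) ε A.1 := by
    rw [hA, mem_funs]
    exact hPQ.val.isFun_enc hr hr'
  let h : Inner (funs omega θ) := ⟨_, prop_of_mem A hcode⟩
  have hrow : ∀ {k}, k ε (omega : Inner (funs omega θ)) →
      (row P Q h k).1 = snd (app f k.1) := fun hk => val_row_enc hPQ hr hr' rfl hk
  -- Recursion inside `L(A)` from `x_0` and `h`. The passage from `n` to `n + 1` uses row `n + 1`,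
  -- because in the sequence from `DC` the second component justifies the first component of the
  -- same pair.
  obtain ⟨e, he, he0, hes⟩ := exists_nat_rec
    (⟨fst (app f empty), prop_of_mem X (hfst empty (by simp)).1⟩ : Inner (funs omega θ))
    (S := fun n x => first (rules A P Q) (row P Q h (succ n)) (S x)) (by
      simp only [S]; infer_instance)
  let g := lam omega e
  have hg : ∀ {n}, n ε (omega : Inner (funs omega θ)) → app g n = e n :=
    fun hn => app_lam hn
  -- The sequence computed in `L(A)` is the one that `DC` gave in `V`, as each step is determined by
  -- `x_n` and row `n + 1`.
  have hgf : ∀ n, n ε (omega : M) → app g.1 n = fst (app f n) := by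
    intro n hn
    refine nat_induction (P := fun n => app g.1 n = fst (app f n)) ?_ (fun n hn ih => ?_) hn
    · rw [← val_empty (P := InL mem (funs omega θ)), ← val_app, hg (by simp), he0]
      simp
    · let n' : Inner (funs omega θ) := ⟨n, prop_nat hn⟩
      have hn' : n' ε (omega : Inner (funs omega θ)) := mem_omega_val.1 hn
      have hs' := succ_mem_omega hn'
      obtain ⟨h1, h2, _⟩ := hstep n hn
      have h3 : e n' = ⟨fst (app f n), h1 0⟩ :=
        Subtype.ext (by rw [← hg hn', val_app]; exact ih)
      have h4 : row P Q h (succ n') = ⟨snd (app f (succ n)), h1 2⟩ :=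
        Subtype.ext (by rw [hrow hs', val_succ])
      have h5 := hes n' hn'
      rw [h3, h4] at h5
      have h6 := congrArg Subtype.val (h5.trans h2.symm)
      rw [← hg hs', val_app, val_succ] at h6
      exact h6
  refine ⟨omega, g, isOmega_iff.2 rfl, isFun_lam fun n hn => ?_, fun n m x y hn hm hx hy => ?_⟩
  · change (e n).1 ε X.1
    rw [← hg hn, val_app, hgf _ (mem_omega_val.2 hn)]
    exact (hfst _ (mem_omega_val.2 hn)).1
  · obtain rfl := isSucc_iff.1 hm
    have hn1 := mem_omega_val.2 hn
    have hx' := (opair_mem_lam.1 (pairMem_iff.1 hx)).2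
    have hy' := (opair_mem_lam.1 (pairMem_iff.1 hy)).2
    obtain ⟨h1, _, h2⟩ := hstep n.1 hn1
    have h3 : x = ⟨fst (app f n.1), h1 0⟩ :=
      Subtype.ext (by rw [hx', ← hg hn, val_app]; exact hgf _ hn1)
    have h4 : y = ⟨fst (app f (succ n.1)), h1 1⟩ := Subtype.ext (by
      rw [hy', ← hg (succ_mem_omega hn), val_app, val_succ]; exact hgf _ (succ_mem_omega hn1))
    rw [h3, h4]
    exact pairMem_iff.2 (mem_sep.1 h2).2

end
end SetModel

namespace SetModel
universe u
open SetStr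

/-! ### The models `L(θ^ω)` and the Chang model -/

section
variable {M : Type u} [SetStr M] [ZFM M]

theorem inLOmegaPower_iff {θ x : M} : InLOmegaPower mem θ x ↔ InL mem (funs omega θ) x := by
  have : ∀ A, IsOmegaPower mem θ A ↔ A = funs omega θ := fun A => by
    simp only [IsOmegaPower, isOmega_iff, exists_eq_left, ← mem_funs]
    exact ⟨ext, fun h f => by rw [h]⟩
  simp [InLOmegaPower, this]

theorem prop_funs {P : M → Prop} [TransClass P] [ZFM {x // P x}] {θ : M} (hθ : P θ)
    (h : ∀ f, IsFun mem f omega θ → P f) : P (funs omega θ) := by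
  have : (funs omega (⟨θ, hθ⟩ : {x // P x})).1 = funs omega θ := by
    refine val_eq (fun w => ?_) fun w hw => h w (mem_funs.1 hw)
    rw [mem_funs, mem_funs, isFun_val, val_omega]
  exact this ▸ (funs omega (⟨θ, hθ⟩ : {x // P x})).2

/-- Each function `ω → θ` is a member of `θ'^ω`, so `L(θ'^ω)` computes `θ^ω` correctly and contains
it; it therefore contains all of `L(θ^ω)`. -/
theorem inL_funs_mono {θ θ' x : M} (hθ : IsOrd mem θ) (h : IsSubset mem θ θ')
    (hx : InL mem (funs omega θ) x) : InL mem (funs omega θ') x :=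
  inL_of_inL (prop_funs (inL_ord _ hθ) fun _ hf => (inL_self _).trans (mem_funs.2 (hf.mono h))) hx

/-- The only function `ω → 1` is constant zero, and this belongs to `L(0^ω)`. The case `θ = 0`, in
which there is no sequence to code with, thus reduces to `θ = 1`. -/
theorem inL_funs_empty_iff {x : M} :
    InL mem (funs omega empty) x ↔ InL mem (funs omega (succ empty)) x := by
  refine ⟨inL_funs_mono isOrd_empty fun z hz => (not_mem_empty hz).elim,
    inL_of_inL (prop_funs (inL_ord _ isOrd_empty.succ) fun f hf => ?_)⟩
  let c : Inner (funs omega (empty : M)) := lam omega fun _ => empty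
  have hc : IsFun mem c omega (succ empty) := isFun_lam fun _ _ => by simp
  have hc' := isFun_val.1 hc
  rw [val_omega] at hc'
  have : c.1 = f := hc'.funext hf fun n hn => by
    have h1 := hc'.app_mem hn
    have h2 := hf.app_mem hn
    rw [val_succ, val_empty] at h1
    simp only [mem_succ, not_mem_empty, false_or] at h1 h2
    rw [h1, h2]
  exact this ▸ c.2

theorem dc_inL (hDC : DC (mem : M → M → Prop)) {θ : M} (hθ : IsOrd mem θ) :
    DC (restrict mem (InL mem (funs omega θ))) := by
  rcases ord_trichotomy isOrd_empty hθ with h | rfl | h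
  · exact dc_inL_funs hDC hθ h
  · rw [show InL mem (funs omega empty) = InL mem (funs omega (succ (empty : M))) from
      funext fun _ => propext inL_funs_empty_iff]
    exact dc_inL_funs hDC isOrd_empty.succ (by simp)
  · exact (not_mem_empty h).elim

/-! ### The Chang model -/

theorem inChang_iff {x : M} :
    InChang mem x ↔ ∃ θ, IsOrd mem θ ∧ InL mem (funs omega θ) x := by
  simp only [InChang, inLOmegaPower_iff]

instance InChang.transClass : TransClass (InChang (mem : M → M → Prop)) where
  trans hx hy := by
    obtain ⟨θ, hθ, hx⟩ := inChang_iff.1 hx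
    exact inChang_iff.2 ⟨θ, hθ, hx.trans hy⟩

theorem isOmega_of_val_eq {P : M → Prop} [TransClass P] {w : {x // P x}} (h : w.1 = omega) :
    IsOmega mem w := by
  have hw := isOmega_iff.2 h
  exact ⟨isInductive_val.2 hw.1, fun v hv => isSubset_val.2 (hw.2 _ (isInductive_val.1 hv))⟩

/-- The models `L(θ^ω)` increase with `θ`, so `X` and `R` lie in a common one, whose `DC` supplies
the sequence. Its properties pass to the Chang model by transitivity alone, without `ZF` holding
there. -/
theorem dc_inChang (hDC : DC (mem : M → M → Prop)) :
    DC (restrict mem (InChang (mem : M → M → Prop))) := by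
  change DC (mem : {x // InChang (mem : M → M → Prop) x} → _ → Prop)
  intro X R ⟨x₁, hx₁⟩ htot
  have key : ∃ θ, IsOrd mem θ ∧ InL mem (funs omega θ) X.1 ∧ InL mem (funs omega θ) R.1 := by
    obtain ⟨θ₁, h₁, hX⟩ := inChang_iff.1 X.2
    obtain ⟨θ₂, h₂, hR⟩ := inChang_iff.1 R.2
    rcases ord_trichotomy h₁ h₂ with h | rfl | h
    · exact ⟨θ₂, h₂, inL_funs_mono h₁ (h₂.1 _ h) hX, hR⟩
    · exact ⟨θ₁, h₁, hX, hR⟩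
    · exact ⟨θ₁, h₁, hX, inL_funs_mono h₂ (h₁.1 _ h) hR⟩
  obtain ⟨θ, hθ, hX, hR⟩ := key
  have up : ∀ {x}, InL mem (funs omega θ) x → InChang mem x := fun h => inChang_iff.2 ⟨θ, hθ, h⟩
  have hL : DC (mem : Inner (funs omega θ) → _ → Prop) := dc_inL hDC hθ
  obtain ⟨w, f, hw, hf, hfR⟩ := hL ⟨X.1, hX⟩ ⟨R.1, hR⟩ ⟨⟨x₁.1, hX.trans hx₁⟩, hx₁⟩ (by
    intro x hx
    obtain ⟨y, hy, h⟩ := htot ⟨x.1, up x.2⟩ hx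
    have h' := pairMem_val.1 h
    exact ⟨⟨y.1, hX.trans hy⟩, hy, pairMem_val.2 h'⟩)
  have hw' : w.1 = omega := by rw [isOmega_iff.1 hw, val_omega]
  have hf' := isFun_val.1 hf
  refine ⟨⟨w.1, up w.2⟩, ⟨f.1, up f.2⟩, isOmega_of_val_eq hw', isFun_val.2 hf',
    fun n m x y hn hm hx hy => ?_⟩
  have hx' := pairMem_val.1 hx
  have hy' := pairMem_val.1 hy
  obtain ⟨hn1, hx1⟩ := prop_of_pairMem f hx'
  obtain ⟨hm1, hy1⟩ := prop_of_pairMem f hy'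
  have hm' := isSucc_val.1 hm
  have hxy := pairMem_val.1 (hfR ⟨n.1, hn1⟩ ⟨m.1, hm1⟩ ⟨x.1, hx1⟩ ⟨y.1, hy1⟩ hn
    (isSucc_val.2 hm') (pairMem_val.2 hx') (pairMem_val.2 hy'))
  exact pairMem_val.2 hxy

end
end SetModel

theorem mainTheorem7 {M : Type*} (E : M → M → Prop)
    (hZF : SetModel.ZF E) (hDC : SetModel.DC E) :
    (∀ θ : M, SetModel.IsOrd E θ →
      SetModel.DC (SetModel.restrict E (SetModel.InLOmegaPower E θ))) ∧
    SetModel.DC (SetModel.restrict E (SetModel.InChang E)) := by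
  let _ : SetModel.SetStr M := ⟨E⟩
  have : SetModel.ZFM M := SetModel.ZF.zfm hZF
  refine ⟨fun θ hθ => ?_, SetModel.dc_inChang hDC⟩
  rw [show SetModel.InLOmegaPower E θ = SetModel.InL E (SetModel.funs SetModel.omega θ) from
    funext fun _ => propext SetModel.inLOmegaPower_iff]
  exact SetModel.dc_inL hDC hθ
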